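/- Let $d \ge 1$ and let $V:\mathbb{R}^d\to\mathbb{R}$ be such that $V\in L^1_{\mathrm{loc}}(\mathbb{R}^d)$ and $|V|$ is relatively form-bounded with respect to $-\Delta$ with relative bound less than one: there are $a<1$ and $C\ge 0$ with $\int |V||\psi|^2 \le a\int|\nabla\psi|^2 + C\int|\psi|^2$ for all $\psi\in W^{1,2}(\mathbb{R}^d)$. Let $H_{0,V}=-\Delta+V$ be the self-adjoint operator in the complex Hilbert space $L^2(\mathbb{R}^d)$ associated with the closed form $h_V(\phi,\psi)=\int\overline{\nabla\phi}\cdot\nabla\psi+\int V\,\overline{\phi}\,\psi$ with form domain $W^{1,2}(\mathbb{R}^d)$. Assume that (i) or (ii) holds. (i) $V\in W^{1,p}_{\mathrm{loc}}(\mathbb{R}^d)$, where $p=1$ if $d=1$, $p>1$ (for some such $p$) if $d=2$, and $p=d/2$ if $d\ge3$; and there exists $b<2$ such that for all $\psi\in W^{1,2}(\mathbb{R}^d)$ $$\int_{\mathbb{R}^d}(x\cdot\nabla V)_+\,|\psi|^2\le b\int_{\mathbb{R}^d}|\nabla\psi|^2 ,$$ where $\nabla V$ is the weak gradient and $(\cdot)_+$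 denotes the positive part. (ii) There exists $b<\frac{2}{d+2}$ such that for all $\psi\in W^{1,2}(\mathbb{R}^d)$ $$\int_{\mathbb{R}^d}|V|\,|\psi|^2\le b\int_{\mathbb{R}^d}|\nabla\psi|^2 \qquad\text{and}\qquad \int_{\mathbb{R}^d}|x|^2\,|V|^2\,|\psi|^2\le b^2\int_{\mathbb{R}^d}|\nabla\psi|^2 .$$ Then $H_{0,V}$ has no eigenvalues: $\sigma_{\mathrm p}(H_{0,V})=\varnothing$. -/

import Mathlib

open MeasureTheory
open scoped ENNReal NNReal ContDiff ComplexConjugate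

noncomputable section

namespace Schrodinger

/-- The Euclidean space `ℝ^d`. -/
abbrev E (d : ℕ) : Type := EuclideanSpace ℝ (Fin d)

/-- `p`-integrability on compact sets, i.e. membership in `L^p_loc(ℝ^d)`. -/
def LocMemLp {d : ℕ} {F : Type*} [NormedAddCommGroup F] (u : E d → F) (p : ℝ≥0∞) : Prop :=
  ∀ K : Set (E d), IsCompact K → MemLp u p (volume.restrict K)

/-- `g` is the gradient of `u` in the sense of distributions:
`∫ (∂_i φ) u = - ∫ φ g_i` for every real test function `φ ∈ C_c^∞(ℝ^d)` and every `i`. -/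
structure HasWeakGradient {d : ℕ} {𝕜 : Type*} [RCLike 𝕜]
    (u : E d → 𝕜) (g : E d → EuclideanSpace 𝕜 (Fin d)) : Prop where
  locallyIntegrable : LocallyIntegrable u volume
  locallyIntegrable_grad : LocallyIntegrable g volume
  integral_eq : ∀ φ : E d → ℝ, ContDiff ℝ ∞ φ → HasCompactSupport φ → ∀ i : Fin d,
    ∫ x, (fderiv ℝ φ x (EuclideanSpace.single i 1)) • u x = - ∫ x, φ x • g x i

section WeakGradient

variable {d : ℕ} {𝕜 : Type*} [RCLike 𝕜]

theorem locallyIntegrable_coord {g : E d → EuclideanSpace 𝕜 (Fin d)}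
    (hg : LocallyIntegrable g volume) (i : Fin d) :
    LocallyIntegrable (fun x => g x i) volume := by
  intro x
  obtain ⟨s, hs, hi⟩ := hg x
  exact ⟨s, hs, (EuclideanSpace.proj i : EuclideanSpace 𝕜 (Fin d) →L[𝕜] 𝕜).integrable_comp hi⟩

theorem continuous_partial {φ : E d → ℝ} (hφ : ContDiff ℝ ∞ φ) (v : E d) :
    Continuous (fun x => fderiv ℝ φ x v) :=
  (hφ.continuous_fderiv (by simp)).clm_apply continuous_const

theorem hasCompactSupport_partial {φ : E d → ℝ} (hφ : HasCompactSupport φ) (v : E d) :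
    HasCompactSupport (fun x => fderiv ℝ φ x v) :=
  hφ.fderiv_apply ℝ v

theorem HasWeakGradient.add {u v : E d → 𝕜} {g h : E d → EuclideanSpace 𝕜 (Fin d)}
    (hu : HasWeakGradient u g) (hv : HasWeakGradient v h) :
    HasWeakGradient (fun x => u x + v x) (fun x => g x + h x) where
  locallyIntegrable := hu.1.add hv.1
  locallyIntegrable_grad := hu.2.add hv.2
  integral_eq φ hφ hc i := by
    have a1 := hu.1.integrable_smul_left_of_hasCompactSupport
      (continuous_partial hφ (EuclideanSpace.single i 1)) (hasCompactSupport_partial hc _)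
    have a2 := hv.1.integrable_smul_left_of_hasCompactSupport
      (continuous_partial hφ (EuclideanSpace.single i 1)) (hasCompactSupport_partial hc _)
    have b1 := (locallyIntegrable_coord hu.2 i).integrable_smul_left_of_hasCompactSupport
      hφ.continuous hc
    have b2 := (locallyIntegrable_coord hv.2 i).integrable_smul_left_of_hasCompactSupport
      hφ.continuous hc
    simp only [smul_add, PiLp.add_apply]
    rw [integral_add a1 a2, integral_add b1 b2, hu.3 φ hφ hc i, hv.3 φ hφ hc i]
    ring

theorem HasWeakGradient.const_smul {u : E d → 𝕜} {g : E d → EuclideanSpace 𝕜 (Fin d)}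
    (hu : HasWeakGradient u g) (c : 𝕜) :
    HasWeakGradient (fun x => c • u x) (fun x => c • g x) where
  locallyIntegrable := hu.1.smul c
  locallyIntegrable_grad := hu.2.smul c
  integral_eq φ hφ hc i := by
    simp only [PiLp.smul_apply, smul_comm _ c]
    rw [integral_smul, integral_smul, hu.3 φ hφ hc i, smul_neg]

theorem HasWeakGradient.congr {u v : E d → 𝕜} {g h : E d → EuclideanSpace 𝕜 (Fin d)}
    (hu : HasWeakGradient u g) (huv : u =ᵐ[volume] v) (hgh : g =ᵐ[volume] h) :
    HasWeakGradient v h where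
  locallyIntegrable := (locallyIntegrable_congr huv).1 hu.1
  locallyIntegrable_grad := (locallyIntegrable_congr hgh).1 hu.2
  integral_eq φ hφ hc i := by
    have h1 : ∫ x, (fderiv ℝ φ x (EuclideanSpace.single i 1)) • v x
        = ∫ x, (fderiv ℝ φ x (EuclideanSpace.single i 1)) • u x :=
      integral_congr_ae (huv.mono fun x hx => by simp only [hx])
    have h2 : ∫ x, φ x • h x i = ∫ x, φ x • g x i :=
      integral_congr_ae (hgh.mono fun x hx => by simp only [hx])
    rw [h1, h2, hu.3 φ hφ hc i]

/-- Weak gradients are unique almost everywhere. -/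
theorem HasWeakGradient.unique {u : E d → 𝕜} {g h : E d → EuclideanSpace 𝕜 (Fin d)}
    (hg : HasWeakGradient u g) (hh : HasWeakGradient u h) : g =ᵐ[volume] h := by
  have key : ∀ i : Fin d, ∀ᵐ x, g x i = h x i := fun i =>
    ae_eq_of_integral_contDiff_smul_eq (locallyIntegrable_coord hg.2 i)
      (locallyIntegrable_coord hh.2 i) (fun φ hφ hc => by
        have := (hg.3 φ hφ hc i).symm.trans (hh.3 φ hφ hc i)
        exact neg_injective this)
  filter_upwards [ae_all_iff.2 key] with x hx
  ext i
  exact hx i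

end WeakGradient

/-- The complex Hilbert space `L²(ℝ^d)`. -/
abbrev L2 (d : ℕ) : Type := Lp ℂ 2 (volume : Measure (E d))

/-- The Hilbert space `L²(ℝ^d; ℂ^d)`. -/
abbrev L2Vec (d : ℕ) : Type := Lp (EuclideanSpace ℂ (Fin d)) 2 (volume : Measure (E d))

/-- The Sobolev space `W^{1,2}(ℝ^d)` of complex functions, as a subspace of `L²(ℝ^d)`. -/
def W12 (d : ℕ) : Submodule ℂ (L2 d) where
  carrier := {ψ | ∃ g : L2Vec d, HasWeakGradient (ψ : E d → ℂ) g}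
  add_mem' := by
    rintro ψ χ ⟨g, hg⟩ ⟨h, hh⟩
    exact ⟨g + h, (hg.add hh).congr (Lp.coeFn_add ψ χ).symm (Lp.coeFn_add g h).symm⟩
  zero_mem' := by
    refine ⟨0, HasWeakGradient.congr (u := fun _ => 0) (g := fun _ => 0) ⟨?_, ?_, ?_⟩
      (Lp.coeFn_zero _ _ _).symm (Lp.coeFn_zero _ _ _).symm⟩
    · exact locallyIntegrable_zero
    · exact locallyIntegrable_zero
    · intro φ _ _ i
      simp
  smul_mem' := by
    rintro c ψ ⟨g, hg⟩
    exact ⟨c • g, (hg.const_smul c).congr (Lp.coeFn_smul c ψ).symm (Lp.coeFn_smul c g).symm⟩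

/-- The weak gradient `∇ : W^{1,2}(ℝ^d) → L²(ℝ^d; ℂ^d)`. -/
def grad {d : ℕ} (ψ : W12 d) : L2Vec d := ψ.2.choose

theorem grad_spec {d : ℕ} (ψ : W12 d) :
    HasWeakGradient ((ψ : L2 d) : E d → ℂ) (grad ψ) := ψ.2.choose_spec

theorem grad_eq {d : ℕ} {ψ : W12 d} {g : L2Vec d}
    (hg : HasWeakGradient ((ψ : L2 d) : E d → ℂ) g) : grad ψ = g :=
  Lp.ext ((grad_spec ψ).unique hg)

theorem grad_add {d : ℕ} (ψ χ : W12 d) : grad (ψ + χ) = grad ψ + grad χ :=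
  grad_eq (((grad_spec ψ).add (grad_spec χ)).congr
    (Lp.coeFn_add (ψ : L2 d) χ).symm (Lp.coeFn_add _ _).symm)

theorem grad_smul {d : ℕ} (c : ℂ) (ψ : W12 d) : grad (c • ψ) = c • grad ψ :=
  grad_eq (((grad_spec ψ).const_smul c).congr
    (Lp.coeFn_smul c (ψ : L2 d)).symm (Lp.coeFn_smul c (grad ψ)).symm)

theorem grad_zero {d : ℕ} : grad (0 : W12 d) = 0 := by
  simpa using grad_smul (0 : ℂ) (0 : W12 d)

/-- `∫ w |ψ|²` for a weight `w` with values in `[0, ∞]`. -/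
def weightedMass {d : ℕ} (w : E d → ℝ≥0∞) (ψ : W12 d) : ℝ≥0∞ :=
  ∫⁻ x, w x * ‖(ψ : L2 d) x‖ₑ ^ 2

/-- The Dirichlet integral `∫ |∇ψ|²`. -/
def dirichlet {d : ℕ} (ψ : W12 d) : ℝ≥0∞ := ∫⁻ x, ‖grad ψ x‖ₑ ^ 2

/-- Admissible electric potentials: `V ∈ L^1_loc`, and `|V|` is form-bounded with respect
to `-Δ` with relative bound less than one. -/
structure IsAdmissible {d : ℕ} (V : E d → ℝ) : Prop where
  locallyIntegrable : LocallyIntegrable V volume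
  formBounded : ∃ a C : ℝ≥0, a < 1 ∧ ∀ ψ : W12 d,
    weightedMass (fun x => ‖V x‖ₑ) ψ ≤ a * dirichlet ψ + C * weightedMass (fun _ => 1) ψ

theorem weightedMass_one_lt_top {d : ℕ} (ψ : W12 d) : weightedMass (fun _ => 1) ψ < ⊤ := by
  have h := (Lp.memLp (ψ : L2 d)).eLpNorm_lt_top
  rw [eLpNorm_lt_top_iff_lintegral_rpow_enorm_lt_top (by simp) (by simp)] at h
  simpa [weightedMass] using h

theorem dirichlet_lt_top {d : ℕ} (ψ : W12 d) : dirichlet ψ < ⊤ := by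
  have h := (Lp.memLp (grad ψ)).eLpNorm_lt_top
  rw [eLpNorm_lt_top_iff_lintegral_rpow_enorm_lt_top (by simp) (by simp)] at h
  simpa [dirichlet] using h

theorem IsAdmissible.weightedMass_lt_top {d : ℕ} {V : E d → ℝ} (hV : IsAdmissible V)
    (ψ : W12 d) : weightedMass (fun x => ‖V x‖ₑ) ψ < ⊤ := by
  obtain ⟨a, C, -, h⟩ := hV.formBounded
  exact (h ψ).trans_lt (ENNReal.add_lt_top.2
    ⟨ENNReal.mul_lt_top (by simp) (dirichlet_lt_top ψ),
      ENNReal.mul_lt_top (by simp) (weightedMass_one_lt_top ψ)⟩)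

/-- For admissible `V`, the function `V φ̄ ψ` is integrable for all `φ, ψ ∈ W^{1,2}`. -/
theorem IsAdmissible.integrable {d : ℕ} {V : E d → ℝ} (hV : IsAdmissible V) (φ ψ : W12 d) :
    Integrable (fun x => (V x : ℂ) * (conj ((φ : L2 d) x) * (ψ : L2 d) x)) volume := by
  have hVm : AEStronglyMeasurable (fun x => (V x : ℂ)) volume :=
    Complex.continuous_ofReal.comp_aestronglyMeasurable hV.locallyIntegrable.aestronglyMeasurable
  have hφm := (Lp.memLp (φ : L2 d)).aestronglyMeasurable
  have hψm := (Lp.memLp (ψ : L2 d)).aestronglyMeasurable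
  refine ⟨hVm.mul ((Complex.continuous_conj.comp_aestronglyMeasurable hφm).mul hψm), ?_⟩
  have hsq : ∀ a b : ℝ≥0∞, a * b ≤ a ^ 2 + b ^ 2 := by
    intro a b
    rcases le_total a b with h | h
    · calc a * b ≤ b * b := by gcongr
        _ = b ^ 2 := (sq b).symm
        _ ≤ _ := le_add_self
    · calc a * b ≤ a * a := by gcongr
        _ = a ^ 2 := (sq a).symm
        _ ≤ _ := le_self_add
  have hmeas : AEMeasurable (fun x => ‖V x‖ₑ * ‖(φ : L2 d) x‖ₑ ^ 2) volume :=
    hV.locallyIntegrable.aestronglyMeasurable.enorm.mul (hφm.enorm.pow_const 2)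
  calc ∫⁻ x, ‖(V x : ℂ) * (conj ((φ : L2 d) x) * (ψ : L2 d) x)‖ₑ
      ≤ ∫⁻ x, (‖V x‖ₑ * ‖(φ : L2 d) x‖ₑ ^ 2 + ‖V x‖ₑ * ‖(ψ : L2 d) x‖ₑ ^ 2) := by
        refine lintegral_mono fun x => ?_
        have h1 : ‖(V x : ℂ)‖ₑ = ‖V x‖ₑ := by
          rw [← ofReal_norm, ← ofReal_norm, Complex.norm_real]
        have h2 : ‖conj ((φ : L2 d) x)‖ₑ = ‖(φ : L2 d) x‖ₑ := by
          rw [← ofReal_norm, ← ofReal_norm, RCLike.norm_conj]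
        rw [enorm_mul, enorm_mul, h1, h2, ← mul_add]
        gcongr
        exact hsq _ _
    _ = weightedMass (fun x => ‖V x‖ₑ) φ + weightedMass (fun x => ‖V x‖ₑ) ψ :=
        lintegral_add_left' hmeas _
    _ < ⊤ := ENNReal.add_lt_top.2 ⟨hV.weightedMass_lt_top φ, hV.weightedMass_lt_top ψ⟩

/-- The sesquilinear form `h_V(φ, ψ) = ∫ ∇φ̄ · ∇ψ + ∫ V φ̄ ψ` on `W^{1,2}(ℝ^d)`
(linear in the second argument). -/
def energyForm {d : ℕ} (V : E d → ℝ) (φ ψ : W12 d) : ℂ :=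
  inner ℂ (grad φ) (grad ψ) + ∫ x, (V x : ℂ) * (conj ((φ : L2 d) x) * (ψ : L2 d) x)

theorem energyForm_add {d : ℕ} {V : E d → ℝ} (hV : IsAdmissible V) (φ ψ χ : W12 d) :
    energyForm V φ (ψ + χ) = energyForm V φ ψ + energyForm V φ χ := by
  have h : ∫ x, (V x : ℂ) * (conj ((φ : L2 d) x) * ((ψ + χ : W12 d) : L2 d) x)
      = ∫ x, ((V x : ℂ) * (conj ((φ : L2 d) x) * (ψ : L2 d) x)
        + (V x : ℂ) * (conj ((φ : L2 d) x) * (χ : L2 d) x)) := by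
    refine integral_congr_ae ?_
    filter_upwards [Lp.coeFn_add (ψ : L2 d) (χ : L2 d)] with x hx
    rw [Submodule.coe_add, hx, Pi.add_apply]
    ring
  rw [energyForm, h, integral_add (hV.integrable φ ψ) (hV.integrable φ χ), grad_add,
    inner_add_right, energyForm, energyForm]
  ring

theorem energyForm_smul {d : ℕ} (V : E d → ℝ) (φ : W12 d) (c : ℂ) (ψ : W12 d) :
    energyForm V φ (c • ψ) = c * energyForm V φ ψ := by
  have h : ∫ x, (V x : ℂ) * (conj ((φ : L2 d) x) * ((c • ψ : W12 d) : L2 d) x)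
      = ∫ x, c * ((V x : ℂ) * (conj ((φ : L2 d) x) * (ψ : L2 d) x)) := by
    refine integral_congr_ae ?_
    filter_upwards [Lp.coeFn_smul c (ψ : L2 d)] with x hx
    rw [Submodule.coe_smul, hx, Pi.smul_apply, smul_eq_mul]
    ring
  rw [energyForm, h, integral_const_mul, grad_smul, inner_smul_right, energyForm]
  ring

/-- The graph of the operator associated with the form `h_V`: the pairs `(ψ, η)` with
`ψ ∈ W^{1,2}(ℝ^d)`, `η ∈ L²(ℝ^d)` and `h_V(φ, ψ) = (φ, η)` for all `φ ∈ W^{1,2}(ℝ^d)`. -/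
def hamiltonianGraph {d : ℕ} (V : E d → ℝ) (hV : IsAdmissible V) :
    Submodule ℂ (L2 d × L2 d) where
  carrier := {q | ∃ ψ : W12 d, (ψ : L2 d) = q.1 ∧
    ∀ φ : W12 d, energyForm V φ ψ = inner ℂ (φ : L2 d) q.2}
  add_mem' := by
    rintro ⟨a, b⟩ ⟨a', b'⟩ ⟨ψ, h1, h2⟩ ⟨χ, h3, h4⟩
    refine ⟨ψ + χ, by simp_all, fun φ => ?_⟩
    rw [energyForm_add hV, h2, h4, Prod.snd_add, inner_add_right]
  zero_mem' := by
    refine ⟨0, rfl, fun φ => ?_⟩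
    have := energyForm_smul V φ 0 0
    simpa using this
  smul_mem' := by
    rintro c ⟨a, b⟩ ⟨ψ, h1, h2⟩
    refine ⟨c • ψ, by simp_all, fun φ => ?_⟩
    rw [energyForm_smul, h2, Prod.smul_snd, inner_smul_right]

/-- The Schrödinger operator `H_{0,V} = -Δ + V` in `L²(ℝ^d)`, i.e. the (self-adjoint) operator
associated with the closed form `h_V` with form domain `W^{1,2}(ℝ^d)`. -/
def hamiltonian {d : ℕ} (V : E d → ℝ) (hV : IsAdmissible V) : L2 d →ₗ.[ℂ] L2 d :=
  (hamiltonianGraph V hV).toLinearPMap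

/-- Test functions belong to `W^{1,2}(ℝ^d)`. -/
theorem exists_W12_of_test {d : ℕ} {φ : E d → ℝ} (hφ : ContDiff ℝ ∞ φ)
    (hc : HasCompactSupport φ) :
    ∃ ψ : W12 d, ((ψ : L2 d) : E d → ℂ) =ᵐ[volume] fun x => (φ x : ℂ) := by
  have hcont : Continuous fun x => (φ x : ℂ) := Complex.continuous_ofReal.comp hφ.continuous
  have hcs : HasCompactSupport fun x => (φ x : ℂ) :=
    hc.comp_left (g := fun r : ℝ => (r : ℂ)) (by simp)
  have hm : MemLp (fun x => (φ x : ℂ)) 2 volume := hcont.memLp_of_hasCompactSupport hcs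
  let g : E d → EuclideanSpace ℂ (Fin d) := fun x =>
    WithLp.toLp 2 fun i => ((fderiv ℝ φ x (EuclideanSpace.single i 1) : ℝ) : ℂ)
  have hgc : Continuous g := by
    refine (PiLp.continuous_toLp 2 _).comp (continuous_pi fun i => ?_)
    exact Complex.continuous_ofReal.comp (continuous_partial hφ _)
  have hgs : HasCompactSupport g := by
    have h0 : HasCompactSupport (fderiv ℝ φ) := hc.fderiv ℝ
    refine h0.mono ?_
    intro x hx h
    apply hx
    ext i
    simp [g, h]
  have hgm : MemLp g 2 volume := hgc.memLp_of_hasCompactSupport hgs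
  have hw : HasWeakGradient (fun x => (φ x : ℂ)) g := by
    refine ⟨hcont.locallyIntegrable, hgc.locallyIntegrable, fun χ hχ hχc i => ?_⟩
    have h := integral_mul_fderiv_eq_neg_fderiv_mul_of_integrable (𝕜 := ℝ)
      (μ := (volume : Measure (E d))) (f := χ) (g := φ) (v := EuclideanSpace.single i 1)
      (Continuous.integrable_of_hasCompactSupport
        ((continuous_partial hχ _).mul hφ.continuous) (hc.mul_left))
      (Continuous.integrable_of_hasCompactSupport
        (hχ.continuous.mul (continuous_partial hφ _)) (hχc.mul_right))
      (Continuous.integrable_of_hasCompactSupport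
        (hχ.continuous.mul hφ.continuous) (hχc.mul_right))
      (fun x _ => hχ.differentiable (by simp) x) (fun x _ => hφ.differentiable (by simp) x)
    have e1 : ∀ x, (fderiv ℝ χ x (EuclideanSpace.single i 1)) • (φ x : ℂ)
        = ((fderiv ℝ χ x (EuclideanSpace.single i 1) * φ x : ℝ) : ℂ) := by
      intro x; simp
    have e2 : ∀ x, χ x • g x i
        = ((χ x * fderiv ℝ φ x (EuclideanSpace.single i 1) : ℝ) : ℂ) := by
      intro x; simp [g]
    simp only [e1, e2, integral_complex_ofReal, h]
    simp
  exact ⟨⟨hm.toLp _, hgm.toLp _, hw.congr hm.coeFn_toLp.symm hgm.coeFn_toLp.symm⟩,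
    hm.coeFn_toLp⟩

/-- The operator is well defined: `η = Hψ` is determined by `ψ`. -/
theorem hamiltonianGraph_functional {d : ℕ} {V : E d → ℝ} (hV : IsAdmissible V) :
    ∀ q ∈ hamiltonianGraph V hV, q.1 = 0 → q.2 = 0 := by
  rintro ⟨a, η⟩ ⟨ψ, h1, h2⟩ ha
  simp only at h1 h2 ha
  have hψ : ψ = 0 := Subtype.ext (h1.trans ha)
  subst hψ
  have h0 : ∀ φ : W12 d, inner ℂ (φ : L2 d) η = 0 := by
    intro φ
    rw [← h2 φ]
    simpa using energyForm_smul V φ 0 0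
  have hη : LocallyIntegrable (η : E d → ℂ) volume :=
    (Lp.memLp η).locallyIntegrable (by norm_num)
  have : ∀ᵐ x, (η : E d → ℂ) x = 0 := by
    refine ae_eq_zero_of_integral_contDiff_smul_eq_zero hη fun φ hφ hc => ?_
    obtain ⟨χ, hχ⟩ := exists_W12_of_test hφ hc
    rw [← h0 χ, L2.inner_def]
    refine integral_congr_ae (hχ.mono fun x hx => ?_)
    simp only [hx]
    simp [mul_comm]
  refine Lp.ext ?_
  filter_upwards [this, Lp.coeFn_zero ℂ 2 (volume : Measure (E d))] with x hx h0
  rw [hx, h0, Pi.zero_apply]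

/-- `ψ ∈ D(H)` and `Hψ = η` iff `ψ ∈ W^{1,2}` and `h_V(φ, ψ) = (φ, η)` for all `φ ∈ W^{1,2}`. -/
theorem hamiltonian_graph {d : ℕ} {V : E d → ℝ} (hV : IsAdmissible V) :
    (hamiltonian V hV).graph = hamiltonianGraph V hV :=
  Submodule.toLinearPMap_graph_eq _ fun q h h' => hamiltonianGraph_functional hV q h h'

/-- The point spectrum: the set of eigenvalues of an (unbounded) operator `H` in `L²(ℝ^d)`. -/
def pointSpectrum {d : ℕ} (H : L2 d →ₗ.[ℂ] L2 d) : Set ℂ :=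
  {z | ∃ ψ : H.domain, (ψ : L2 d) ≠ 0 ∧ H ψ = z • (ψ : L2 d)}

/-- `V ∈ W^{1,p}_loc(ℝ^d)` with weak gradient `G`, where `p = 1` if `d = 1`, `p > 1` if `d = 2`
and `p = d / 2` if `d ≥ 3`. -/
def ExtraRegularity {d : ℕ} (V : E d → ℝ) (G : E d → E d) : Prop :=
  ∃ p : ℝ≥0∞, (d = 1 → p = 1) ∧ (d = 2 → 1 < p) ∧ (3 ≤ d → p = (d : ℝ≥0∞) / 2) ∧
    HasWeakGradient V G ∧ LocMemLp V p ∧ LocMemLp G p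

/-- `∃ b < 2, ∀ ψ ∈ W^{1,2}, ∫ (x · ∇V)_+ |ψ|² ≤ b ∫ |∇ψ|²`, where `G = ∇V`. -/
def Repulsive {d : ℕ} (G : E d → E d) : Prop :=
  ∃ b : ℝ≥0, b < 2 ∧ ∀ ψ : W12 d,
    weightedMass (fun x => ENNReal.ofReal (max (inner ℝ x (G x)) 0)) ψ ≤ b * dirichlet ψ

/-- `∃ b < 2 / (d + 2), ∀ ψ ∈ W^{1,2}, ∫ |V| |ψ|² ≤ b ∫ |∇ψ|²` and
`∫ |x|² |V|² |ψ|² ≤ b² ∫ |∇ψ|²`. -/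
def Small {d : ℕ} (V : E d → ℝ) : Prop :=
  ∃ b : ℝ≥0, b < 2 / ((d : ℝ≥0) + 2) ∧ ∀ ψ : W12 d,
    weightedMass (fun x => ‖V x‖ₑ) ψ ≤ b * dirichlet ψ ∧
    weightedMass (fun x => ‖x‖ₑ ^ 2 * ‖V x‖ₑ ^ 2) ψ ≤ (b : ℝ≥0∞) ^ 2 * dirichlet ψ

end Schrodinger

end

noncomputable section

namespace Schrodinger

/-! ### Scaling of integrals and `L²` norms under dilations. -/

section Dilation

variable {d : ℕ}

/-! The proof is a virial argument carried out with finite dilations, so that the unbounded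
generator `x · ∇` is never applied to an eigenfunction. Eigenvalues are real, since the quadratic
form is (`exists_isWeakSolution_of_mem_pointSpectrum`). Let `-Δu + Vu = μu`, `g = ∇u`, and test the
equation with `u(r·)` and `u(r⁻¹·)`. After a change of variables and multiplication of the second
identity by `r⁻ᵈ`, the `μ` terms have the same real part and cancel (`IsWeakSolution.virial`). What
remains equates `(r - r⁻¹) Re ∫ ⟨g, g(r·)⟩` with a difference of two potential terms. Dividing by `r
- 1` and letting `r ↓ 1` gives `2 ‖∇u‖²` on the left (`two_mul_sq_le_of_virial`). In both cases the
right side is at most `c ‖∇u‖²` with `c < 2`, hence `∇u = 0`. An `L²` function with zero gradient is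
invariant under `x ↦ 2x`, which scales its squared norm by `2⁻ᵈ`, so it vanishes.

Under (ii) the potential is not differentiated. The function `Vu` is treated as a source, and `u(rx)
- u(x)` is written as an integral of `∇u` along the ray (`HasWeakGradient.ray`). Cauchy-Schwarz
moves the weight `|x|` onto `Vu`, and the Jacobian contributes `d |∫ V|u|²|`. The total constant is
`2b + db < 2` (`eq_zero_of_small`).

Under (i) the difference falls on `V`: `V(rx) - V(x)` is the integral over `s ∈ (1, r]` of `x ·
∇V(sx)`. The substitution `y = sx` leaves the fixed weight `y · ∇V(y)` and puts all dilations on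
`u`, where they act continuously (`tendsto_weighted_correlation`, `eventually_potential_term_le`).
This continuity needs a form bound for `|x · ∇V|`, while the hypothesis controls only the positive
part. Local integrability at the critical exponent together with Sobolev's inequality supplies such
a bound on balls (`exists_local_form_bound`), so `u` is first cut off. The cutoff creates a source
that is small in `L²` even with the weight `|x|` (`IsWeakSolution.exists_localization`). The local
form constant does not enter the final inequality, so the cutoff can be removed. -/

theorem lintegral_comp_smul (f : E d → ℝ≥0∞) {r : ℝ} (hr : 0 < r) :
    ∫⁻ x, f (r • x) = ENNReal.ofReal ((r ^ d)⁻¹) * ∫⁻ x, f x := by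
  calc ∫⁻ x, f (r • x) = ∫⁻ y, f y ∂Measure.map (fun x : E d => r • x) volume :=
        (lintegral_map_equiv f (MeasurableEquiv.smul₀ r hr.ne')).symm
    _ = _ := by
        rw [Measure.map_addHaar_smul volume hr.ne', lintegral_smul_measure,
          finrank_euclideanSpace_fin, abs_of_pos (by positivity), smul_eq_mul]

theorem integral_comp_smul {F : Type*} [NormedAddCommGroup F] [NormedSpace ℝ F]
    (f : E d → F) {r : ℝ} (hr : 0 < r) :
    ∫ x, f (r • x) = (r ^ d)⁻¹ • ∫ x, f x := by
  rw [Measure.integral_comp_smul, finrank_euclideanSpace_fin, abs_of_pos (by positivity)]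

theorem eLpNorm_two_sq {α F : Type*} [MeasurableSpace α] [NormedAddCommGroup F] (f : α → F)
    (μ : Measure α) : eLpNorm f 2 μ ^ 2 = ∫⁻ x, ‖f x‖ₑ ^ 2 ∂μ := by
  have h := eLpNorm_nnreal_pow_eq_lintegral (f := f) (μ := μ) (p := 2) (by norm_num)
  simpa using h

theorem eLpNorm_comp_smul_sq {F : Type*} [NormedAddCommGroup F] (f : E d → F) {r : ℝ}
    (hr : 0 < r) : eLpNorm (fun x => f (r • x)) 2 volume ^ 2
      = ENNReal.ofReal ((r ^ d)⁻¹) * eLpNorm f 2 volume ^ 2 := by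
  rw [eLpNorm_two_sq, eLpNorm_two_sq, lintegral_comp_smul (fun x => ‖f x‖ₑ ^ 2) hr]

theorem measurable_smul_left (r : ℝ) : Measurable fun x : E d => r • x :=
  (continuous_const_smul r).measurable

theorem memLp_comp_smul {F : Type*} [NormedAddCommGroup F] {f : E d → F}
    (hm : StronglyMeasurable f) (hf : MemLp f 2 volume) {r : ℝ} (hr : 0 < r) :
    MemLp (fun x => f (r • x)) 2 volume := by
  refine ⟨(hm.comp_measurable (measurable_smul_left r)).aestronglyMeasurable, ?_⟩
  have h : eLpNorm (fun x => f (r • x)) 2 volume ^ 2 < ⊤ := by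
    rw [eLpNorm_comp_smul_sq f hr]
    exact ENNReal.mul_lt_top (by simp) (ENNReal.pow_lt_top hf.2)
  exact (ENNReal.pow_lt_top_iff.1 h).resolve_right (by norm_num)

/-- Dilating by a factor at least one does not increase the `L²` norm. -/
theorem eLpNorm_comp_smul_le {F : Type*} [NormedAddCommGroup F] (f : E d → F) {r : ℝ}
    (hr : 1 ≤ r) : eLpNorm (fun x => f (r • x)) 2 volume ≤ eLpNorm f 2 volume := by
  refine (ENNReal.pow_le_pow_left_iff (n := 2) (by norm_num)).1 ?_
  rw [eLpNorm_comp_smul_sq f (by positivity)]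
  calc _ ≤ 1 * eLpNorm f 2 volume ^ 2 := by
        gcongr
        rw [← ENNReal.ofReal_one]
        exact ENNReal.ofReal_le_ofReal (inv_le_one_of_one_le₀ (one_le_pow₀ hr))
    _ = _ := one_mul _

end Dilation

/-- The Cauchy-Schwarz inequality for `∫ ‖f‖ ‖g‖`. -/
theorem lintegral_enorm_mul_le {α F G : Type*} [MeasurableSpace α] {μ : Measure α}
    [NormedAddCommGroup F] [NormedAddCommGroup G] {f : α → F} {g : α → G}
    (hf : AEStronglyMeasurable f μ) (hg : AEStronglyMeasurable g μ) :
    ∫⁻ x, ‖f x‖ₑ * ‖g x‖ₑ ∂μ ≤ eLpNorm f 2 μ * eLpNorm g 2 μ := by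
  have h := ENNReal.lintegral_mul_le_Lp_mul_Lq μ Real.HolderConjugate.two_two hf.enorm hg.enorm
  rw [eLpNorm_eq_lintegral_rpow_enorm_toReal (by norm_num) (by norm_num),
    eLpNorm_eq_lintegral_rpow_enorm_toReal (by norm_num) (by norm_num)]
  simpa using h

/-! ### Sobolev functions as pairs of measurable functions: dilation and cutoff. -/

/-- `u ∈ W^{1,2}(ℝ^d)` with weak gradient `g`, with measurable representatives. -/
structure IsH1 {d : ℕ} (u : E d → ℂ) (g : E d → EuclideanSpace ℂ (Fin d)) : Prop where
  meas : StronglyMeasurable u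
  meas_grad : StronglyMeasurable g
  memLp : MemLp u 2 volume
  memLp_grad : MemLp g 2 volume
  weak : HasWeakGradient u g

namespace IsH1

variable {d : ℕ} {u v : E d → ℂ} {g h : E d → EuclideanSpace ℂ (Fin d)}

theorem of_W12 (ψ : W12 d) : IsH1 ((ψ : L2 d) : E d → ℂ) (grad ψ) :=
  ⟨Lp.stronglyMeasurable _, Lp.stronglyMeasurable _, Lp.memLp _, Lp.memLp _, grad_spec ψ⟩

theorem exists_W12 (hu : IsH1 u g) :
    ∃ ψ : W12 d, ((ψ : L2 d) : E d → ℂ) =ᵐ[volume] u ∧ (grad ψ : E d → _) =ᵐ[volume] g := by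
  have hw := hu.weak.congr hu.memLp.coeFn_toLp.symm hu.memLp_grad.coeFn_toLp.symm
  refine ⟨⟨hu.memLp.toLp u, hu.memLp_grad.toLp g, hw⟩, hu.memLp.coeFn_toLp, ?_⟩
  rw [grad_eq hw]
  exact hu.memLp_grad.coeFn_toLp

/-- Carries the form hypotheses, which are stated for elements of `W12`, over to dilated and
truncated functions. -/
theorem weightedMass_le {w : E d → ℝ≥0∞} {b : ℝ≥0∞}
    (hw : ∀ ψ : W12 d, weightedMass w ψ ≤ b * dirichlet ψ) (hu : IsH1 u g) :
    ∫⁻ x, w x * ‖u x‖ₑ ^ 2 ≤ b * eLpNorm g 2 volume ^ 2 := by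
  obtain ⟨ψ, h1, h2⟩ := hu.exists_W12
  have e1 : weightedMass w ψ = ∫⁻ x, w x * ‖u x‖ₑ ^ 2 :=
    lintegral_congr_ae (h1.mono fun x hx => by simp only [hx])
  have e2 : dirichlet ψ = eLpNorm g 2 volume ^ 2 := by
    rw [eLpNorm_two_sq]
    exact lintegral_congr_ae (h2.mono fun x hx => by simp only [hx])
  rw [← e1, ← e2]
  exact hw ψ

theorem sub (hu : IsH1 u g) (hv : IsH1 v h) :
    IsH1 (fun x => u x - v x) (fun x => g x - h x) := by
  refine ⟨hu.meas.sub hv.meas, hu.meas_grad.sub hv.meas_grad, hu.memLp.sub hv.memLp,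
    hu.memLp_grad.sub hv.memLp_grad, ?_⟩
  have := hu.weak.add (hv.weak.const_smul (-1))
  simpa [sub_eq_add_neg] using this

/-- By duality: the gradient of `u` is tested against `φ(r⁻¹·)`, and the Jacobians of the two sides
cancel up to the chain-rule factor `r`. -/
theorem comp_smul (hu : IsH1 u g) {r : ℝ} (hr : 0 < r) :
    IsH1 (fun x => u (r • x)) (fun x => (r : ℂ) • g (r • x)) := by
  have m1 := memLp_comp_smul hu.meas hu.memLp hr
  have m2 := (memLp_comp_smul hu.meas_grad hu.memLp_grad hr).const_smul (r : ℂ)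
  refine ⟨hu.meas.comp_measurable (measurable_smul_left r),
    (hu.meas_grad.comp_measurable (measurable_smul_left r)).const_smul (r : ℂ), m1, m2,
    m1.locallyIntegrable (by norm_num), m2.locallyIntegrable (by norm_num),
    fun φ hφ hc i => ?_⟩
  have hφ' : ContDiff ℝ ∞ fun y => φ (r⁻¹ • y) := hφ.comp (contDiff_const_smul r⁻¹)
  have hc' : HasCompactSupport fun y => φ (r⁻¹ • y) :=
    hc.comp_homeomorph (Homeomorph.smulOfNeZero r⁻¹ (inv_ne_zero hr.ne'))
  have hd : ∀ x, fderiv ℝ (fun y => φ (r⁻¹ • y)) (r • x) (EuclideanSpace.single i 1)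
      = r⁻¹ * fderiv ℝ φ x (EuclideanSpace.single i 1) := by
    intro x
    have h1 : HasFDerivAt (fun y : E d => r⁻¹ • y) (r⁻¹ • ContinuousLinearMap.id ℝ (E d)) (r • x) :=
      (hasFDerivAt_id _).const_smul r⁻¹
    have h2 : HasFDerivAt φ (fderiv ℝ φ x) (r⁻¹ • (r • x)) := by
      rw [inv_smul_smul₀ hr.ne']
      exact (hφ.differentiable (by simp) x).hasFDerivAt
    have h3 := (h2.comp (r • x) h1).fderiv
    have h4 : fderiv ℝ (fun y => φ (r⁻¹ • y)) (r • x)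
        = (fderiv ℝ φ x).comp (r⁻¹ • ContinuousLinearMap.id ℝ (E d)) := h3
    rw [h4]
    simp
  have key := hu.weak.3 _ hφ' hc' i
  have k1 := integral_comp_smul (fun y => (fderiv ℝ (fun y => φ (r⁻¹ • y)) y
    (EuclideanSpace.single i 1)) • u y) hr
  have k2 := integral_comp_smul (fun y => φ (r⁻¹ • y) • g y i) hr
  simp only [hd, inv_smul_smul₀ hr.ne', mul_smul] at k1 k2
  rw [integral_smul, key, smul_neg, ← k2] at k1
  have k3 : ∫ x, φ x • ((r : ℂ) • g (r • x)) i = r • ∫ x, φ x • g (r • x) i := by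
    rw [← integral_smul]
    congr 1
    ext x
    simp
    ring
  rw [k3, ← smul_neg, ← k1, smul_inv_smul₀ hr.ne']

end IsH1

/-- The gradient of a real function, as a vector in `ℂ^d`. -/
def complexGradient {d : ℕ} (χ : E d → ℝ) (x : E d) : EuclideanSpace ℂ (Fin d) :=
  WithLp.toLp 2 fun i => ((fderiv ℝ χ x (EuclideanSpace.single i 1) : ℝ) : ℂ)

theorem continuous_complexGradient {d : ℕ} {χ : E d → ℝ} (hχ : ContDiff ℝ ∞ χ) :
    Continuous (complexGradient χ) :=
  (PiLp.continuous_toLp 2 _).comp (continuous_pi fun _ =>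
    Complex.continuous_ofReal.comp (continuous_partial hχ _))

/-- The product rule follows by testing `∇u` against `χφ`. Compact support makes `χ` and `∇χ`
bounded, so both terms stay in `L²`. -/
theorem IsH1.cutoff {d : ℕ} {u : E d → ℂ} {g : E d → EuclideanSpace ℂ (Fin d)}
    (hu : IsH1 u g) {χ : E d → ℝ} (hχ : ContDiff ℝ ∞ χ) (hχc : HasCompactSupport χ) :
    IsH1 (fun x => χ x • u x) (fun x => χ x • g x + u x • complexGradient χ x) := by
  have c1 := hχ.continuous
  have c2 := continuous_complexGradient hχ
  have hc2 : HasCompactSupport (complexGradient χ) := by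
    refine (hχc.fderiv ℝ).mono fun x hx h => hx ?_
    ext i
    simp [complexGradient, h]
  have b1 : MemLp χ ⊤ volume := c1.memLp_of_hasCompactSupport hχc
  have b2 : MemLp (complexGradient χ) ⊤ volume := c2.memLp_of_hasCompactSupport hc2
  have m1 : MemLp (fun x => χ x • u x) 2 volume := hu.memLp.smul (r := 2) b1
  have m2 : MemLp (fun x => χ x • g x) 2 volume := hu.memLp_grad.smul (r := 2) b1
  have m3 : MemLp (fun x => u x • complexGradient χ x) 2 volume := b2.smul (r := 2) hu.memLp
  have m4 := m2.add m3
  refine ⟨c1.stronglyMeasurable.smul hu.meas, (c1.stronglyMeasurable.smul hu.meas_grad).add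
    (hu.meas.smul c2.stronglyMeasurable), m1, m4, m1.locallyIntegrable (by norm_num),
    m4.locallyIntegrable (by norm_num), fun φ hφ hc i => ?_⟩
  have key := hu.weak.3 (fun x => χ x * φ x) (hχ.mul hφ) (hc.mul_left) i
  have hd : ∀ x, fderiv ℝ (fun x => χ x * φ x) x (EuclideanSpace.single i 1)
      = χ x * fderiv ℝ φ x (EuclideanSpace.single i 1)
        + φ x * fderiv ℝ χ x (EuclideanSpace.single i 1) := by
    intro x
    rw [fderiv_fun_mul (hχ.differentiable (by simp) x) (hφ.differentiable (by simp) x)]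
    simp
  simp only [hd, add_smul, mul_smul] at key
  have l1 := hu.memLp.locallyIntegrable (by norm_num)
  have i1 : Integrable (fun x => χ x • fderiv ℝ φ x (EuclideanSpace.single i 1) • u x) := by
    have := l1.integrable_smul_left_of_hasCompactSupport
      (c1.mul (continuous_partial hφ (EuclideanSpace.single i 1))) (hχc.mul_right)
    simpa only [Pi.mul_apply, mul_smul] using this
  have i2 : Integrable (fun x => φ x • fderiv ℝ χ x (EuclideanSpace.single i 1) • u x) := by
    have := l1.integrable_smul_left_of_hasCompactSupport
      (hφ.continuous.mul (continuous_partial hχ (EuclideanSpace.single i 1))) (hc.mul_right)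
    simpa only [Pi.mul_apply, mul_smul] using this
  have i3 : Integrable (fun x => χ x • φ x • g x i) := by
    have := (locallyIntegrable_coord hu.weak.2 i).integrable_smul_left_of_hasCompactSupport
      (c1.mul hφ.continuous) (hχc.mul_right)
    simpa only [Pi.mul_apply, mul_smul] using this
  rw [integral_add i1 i2] at key
  have e1 : ∀ x, φ x • (χ x • g x + u x • complexGradient χ x) i
      = χ x • φ x • g x i + φ x • fderiv ℝ χ x (EuclideanSpace.single i 1) • u x := by
    intro x
    simp [complexGradient]
    ring
  simp only [e1]
  rw [integral_add i3 i2, neg_add, ← key]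
  simp only [smul_comm (fderiv ℝ φ _ _) (χ _)]
  ring

/-! ### The fundamental theorem of calculus along rays for weak gradients. -/

section Ray

variable {d : ℕ} {𝕜 : Type*} [RCLike 𝕜]

/-- The bilinear pairing `x · v` of a real and a `𝕜`-valued vector. -/
def pairing (x : E d) (v : EuclideanSpace 𝕜 (Fin d)) : 𝕜 := ∑ i, x i • v i

theorem enorm_pairing_le (x : E d) (v : EuclideanSpace 𝕜 (Fin d)) :
    ‖pairing x v‖ₑ ≤ ‖x‖ₑ * ‖v‖ₑ := by
  have h : ‖pairing x v‖ ≤ ‖x‖ * ‖v‖ := by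
    calc ‖pairing x v‖ ≤ ∑ i, ‖x i‖ * ‖v i‖ := by
          refine (norm_sum_le _ _).trans (le_of_eq ?_)
          simp [norm_smul]
      _ ≤ _ := by
          rw [EuclideanSpace.norm_eq, EuclideanSpace.norm_eq]
          exact Real.sum_mul_le_sqrt_mul_sqrt _ _ _
  rw [← ofReal_norm, ← ofReal_norm, ← ofReal_norm, ← ENNReal.ofReal_mul (norm_nonneg _)]
  exact ENNReal.ofReal_le_ofReal h

theorem pairing_eq_inner (x v : E d) : pairing x v = inner ℝ x v := by
  simp [pairing, PiLp.inner_apply, mul_comm]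

theorem pairing_smul_left (c : ℝ) (x : E d) (v : EuclideanSpace 𝕜 (Fin d)) :
    pairing (c • x) v = c • pairing x v := by
  simp [pairing, Finset.smul_sum, mul_smul]

theorem stronglyMeasurable_pairing {α : Type*} [MeasurableSpace α] {X : α → E d}
    {v : α → EuclideanSpace 𝕜 (Fin d)} (hX : StronglyMeasurable X) (hv : StronglyMeasurable v) :
    StronglyMeasurable fun a => pairing (X a) (v a) := by
  refine Finset.stronglyMeasurable_fun_sum _ fun i _ => ?_
  exact (((EuclideanSpace.proj i : E d →L[ℝ] ℝ).continuous.comp_stronglyMeasurable hX)).smul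
    ((EuclideanSpace.proj i : EuclideanSpace 𝕜 (Fin d) →L[𝕜] 𝕜).continuous.comp_stronglyMeasurable
      hv)

theorem measurable_ray : Measurable fun p : ℝ × E d => p.1 • p.2 :=
  (continuous_fst.smul continuous_snd).measurable

/-- Everywhere measurability of `G` makes the composition with `(s, x) ↦ s x` jointly measurable
with no null-set argument, as Fubini requires. -/
theorem stronglyMeasurable_ray {G : E d → EuclideanSpace 𝕜 (Fin d)} (hG : StronglyMeasurable G) :
    StronglyMeasurable fun p : ℝ × E d => pairing p.2 (G (p.1 • p.2)) :=
  stronglyMeasurable_pairing measurable_snd.stronglyMeasurable (hG.comp_measurable measurable_ray)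

/-- Since `1 ≤ s ≤ r`, the Jacobian `s⁻ᵈ` is at most one and `s x` stays in the ball of radius `r
ρ`. The bound is therefore uniform in `s`. -/
theorem setLIntegral_comp_smul_le (f : E d → ℝ≥0∞) {s r ρ : ℝ} (hs : 1 ≤ s) (hsr : s ≤ r) : ∫⁻ x in Metric.closedBall 0 ρ, f (s • x) ≤
      ∫⁻ x in Metric.closedBall 0 (r * ρ), f x := by
  rw [← lintegral_indicator Metric.isClosed_closedBall.measurableSet,
    ← lintegral_indicator Metric.isClosed_closedBall.measurableSet]
  have h0 : (0 : ℝ) < s := by linarith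
  calc _ ≤ ∫⁻ x, (Metric.closedBall (0 : E d) (r * ρ)).indicator f (s • x) := by
        refine lintegral_mono fun x => ?_
        by_cases hx : x ∈ Metric.closedBall (0 : E d) ρ
        · have : s • x ∈ Metric.closedBall (0 : E d) (r * ρ) := by
            simp only [mem_closedBall_zero_iff] at hx ⊢
            rw [norm_smul, Real.norm_of_nonneg h0.le]
            exact mul_le_mul hsr hx (norm_nonneg x) (h0.le.trans hsr)
          simp [Set.indicator_of_mem hx, Set.indicator_of_mem this]
        · simp [Set.indicator_of_notMem hx]
    _ = _ := lintegral_comp_smul _ h0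
    _ ≤ 1 * _ := by
        gcongr
        rw [← ENNReal.ofReal_one]
        exact ENNReal.ofReal_le_ofReal (inv_le_one_of_one_le₀ (one_le_pow₀ hs))
    _ = _ := one_mul _

/-- Local integrability of `G` suffices: on the ball the factor `x` is bounded by `ρ`, and the
points `s x` remain in a fixed larger ball. -/
theorem integrable_ray {G : E d → EuclideanSpace 𝕜 (Fin d)} (hG : StronglyMeasurable G)
    (hGi : LocallyIntegrable G volume) (r ρ : ℝ) :
    Integrable (fun p : ℝ × E d => pairing p.2 (G (p.1 • p.2)))
      ((volume.restrict (Set.Ioc 1 r)).prod (volume.restrict (Metric.closedBall 0 ρ))) := by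
  have hm := stronglyMeasurable_ray hG
  refine ⟨hm.aestronglyMeasurable, ?_⟩
  have hfin : ∫⁻ x in Metric.closedBall 0 (r * ρ), ‖G x‖ₑ < ⊤ :=
    (hGi.integrableOn_isCompact (isCompact_closedBall _ _)).2
  unfold HasFiniteIntegral
  rw [lintegral_prod _ hm.enorm.aemeasurable]
  calc _ ≤ ∫⁻ _ in Set.Ioc 1 r, ENNReal.ofReal ρ *
        ∫⁻ x in Metric.closedBall 0 (r * ρ), ‖G x‖ₑ := by
        refine setLIntegral_mono measurable_const fun s hs => ?_
        calc _ ≤ ∫⁻ x in Metric.closedBall 0 ρ, ENNReal.ofReal ρ * ‖G (s • x)‖ₑ := by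
              refine setLIntegral_mono ((hG.comp_measurable
                (measurable_smul_left s)).enorm.const_mul _) fun x hx => ?_
              refine (enorm_pairing_le _ _).trans ?_
              gcongr
              rw [← ofReal_norm]
              exact ENNReal.ofReal_le_ofReal (mem_closedBall_zero_iff.1 hx)
          _ = ENNReal.ofReal ρ * ∫⁻ x in Metric.closedBall 0 ρ, ‖G (s • x)‖ₑ :=
              lintegral_const_mul _ (hG.comp_measurable (measurable_smul_left s)).enorm
          _ ≤ _ := mul_le_mul' le_rfl
              (setLIntegral_comp_smul_le (fun x => ‖G x‖ₑ) hs.1.le hs.2)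
    _ < ⊤ := by
        rw [lintegral_const]
        refine ENNReal.mul_lt_top (ENNReal.mul_lt_top (by simp) hfin) (by simp)

theorem locallyIntegrable_of_closedBall {F : Type*} [NormedAddCommGroup F] {f : E d → F}
    (h : ∀ ρ : ℝ, 0 ≤ ρ → IntegrableOn f (Metric.closedBall 0 ρ) volume) :
    LocallyIntegrable f volume := by
  refine locallyIntegrable_iff.2 fun K hK => ?_
  obtain ⟨ρ, hρ⟩ := hK.isBounded.subset_closedBall 0
  exact (h (max ρ 0) (le_max_right _ _)).mono_set
    (hρ.trans (Metric.closedBall_subset_closedBall (le_max_left _ _)))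

theorem locallyIntegrable_comp_smul {F : Type*} [NormedAddCommGroup F] {f : E d → F}
    (hf : LocallyIntegrable f volume) {r : ℝ} (hr : 0 < r) :
    LocallyIntegrable (fun x => f (r • x)) volume := by
  refine locallyIntegrable_of_closedBall fun ρ hρ => ?_
  have h1 := (hf.integrableOn_isCompact (isCompact_closedBall 0 (r * ρ))).integrable_indicator
    Metric.isClosed_closedBall.measurableSet
  refine ((h1.comp_smul hr.ne').integrableOn (s := Metric.closedBall 0 ρ)).congr_fun
    (fun x hx => ?_) Metric.isClosed_closedBall.measurableSet
  refine Set.indicator_of_mem ?_ f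
  simp only [mem_closedBall_zero_iff] at hx ⊢
  rw [norm_smul, Real.norm_of_nonneg hr.le]
  gcongr

theorem exists_support_subset_closedBall {F : Type*} [Zero F] {φ : E d → F}
    (hc : HasCompactSupport φ) : ∃ ρ : ℝ, 0 ≤ ρ ∧ ∀ x, φ x ≠ 0 → ‖x‖ ≤ ρ := by
  obtain ⟨ρ, hρ⟩ := hc.isCompact.isBounded.subset_closedBall 0
  refine ⟨max ρ 0, le_max_right _ _, fun x hx => ?_⟩
  have := hρ (subset_tsupport _ (Function.mem_support.2 hx))
  exact (mem_closedBall_zero_iff.1 this).trans (le_max_left _ _)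

/-- The divergence `d φ(z) + z · ∇φ(z)` of `z ↦ φ(z) z`. -/
def dilationDivergence (φ : E d → ℝ) (z : E d) : ℝ := d * φ z + fderiv ℝ φ z z

theorem continuous_dilationDivergence {φ : E d → ℝ} (hφ : ContDiff ℝ ∞ φ) :
    Continuous (dilationDivergence φ) :=
  (continuous_const.mul hφ.continuous).add
    ((hφ.continuous_fderiv (by simp)).clm_apply continuous_id)

theorem hasCompactSupport_dilationDivergence {φ : E d → ℝ} (hc : HasCompactSupport φ) :
    HasCompactSupport (dilationDivergence φ) := by
  have h : HasCompactSupport fun z => fderiv ℝ φ z z := by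
    refine (hc.fderiv ℝ).mono fun x hx h => hx ?_
    simp [h]
  exact (hc.mul_left (f := fun _ => (d : ℝ))).add h

/-- The function `s⁻ᵈ φ(y/s)` is the adjoint dilation of the test function. The calculus in `s` is
done on this smooth side, so that `u` itself needs no derivative along rays. -/
theorem hasDerivAt_dilation {φ : E d → ℝ} (hφ : ContDiff ℝ ∞ φ) (y : E d) {s : ℝ} (hs : s ≠ 0) :
    HasDerivAt (fun s : ℝ => s⁻¹ ^ d * φ (s⁻¹ • y))
      (-(s⁻¹ ^ (d + 1) * dilationDivergence φ (s⁻¹ • y))) s := by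
  have h1 : HasDerivAt (fun s : ℝ => s⁻¹) (-(s ^ 2)⁻¹) s := hasDerivAt_inv hs
  have h2 : HasDerivAt (fun s : ℝ => s⁻¹ • y) ((-(s ^ 2)⁻¹) • y) s := h1.smul_const y
  have h3 : HasDerivAt (fun s : ℝ => φ (s⁻¹ • y)) (fderiv ℝ φ (s⁻¹ • y) ((-(s ^ 2)⁻¹) • y)) s :=
    (hφ.differentiable (by simp) (s⁻¹ • y)).hasFDerivAt.comp_hasDerivAt s h2
  refine ((h1.pow d).mul h3).congr_deriv ?_
  rw [dilationDivergence, map_smul, map_smul]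
  -- The power rule produces the truncated exponent `d - 1`, so `d = 0` is separated.
  rcases d with _ | d
  · simp
    field_simp
  · simp
    field_simp
    ring

/-- This is the divergence of the field `y ↦ φ(y/s) y`, whose components serve as test functions in
the weak gradient identity. -/
theorem sum_partial_eq {φ : E d → ℝ} (hφ : ContDiff ℝ ∞ φ) (s : ℝ) (y : E d) :
    ∑ i, fderiv ℝ (fun y : E d => y i * φ (s⁻¹ • y)) y (EuclideanSpace.single i 1)
      = dilationDivergence φ (s⁻¹ • y) := by
  have hL : HasFDerivAt (fun y : E d => φ (s⁻¹ • y))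
      ((fderiv ℝ φ (s⁻¹ • y)).comp (s⁻¹ • ContinuousLinearMap.id ℝ (E d))) y :=
    (hφ.differentiable (by simp) (s⁻¹ • y)).hasFDerivAt.comp y ((hasFDerivAt_id _).const_smul s⁻¹)
  have hd : ∀ i, fderiv ℝ (fun y : E d => y i * φ (s⁻¹ • y)) y (EuclideanSpace.single i 1)
      = φ (s⁻¹ • y) + y i * (s⁻¹ * fderiv ℝ φ (s⁻¹ • y) (EuclideanSpace.single i 1)) := by
    intro i
    have h1 : HasFDerivAt (fun y : E d => y i) (EuclideanSpace.proj i : E d →L[ℝ] ℝ) y :=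
      (EuclideanSpace.proj i : E d →L[ℝ] ℝ).hasFDerivAt
    have h2 := (h1.mul hL).fderiv
    have h3 : fderiv ℝ (fun y : E d => y i * φ (s⁻¹ • y)) y = _ := h2
    rw [h3]
    simp
    ring
  simp only [hd, Finset.sum_add_distrib, dilationDivergence]
  have hy : fderiv ℝ φ (s⁻¹ • y) y
      = ∑ i, y i * fderiv ℝ φ (s⁻¹ • y) (EuclideanSpace.single i 1) := by
    generalize fderiv ℝ φ (s⁻¹ • y) = L
    conv_lhs => rw [← (EuclideanSpace.basisFun (Fin d) ℝ).sum_repr y]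
    simp
  rw [map_smul, hy]
  simp [Finset.mul_sum]
  refine Finset.sum_congr rfl fun i _ => by ring

variable {u : E d → 𝕜} {G : E d → EuclideanSpace 𝕜 (Fin d)}

/-- The substitution `y = s x` turns the left side into `s⁻ᵈ⁻¹ ∫ φ(y/s) y · G(y)`, and the weak
gradient identity is then summed over the coordinates. -/
theorem integral_test_ray (hu : HasWeakGradient u G) {φ : E d → ℝ} (hφ : ContDiff ℝ ∞ φ)
    (hc : HasCompactSupport φ) {s : ℝ} (hs : 0 < s) :
    ∫ x, φ x • pairing x (G (s • x))
      = ∫ y, (-(s⁻¹ ^ (d + 1) * dilationDivergence φ (s⁻¹ • y))) • u y := by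
  have hφ' : ContDiff ℝ ∞ fun y => φ (s⁻¹ • y) := hφ.comp (contDiff_const_smul s⁻¹)
  have hc' : HasCompactSupport fun y => φ (s⁻¹ • y) :=
    hc.comp_homeomorph (Homeomorph.smulOfNeZero s⁻¹ (inv_ne_zero hs.ne'))
  have hp : ∀ i : Fin d, ContDiff ℝ ∞ fun y : E d => y i := fun i =>
    (EuclideanSpace.proj i : E d →L[ℝ] ℝ).contDiff
  have hz : ∀ i : Fin d, ContDiff ℝ ∞ fun y : E d => y i * φ (s⁻¹ • y) := fun i => (hp i).mul hφ'
  have hzc : ∀ i : Fin d, HasCompactSupport fun y : E d => y i * φ (s⁻¹ • y) := fun i => hc'.mul_left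
  have key := Finset.sum_congr (rfl : (Finset.univ : Finset (Fin d)) = Finset.univ)
    fun i _ => hu.3 _ (hz i) (hzc i) i
  rw [← integral_finsetSum _ fun i _ => hu.1.integrable_smul_left_of_hasCompactSupport
      (continuous_partial (hz i) _) (hasCompactSupport_partial (hzc i) _),
    Finset.sum_neg_distrib, ← integral_finsetSum _ fun i _ =>
      (locallyIntegrable_coord hu.2 i).integrable_smul_left_of_hasCompactSupport
        (hz i).continuous (hzc i)] at key
  simp only [← Finset.sum_smul, sum_partial_eq hφ] at key
  have e1 : ∀ y, ∑ i, (y i * φ (s⁻¹ • y)) • G y i = φ (s⁻¹ • y) • pairing y (G y) := by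
    intro y
    rw [pairing, Finset.smul_sum]
    exact Finset.sum_congr rfl fun i _ => by rw [mul_comm, mul_smul]
  simp only [e1] at key
  have k2 := integral_comp_smul (fun y => φ (s⁻¹ • y) • pairing y (G y)) hs
  simp only [inv_smul_smul₀ hs.ne', pairing_smul_left] at k2
  simp only [neg_smul, mul_smul, integral_neg, integral_smul]
  rw [key, smul_neg, neg_neg, pow_succ', mul_smul, inv_pow, ← k2]
  simp only [smul_comm (φ _) s, integral_smul]
  rw [inv_smul_smul₀ hs.ne']

/-- The ray formula in the sense of distributions: `integral_test_ray` is integrated in `s`, the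
order of integration is exchanged, and `hasDerivAt_dilation` evaluates the `s` integral. -/
theorem integral_test_dilation (hu : HasWeakGradient u G) (hum : StronglyMeasurable u)
    {φ : E d → ℝ} (hφ : ContDiff ℝ ∞ φ) (hc : HasCompactSupport φ) {r : ℝ} (hr : 1 ≤ r) :
    ∫ s in Set.Ioc 1 r, ∫ x, φ x • pairing x (G (s • x)) = ∫ x, φ x • (u (r • x) - u x) := by
  have hr0 : 0 < r := by linarith
  obtain ⟨ρ, hρ0, hρ⟩ := exists_support_subset_closedBall (hasCompactSupport_dilationDivergence hc)
  obtain ⟨M, hM⟩ := (continuous_dilationDivergence hφ).bounded_above_of_compact_support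
    (hasCompactSupport_dilationDivergence hc)
  have hmeas : StronglyMeasurable fun p : ℝ × E d =>
      (-(p.1⁻¹ ^ (d + 1) * dilationDivergence φ (p.1⁻¹ • p.2))) • u p.2 := by
    refine StronglyMeasurable.smul ?_ (hum.comp_measurable measurable_snd)
    refine StronglyMeasurable.neg (StronglyMeasurable.mul ?_ ?_)
    · exact ((measurable_fst.inv).pow_const _).stronglyMeasurable
    · exact (continuous_dilationDivergence hφ).stronglyMeasurable.comp_measurable
        (measurable_fst.inv.smul measurable_snd)
  have hint : Integrable (fun p : ℝ × E d =>
      (-(p.1⁻¹ ^ (d + 1) * dilationDivergence φ (p.1⁻¹ • p.2))) • u p.2)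
      ((volume.restrict (Set.Ioc 1 r)).prod volume) := by
    -- Domination by `M ‖u‖` on the ball of radius `r ρ`: the kernel vanishes unless `|y| ≤ s ρ ≤ r
    -- ρ`, and the powers of `s⁻¹` are at most one.
    have hB := (hu.1.integrableOn_isCompact (isCompact_closedBall 0 (r * ρ))).integrable_indicator
      Metric.isClosed_closedBall.measurableSet
    have hB2 := ((hB.norm.const_mul M).comp_snd (volume.restrict (Set.Ioc 1 r)))
    refine hB2.mono' hmeas.aestronglyMeasurable ?_
    have hae : ∀ᵐ p ∂((volume.restrict (Set.Ioc 1 r)).prod (volume : Measure (E d))),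
        p.1 ∈ Set.Ioc 1 r :=
      Measure.quasiMeasurePreserving_fst.ae (ae_restrict_mem measurableSet_Ioc)
    filter_upwards [hae] with p hp
    have hp0 : 0 < p.1 := by linarith [hp.1]
    by_cases h0 : dilationDivergence φ (p.1⁻¹ • p.2) = 0
    · simp only [h0, mul_zero, neg_zero, zero_smul, norm_zero]
      have := (norm_nonneg _).trans (hM 0)
      positivity
    · have h1 := hρ _ h0
      have h2 : p.2 ∈ Metric.closedBall (0 : E d) (r * ρ) := by
        rw [norm_smul, norm_inv, Real.norm_of_nonneg hp0.le, inv_mul_le_iff₀ hp0] at h1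
        rw [mem_closedBall_zero_iff]
        exact h1.trans (by gcongr; exact hp.2)
      rw [Set.indicator_of_mem h2, norm_smul, norm_neg, norm_mul]
      have h3 : ‖p.1⁻¹ ^ (d + 1)‖ ≤ 1 := by
        rw [Real.norm_of_nonneg (by positivity)]
        exact pow_le_one₀ (by positivity) (inv_le_one_of_one_le₀ hp.1.le)
      gcongr
      calc _ ≤ 1 * M := by gcongr; exact hM _
        _ = M := one_mul _
  calc _ = ∫ s in Set.Ioc 1 r, ∫ y,
        (-(s⁻¹ ^ (d + 1) * dilationDivergence φ (s⁻¹ • y))) • u y :=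
        setIntegral_congr_fun measurableSet_Ioc fun s hs =>
          integral_test_ray hu hφ hc (by linarith [hs.1])
    _ = ∫ y, ∫ s in Set.Ioc 1 r,
        (-(s⁻¹ ^ (d + 1) * dilationDivergence φ (s⁻¹ • y))) • u y :=
        integral_integral_swap hint
    _ = ∫ y, (r⁻¹ ^ d * φ (r⁻¹ • y) - φ y) • u y := by
        congr 1
        ext y
        rw [integral_smul_const, ← intervalIntegral.integral_of_le hr,
          intervalIntegral.integral_eq_sub_of_hasDerivAt
            (f := fun s : ℝ => s⁻¹ ^ d * φ (s⁻¹ • y))]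
        · simp
        · intro s hs
          rw [Set.uIcc_of_le hr] at hs
          exact hasDerivAt_dilation hφ y (by linarith [hs.1])
        · refine ContinuousOn.intervalIntegrable ?_
          rw [Set.uIcc_of_le hr]
          have hinv : ContinuousOn (fun s : ℝ => s⁻¹) (Set.Icc 1 r) :=
            continuousOn_inv₀.mono fun s hs => by
              simp only [Set.mem_compl_iff, Set.mem_singleton_iff]
              linarith [hs.1]
          exact ((hinv.pow _).mul ((continuous_dilationDivergence hφ).comp_continuousOn
            (hinv.smul continuousOn_const))).neg
    _ = _ := by
        have hφ' : Continuous fun y => φ (r⁻¹ • y) := hφ.continuous.comp (continuous_const_smul r⁻¹)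
        have hc' : HasCompactSupport fun y => φ (r⁻¹ • y) :=
          hc.comp_homeomorph (Homeomorph.smulOfNeZero r⁻¹ (inv_ne_zero hr0.ne'))
        have i1 := hu.1.integrable_smul_left_of_hasCompactSupport hφ' hc'
        have i2 := hu.1.integrable_smul_left_of_hasCompactSupport hφ.continuous hc
        have i3 := (locallyIntegrable_comp_smul hu.1 hr0).integrable_smul_left_of_hasCompactSupport
          hφ.continuous hc
        simp only [sub_smul, smul_sub, mul_smul]
        have i4 : Integrable fun x => r⁻¹ ^ d • φ (r⁻¹ • x) • u x := i1.smul (r⁻¹ ^ d)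
        rw [integral_sub i4 i2, integral_sub i3 i2, integral_smul]
        have k := integral_comp_smul (fun y => φ (r⁻¹ • y) • u y) hr0
        simp only [inv_smul_smul₀ hr0.ne'] at k
        rw [k, inv_pow]

/-- The fundamental theorem of calculus along almost every ray. -/
theorem HasWeakGradient.ray (hu : HasWeakGradient u G) (hum : StronglyMeasurable u)
    (hGm : StronglyMeasurable G) {r : ℝ} (hr : 1 ≤ r) :
    ∀ᵐ x, u (r • x) - u x = ∫ s in Set.Ioc 1 r, pairing x (G (s • x)) := by
  have hr0 : 0 < r := by linarith
  -- Both sides are locally integrable, so it is enough that they agree against test functions.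
  refine ae_eq_of_integral_contDiff_smul_eq
    ((locallyIntegrable_comp_smul hu.1 hr0).sub hu.1)
    (locallyIntegrable_of_closedBall fun ρ _ => (integrable_ray hGm hu.2 r ρ).integral_prod_right)
    fun φ hφ hc => ?_
  rw [← integral_test_dilation hu hum hφ hc hr]
  obtain ⟨ρ, hρ0, hρ⟩ := exists_support_subset_closedBall hc
  have hi := integrable_ray hGm hu.2 r ρ
  obtain ⟨M, hM⟩ := hφ.continuous.bounded_above_of_compact_support hc
  have hi2 : Integrable (fun p : ℝ × E d => φ p.2 • pairing p.2 (G (p.1 • p.2)))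
      ((volume.restrict (Set.Ioc 1 r)).prod (volume.restrict (Metric.closedBall 0 ρ))) :=
    hi.bdd_smul M (hφ.continuous.comp continuous_snd).aestronglyMeasurable
      (Filter.Eventually.of_forall fun p => hM p.2)
  have hset : ∀ f : E d → 𝕜, ∫ x in Metric.closedBall 0 ρ, φ x • f x = ∫ x, φ x • f x := by
    intro f
    refine setIntegral_eq_integral_of_forall_compl_eq_zero fun x hx => ?_
    have : φ x = 0 := by
      by_contra h
      exact hx (mem_closedBall_zero_iff.2 (hρ x h))
    simp [this]
  have hsw := integral_integral_swap (f := fun (s : ℝ) (x : E d) => φ x • pairing x (G (s • x))) hi2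
  simp only [hset, integral_smul] at hsw
  exact hsw

/-- Weighted bound for the difference of a function and its dilation. -/
theorem HasWeakGradient.lintegral_dilation_sub_le {F : Type*} [NormedAddCommGroup F]
    [NormedSpace ℝ F] (hu : HasWeakGradient u G) (hum : StronglyMeasurable u)
    (hGm : StronglyMeasurable G) {h : E d → F} (hh : StronglyMeasurable h) {r : ℝ} (hr : 1 ≤ r) :
    ∫⁻ x, ‖u (r • x) - u x‖ₑ * ‖h x‖ₑ ≤ ENNReal.ofReal (r - 1) *
      (eLpNorm G 2 volume * eLpNorm (fun x => ‖x‖ • h x) 2 volume) := by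
  have hray : StronglyMeasurable fun p : ℝ × E d => G (p.1 • p.2) :=
    hGm.comp_measurable measurable_ray
  have hw : StronglyMeasurable fun x : E d => ‖x‖ • h x :=
    continuous_norm.stronglyMeasurable.smul hh
  calc ∫⁻ x, ‖u (r • x) - u x‖ₑ * ‖h x‖ₑ
      ≤ ∫⁻ x, ∫⁻ s in Set.Ioc 1 r, ‖G (s • x)‖ₑ * ‖‖x‖ • h x‖ₑ := by
        refine lintegral_mono_ae ((hu.ray hum hGm hr).mono fun x hx => ?_)
        rw [hx]
        calc _ ≤ (∫⁻ s in Set.Ioc 1 r, ‖pairing x (G (s • x))‖ₑ) * ‖h x‖ₑ := by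
              gcongr
              exact enorm_integral_le_lintegral_enorm _
          _ ≤ (∫⁻ s in Set.Ioc 1 r, ‖x‖ₑ * ‖G (s • x)‖ₑ) * ‖h x‖ₑ := by
              gcongr
              exact enorm_pairing_le _ _
          _ = _ := by
              have hm : Measurable fun s : ℝ => ‖G (s • x)‖ₑ :=
                (hray.comp_measurable measurable_prodMk_right).enorm
              rw [lintegral_const_mul _ hm, lintegral_mul_const _ hm, enorm_smul, enorm_norm]
              ring
    _ = ∫⁻ s in Set.Ioc 1 r, ∫⁻ x, ‖G (s • x)‖ₑ * ‖‖x‖ • h x‖ₑ := by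
        refine lintegral_lintegral_swap (Measurable.aemeasurable ?_)
        exact (hray.comp_measurable measurable_swap).enorm.mul
          (hw.comp_measurable measurable_fst).enorm
    _ ≤ ∫⁻ _ in Set.Ioc 1 r,
          eLpNorm G 2 volume * eLpNorm (fun x => ‖x‖ • h x) 2 volume := by
        -- For each fixed `s ≥ 1`, Cauchy-Schwarz applies and the dilation contracts the `L²` norm
        -- of `G`. The length of `(1, r]` then gives the factor `r - 1`.
        refine setLIntegral_mono measurable_const fun s hs => ?_
        refine (lintegral_enorm_mul_le (hGm.comp_measurable
          (measurable_smul_left s)).aestronglyMeasurable hw.aestronglyMeasurable).trans ?_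
        gcongr
        exact eLpNorm_comp_smul_le G hs.1.le
    _ = _ := by
        rw [lintegral_const, Measure.restrict_apply_univ, Real.volume_Ioc, mul_comm]

/-- A square integrable function with vanishing weak gradient vanishes. -/
theorem HasWeakGradient.eq_zero_of_grad_eq_zero (hd : 1 ≤ d) (hu : HasWeakGradient u G)
    (hum : StronglyMeasurable u) (huL : MemLp u 2 volume) (hG : G =ᵐ[volume] 0) :
    u =ᵐ[volume] 0 := by
  have h0 := hu.congr (Filter.EventuallyEq.refl _ u) hG
  -- The ray formula gives `u(2x) = u(x)` almost everywhere, while the squared norms differ by the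
  -- factor `2⁻ᵈ`, which is below one because `d ≥ 1`.
  have hray := h0.ray hum stronglyMeasurable_zero (r := 2) (by norm_num)
  have hz : ∀ x : E d, pairing x (0 : EuclideanSpace 𝕜 (Fin d)) = 0 := fun x => by simp [pairing]
  simp only [Pi.zero_apply, hz, integral_zero, sub_eq_zero] at hray
  have h1 := eLpNorm_comp_smul_sq u (r := 2) (by norm_num)
  rw [eLpNorm_congr_ae hray] at h1
  by_contra hne
  have hpos : eLpNorm u 2 volume ≠ 0 := fun h =>
    hne ((eLpNorm_eq_zero_iff huL.1 (by norm_num)).1 h)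
  have h2 : ENNReal.ofReal (((2 : ℝ) ^ d)⁻¹) < 1 := by
    rw [← ENNReal.ofReal_one]
    refine (ENNReal.ofReal_lt_ofReal_iff one_pos).2 (inv_lt_one_of_one_lt₀ ?_)
    exact one_lt_pow₀ (by norm_num) (by omega)
  have h3 := ENNReal.mul_lt_mul_left (pow_ne_zero 2 hpos)
    (ENNReal.pow_ne_top huL.2.ne) h2
  rw [one_mul, ← h1] at h3
  exact lt_irrefl _ h3

end Ray

open Filter Topology

/-! ### Convergence in `L²` and strong continuity of dilations. -/

section L2Convergence

variable {d : ℕ} {F : Type*} [NormedAddCommGroup F]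

/-- Approximation operators that are equibounded on `L²` and converge on `C_c` converge on `L²`. -/
theorem tendsto_eLpNorm_sub_of_dense [NormedSpace ℝ F] {ι : Type*} {l : Filter ι} (T : ι → (E d → F) → E d → F)
    {C : ℝ≥0∞} (hC : C ≠ ⊤) {v : E d → F} (hv : MemLp v 2 volume)
    (hmeas : ∀ h : E d → F, MemLp h 2 volume →
      ∀ᶠ i in l, AEStronglyMeasurable (T i h) volume)
    (hbd : ∀ h : E d → F, Continuous h → HasCompactSupport h →
      ∀ᶠ i in l, eLpNorm (T i v - T i h) 2 volume ≤ C * eLpNorm (v - h) 2 volume)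
    (hT : ∀ h : E d → F, Continuous h → HasCompactSupport h →
      Tendsto (fun i => eLpNorm (T i h - h) 2 volume) l (𝓝 0)) :
    Tendsto (fun i => eLpNorm (T i v - v) 2 volume) l (𝓝 0) := by
  rw [ENNReal.tendsto_nhds_zero]
  intro ε hε
  -- The first bound controls `h - v`, the second its image under `T i`. Using `C + 1` avoids
  -- division by zero.
  set δ := min (ε / 3) (ε / 3 / (C + 1)) with hδ
  have hε3 : ε / 3 ≠ 0 := (ENNReal.div_pos hε.ne' (by norm_num)).ne'
  have hC1 : C + 1 ≠ ⊤ := by simpa using hC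
  have hδ0 : δ ≠ 0 := by
    rw [hδ]
    exact (lt_min (pos_iff_ne_zero.2 hε3) (ENNReal.div_pos hε3 hC1)).ne'
  obtain ⟨h, hc, hvh, hcont, hhm⟩ := hv.exists_hasCompactSupport_eLpNorm_sub_le (by norm_num) hδ0
  filter_upwards [hmeas v hv, hmeas h hhm, hbd h hcont hc,
    ENNReal.tendsto_nhds_zero.1 (hT h hcont hc) (ε / 3) (pos_iff_ne_zero.2 hε3)] with i m1 m2 h1 h2
  have e : T i v - v = (T i v - T i h) + ((T i h - h) + (h - v)) := by abel
  have h3 : eLpNorm (h - v) 2 volume ≤ ε / 3 := by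
    rw [eLpNorm_sub_comm]
    exact hvh.trans (min_le_left _ _)
  have h4 : C * eLpNorm (v - h) 2 volume ≤ ε / 3 := by
    calc _ ≤ (C + 1) * (ε / 3 / (C + 1)) := by
          gcongr
          · exact le_self_add
          · exact hvh.trans (min_le_right _ _)
      _ ≤ ε / 3 := ENNReal.mul_div_le
  rw [e]
  calc _ ≤ eLpNorm (T i v - T i h) 2 volume + eLpNorm ((T i h - h) + (h - v)) 2 volume :=
        eLpNorm_add_le (m1.sub m2) ((m2.sub hhm.1).add (hhm.1.sub hv.1)) (by norm_num)
    _ ≤ eLpNorm (T i v - T i h) 2 volume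
        + (eLpNorm (T i h - h) 2 volume + eLpNorm (h - v) 2 volume) := by
        gcongr
        exact eLpNorm_add_le (m2.sub hhm.1) (hhm.1.sub hv.1) (by norm_num)
    _ ≤ ε / 3 + (ε / 3 + ε / 3) := by
        gcongr
        exact h1.trans h4
    _ = ε := by rw [← add_assoc, ENNReal.add_thirds]

/-- Uniform convergence within a fixed ball implies `L²` convergence. -/
theorem tendsto_eLpNorm_sub_of_uniform {ι : Type*} {l : Filter ι} {H : ι → E d → F} {h : E d → F}
    (ρ : ℝ) (hs : ∀ x, h x ≠ 0 → ‖x‖ ≤ ρ) (hHs : ∀ᶠ i in l, ∀ x, H i x ≠ 0 → ‖x‖ ≤ ρ)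
    (hH : ∀ ε > 0, ∀ᶠ i in l, ∀ x, dist (H i x) (h x) ≤ ε) :
    Tendsto (fun i => eLpNorm (H i - h) 2 volume) l (𝓝 0) := by
  rw [ENNReal.tendsto_nhds_zero]
  intro ε hε
  -- `A` converts a uniform bound on the ball into an `L²` bound.
  set A : ℝ≥0∞ := volume (Metric.closedBall (0 : E d) ρ) ^ (1 / (2 : ℝ≥0∞).toReal) with hA
  have hAtop : A ≠ ⊤ := ENNReal.rpow_ne_top_of_nonneg (by simp)
    (measure_closedBall_lt_top (x := (0 : E d)) (r := ρ)).ne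
  have hlim : Tendsto (fun c : ℝ => ENNReal.ofReal c * A) (𝓝[>] 0) (𝓝 0) := by
    have : Tendsto (fun c : ℝ => ENNReal.ofReal c * A) (𝓝 0) (𝓝 (ENNReal.ofReal 0 * A)) :=
      ENNReal.Tendsto.mul_const (ENNReal.continuous_ofReal.tendsto 0) (Or.inr hAtop)
    simpa using this.mono_left nhdsWithin_le_nhds
  obtain ⟨c, hc, hc0⟩ := ((ENNReal.tendsto_nhds_zero.1 hlim ε hε).and
    self_mem_nhdsWithin).exists
  filter_upwards [hHs, hH c hc0] with i h1 h2
  refine (eLpNorm_sub_le_of_dist_bdd (s := Metric.closedBall (0 : E d) ρ) volume (by norm_num)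
    Metric.isClosed_closedBall.measurableSet (le_of_lt hc0) h2 (fun x hx => ?_)
    (fun x hx => ?_)).trans hc
  · exact mem_closedBall_zero_iff.2 (h1 x hx)
  · exact mem_closedBall_zero_iff.2 (hs x hx)

/-- Dilations act continuously on `L²`. -/
theorem tendsto_eLpNorm_comp_smul_sub [NormedSpace ℝ F] {v : E d → F} (hv : MemLp v 2 volume) :
    Tendsto (fun r : ℝ => eLpNorm (fun x => v (r • x) - v x) 2 volume) (𝓝 1) (𝓝 0) := by
  have hr : ∀ᶠ r : ℝ in 𝓝 1, 1 / 2 < r ∧ r < 2 :=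
    (lt_mem_nhds (by norm_num)).and (gt_mem_nhds (by norm_num))
  -- For `r > 1/2` the dilation has `L²` operator norm `r ^ (-d/2)`, which is below the crude
  -- constant `2 ^ d`.
  refine tendsto_eLpNorm_sub_of_dense (fun (r : ℝ) (h : E d → F) x => h (r • x))
    (C := ENNReal.ofReal (2 ^ d)) (by simp) hv ?_ ?_ ?_
  · intro h hh
    filter_upwards [hr] with r hr
    refine hh.1.comp_quasiMeasurePreserving ⟨measurable_smul_left r, ?_⟩
    rw [Measure.map_addHaar_smul volume (by linarith [hr.1])]
    exact Measure.smul_absolutelyContinuous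
  · intro h _ _
    filter_upwards [hr] with r hr
    have hr0 : 0 < r := by linarith [hr.1]
    refine (ENNReal.pow_le_pow_left_iff (n := 2) (by norm_num)).1 ?_
    have h1 := eLpNorm_comp_smul_sq (fun x => v x - h x) hr0
    change eLpNorm (fun x => v (r • x) - h (r • x)) 2 volume ^ 2 ≤ _
    rw [h1, mul_pow]
    change _ ≤ _ * eLpNorm (fun x => v x - h x) 2 volume ^ 2
    gcongr
    rw [← ENNReal.ofReal_pow (by positivity)]
    refine ENNReal.ofReal_le_ofReal ?_
    calc (r ^ d)⁻¹ = r⁻¹ ^ d := (inv_pow _ _).symm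
      _ ≤ 2 ^ d := by
          gcongr
          rw [inv_le_comm₀ hr0 (by norm_num)]
          linarith [hr.1]
      _ ≤ (2 ^ d) ^ 2 := by
          have : (1 : ℝ) ≤ 2 ^ d := one_le_pow₀ (by norm_num)
          nlinarith
  · intro h hcont hc
    obtain ⟨ρ, hρ0, hρ⟩ := exists_support_subset_closedBall hc
    have hsupp : ∀ r : ℝ, 1 / 2 < r → ∀ x, h (r • x) ≠ 0 → ‖x‖ ≤ 2 * ρ := by
      intro r hr x hx
      have := hρ _ hx
      rw [norm_smul, Real.norm_of_nonneg (by linarith)] at this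
      nlinarith [norm_nonneg x]
    refine tendsto_eLpNorm_sub_of_uniform (2 * ρ) (fun x hx => (hρ x hx).trans (by linarith)) ?_ ?_
    · filter_upwards [hr] with r hr x hx using hsupp r hr.1 x hx
    · intro ε hε
      obtain ⟨δ, hδ, hu⟩ := Metric.uniformContinuous_iff.1
        (hc.uniformContinuous_of_continuous hcont) ε hε
      have hlim : Tendsto (fun r : ℝ => |r - 1| * (2 * ρ)) (𝓝 1) (𝓝 0) := by
        have : Continuous fun r : ℝ => |r - 1| * (2 * ρ) := by fun_prop
        simpa using this.tendsto 1
      filter_upwards [hr, hlim.eventually (gt_mem_nhds hδ)] with r hr hrδ x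
      by_cases hx : ‖x‖ ≤ 2 * ρ
      · refine (hu ?_).le
        rw [dist_eq_norm]
        calc ‖r • x - x‖ = |r - 1| * ‖x‖ := by
              rw [← Real.norm_eq_abs, ← norm_smul, sub_smul, one_smul]
          _ ≤ |r - 1| * (2 * ρ) := by gcongr
          _ < δ := hrδ
      · have h1 : h (r • x) = 0 := by
          by_contra hne
          exact hx (hsupp r hr.1 x hne)
        have h2 : h x = 0 := by
          by_contra hne
          exact hx ((hρ x hne).trans (by linarith))
        simp [h1, h2, hε.le]

theorem integrable_inner {F : Type*} [NormedAddCommGroup F] [InnerProductSpace ℂ F] {a v : E d → F} (ha : MemLp a 2 volume)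
    (hv : MemLp v 2 volume) : Integrable (fun x => inner ℂ (a x) (v x)) volume := by
  refine ⟨ha.1.inner hv.1, ?_⟩
  calc _ ≤ ∫⁻ x, ‖a x‖ₑ * ‖v x‖ₑ := by
        refine lintegral_mono fun x => ?_
        rw [← ofReal_norm, ← ofReal_norm, ← ofReal_norm, ← ENNReal.ofReal_mul (norm_nonneg _)]
        exact ENNReal.ofReal_le_ofReal (norm_inner_le_norm _ _)
    _ ≤ _ := lintegral_enorm_mul_le ha.1 hv.1
    _ < ⊤ := ENNReal.mul_lt_top ha.2 hv.2

theorem tendsto_integral_inner {F : Type*} [NormedAddCommGroup F] [InnerProductSpace ℂ F] {ι : Type*} {l : Filter ι}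
    {a v : E d → F} {w : ι → E d → F} (ha : MemLp a 2 volume) (hv : MemLp v 2 volume)
    (hw : ∀ᶠ i in l, MemLp (w i) 2 volume)
    (h : Tendsto (fun i => eLpNorm (fun x => w i x - v x) 2 volume) l (𝓝 0)) :
    Tendsto (fun i => ∫ x, inner ℂ (a x) (w i x)) l (𝓝 (∫ x, inner ℂ (a x) (v x))) := by
  refine tendsto_integral_of_L1 _ (integrable_inner ha hv).1
    (hw.mono fun i hi => integrable_inner ha hi) ?_
  have hlim : Tendsto (fun i => eLpNorm a 2 volume * eLpNorm (fun x => w i x - v x) 2 volume)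
      l (𝓝 0) := by
    simpa using ENNReal.Tendsto.const_mul h (Or.inr ha.2.ne)
  refine tendsto_of_tendsto_of_tendsto_of_le_of_le' tendsto_const_nhds hlim
    (Eventually.of_forall fun _ => zero_le) (hw.mono fun i hi => ?_)
  calc _ ≤ ∫⁻ x, ‖a x‖ₑ * ‖w i x - v x‖ₑ := by
        refine lintegral_mono fun x => ?_
        rw [← inner_sub_right, ← ofReal_norm, ← ofReal_norm, ← ofReal_norm,
          ← ENNReal.ofReal_mul (norm_nonneg _)]
        exact ENNReal.ofReal_le_ofReal (norm_inner_le_norm _ _)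
    _ ≤ _ := lintegral_enorm_mul_le ha.1 (hi.1.sub hv.1)

end L2Convergence

/-! ### Mollification in `L²` and almost everywhere. -/

section Mollifier

variable {d : ℕ} {F : Type*} [NormedAddCommGroup F] [NormedSpace ℝ F]

/-- A sequence of bump functions with shrinking supports. -/
def mollifier (d n : ℕ) : ContDiffBump (0 : E d) where
  rIn := 1 / (2 * ((n : ℝ) + 1))
  rOut := 1 / ((n : ℝ) + 1)
  rIn_pos := by positivity
  rIn_lt_rOut := by
    have : (0 : ℝ) < (n : ℝ) + 1 := by positivity
    gcongr
    linarith

theorem tendsto_mollifier_rOut (d : ℕ) :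
    Tendsto (fun n => (mollifier d n).rOut) atTop (𝓝 0) :=
  tendsto_one_div_add_atTop_nhds_zero_nat

theorem mollifier_rOut_le_one (d n : ℕ) : (mollifier d n).rOut ≤ 1 := by
  change 1 / ((n : ℝ) + 1) ≤ 1
  rw [div_le_one (by positivity)]
  linarith [(Nat.cast_nonneg n : (0 : ℝ) ≤ n)]

/-- Mollification of a function. -/
def mollify (n : ℕ) (v : E d → F) : E d → F :=
  convolution ((mollifier d n).normed volume) v (ContinuousLinearMap.lsmul ℝ ℝ) volume

theorem mollify_apply (n : ℕ) (v : E d → F) (x : E d) :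
    mollify n v x = ∫ t, (mollifier d n).normed volume t • v (x - t) := rfl

theorem contDiff_normed (n : ℕ) : ContDiff ℝ ∞ ((mollifier d n).normed volume) :=
  (mollifier d n).contDiff_normed

theorem hasCompactSupport_normed (n : ℕ) :
    HasCompactSupport ((mollifier d n).normed (volume : Measure (E d))) :=
  (mollifier d n).hasCompactSupport_normed

theorem convolutionExists_mollify (n : ℕ) {v : E d → F} (hv : LocallyIntegrable v volume) :
    ConvolutionExists ((mollifier d n).normed volume) v (ContinuousLinearMap.lsmul ℝ ℝ) volume :=
  (hasCompactSupport_normed n).convolutionExists_left _ (contDiff_normed n).continuous hv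

theorem integrable_mollify (n : ℕ) {v : E d → F} (hv : LocallyIntegrable v volume) (x : E d) :
    Integrable (fun t => (mollifier d n).normed volume t • v (x - t)) volume :=
  convolutionExists_mollify n hv x

theorem contDiff_mollify (n : ℕ) {v : E d → F} (hv : LocallyIntegrable v volume) :
    ContDiff ℝ ∞ (mollify n v) :=
  (hasCompactSupport_normed n).contDiff_convolution_left _ (contDiff_normed n) hv

theorem mollify_support (n : ℕ) {v : E d → F} {ρ : ℝ} (hs : ∀ x, v x ≠ 0 → ‖x‖ ≤ ρ) (x : E d)
    (hx : mollify n v x ≠ 0) : ‖x‖ ≤ ρ + 1 := by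
  obtain ⟨a, ha, b, hb, rfl⟩ := Set.mem_add.1 (support_convolution_subset_swap _ hx)
  have h1 := hs a ha
  rw [ContDiffBump.support_normed_eq, mem_ball_zero_iff] at hb
  have := mollifier_rOut_le_one d n
  exact (norm_add_le a b).trans (by linarith)

theorem hasCompactSupport_mollify (n : ℕ) {v : E d → F} {ρ : ℝ}
    (hs : ∀ x, v x ≠ 0 → ‖x‖ ≤ ρ) : HasCompactSupport (mollify n v) :=
  HasCompactSupport.of_support_subset_isCompact (isCompact_closedBall 0 (ρ + 1))
    fun x hx => mem_closedBall_zero_iff.2 (mollify_support n hs x hx)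

theorem mollify_sub (n : ℕ) {v w : E d → F} (hv : LocallyIntegrable v volume)
    (hw : LocallyIntegrable w volume) : mollify n (v - w) = mollify n v - mollify n w := by
  ext x
  simp only [mollify_apply, Pi.sub_apply, smul_sub]
  exact integral_sub (integrable_mollify n hv x) (integrable_mollify n hw x)

theorem lintegral_normed (n : ℕ) :
    ∫⁻ t, ENNReal.ofReal ((mollifier d n).normed (volume : Measure (E d)) t) = 1 := by
  rw [← ofReal_integral_eq_lintegral_ofReal ((mollifier d n).integrable_normed)
    (Eventually.of_forall fun x => (mollifier d n).nonneg_normed x),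
    ContDiffBump.integral_normed, ENNReal.ofReal_one]

/-- Mollification does not increase the `L²` norm. -/
theorem eLpNorm_mollify_le (n : ℕ) {v : E d → F} (hm : StronglyMeasurable v) :
    eLpNorm (mollify n v) 2 volume ≤ eLpNorm v 2 volume := by
  set w : E d → ℝ≥0∞ := fun t => ENNReal.ofReal ((mollifier d n).normed volume t) with hw
  have hwm : Measurable w := (contDiff_normed n).continuous.measurable.ennreal_ofReal
  -- The kernel is a probability density. For the measure `μ` the `L¹` norm is at most the `L²`
  -- norm, which bounds `|mollify n v x|²` pointwise before Tonelli.
  set μ : Measure (E d) := volume.withDensity w with hμ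
  have hprob : IsProbabilityMeasure μ := ⟨by
    rw [hμ, withDensity_apply _ MeasurableSet.univ, Measure.restrict_univ, lintegral_normed]⟩
  have hvx : ∀ x, StronglyMeasurable fun t => v (x - t) := fun x =>
    hm.comp_measurable (measurable_const.sub measurable_id)
  have hpt : ∀ x, ‖mollify n v x‖ₑ ^ 2 ≤ ∫⁻ t, w t * ‖v (x - t)‖ₑ ^ 2 := by
    intro x
    have h1 : ‖mollify n v x‖ₑ ≤ eLpNorm (fun t => v (x - t)) 1 μ := by
      rw [mollify_apply, eLpNorm_one_eq_lintegral_enorm, hμ,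
        lintegral_withDensity_eq_lintegral_mul _ hwm (hvx x).enorm]
      refine (enorm_integral_le_lintegral_enorm _).trans (lintegral_mono fun t => ?_)
      rw [enorm_smul, Pi.mul_apply, hw, Real.enorm_of_nonneg ((mollifier d n).nonneg_normed t)]
    calc _ ≤ eLpNorm (fun t => v (x - t)) 2 μ ^ 2 := by
          gcongr
          exact h1.trans (eLpNorm_le_eLpNorm_of_exponent_le (by norm_num)
            (hvx x).aestronglyMeasurable)
      _ = _ := by
          rw [eLpNorm_two_sq, hμ, lintegral_withDensity_eq_lintegral_mul _ hwm
            ((hvx x).enorm.pow_const 2)]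
          rfl
  refine (ENNReal.pow_le_pow_left_iff (n := 2) (by norm_num)).1 ?_
  rw [eLpNorm_two_sq, eLpNorm_two_sq]
  calc _ ≤ ∫⁻ x, ∫⁻ t, w t * ‖v (x - t)‖ₑ ^ 2 := lintegral_mono hpt
    _ = ∫⁻ t, ∫⁻ x, w t * ‖v (x - t)‖ₑ ^ 2 := by
        refine lintegral_lintegral_swap (Measurable.aemeasurable ?_)
        exact (hwm.comp measurable_snd).mul ((hm.comp_measurable
          (measurable_fst.sub measurable_snd)).enorm.pow_const 2)
    _ = ∫⁻ t, w t * ∫⁻ x, ‖v x‖ₑ ^ 2 := by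
        refine lintegral_congr fun t => ?_
        have hvt : Measurable fun x => ‖v (x - t)‖ₑ ^ 2 :=
          (hm.comp_measurable (measurable_id.sub measurable_const)).enorm.pow_const 2
        rw [lintegral_const_mul _ hvt]
        congr 1
        exact lintegral_sub_right_eq_self (fun x => ‖v x‖ₑ ^ 2) t
    _ = _ := by rw [lintegral_mul_const _ hwm, lintegral_normed, one_mul]

variable [CompleteSpace F]

/-- Mollifications converge in `L²`. -/
theorem tendsto_eLpNorm_mollify_sub {v : E d → F} (hm : StronglyMeasurable v)
    (hv : MemLp v 2 volume) :
    Tendsto (fun n => eLpNorm (mollify n v - v) 2 volume) atTop (𝓝 0) := by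
  refine tendsto_eLpNorm_sub_of_dense (fun n (h : E d → F) => mollify n h) (C := 1) (by simp) hv
    (fun h hh => Eventually.of_forall fun n => (contDiff_mollify n
      (hh.locallyIntegrable (by norm_num))).continuous.aestronglyMeasurable) ?_ ?_
  · intro h hcont hc
    refine Eventually.of_forall fun n => ?_
    rw [← mollify_sub n (hv.locallyIntegrable (by norm_num)) hcont.locallyIntegrable, one_mul]
    exact eLpNorm_mollify_le n (hm.sub (hcont.stronglyMeasurable_of_hasCompactSupport hc))
  · intro h hcont hc
    obtain ⟨ρ, hρ0, hρ⟩ := exists_support_subset_closedBall hc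
    refine tendsto_eLpNorm_sub_of_uniform (ρ + 1) (fun x hx => (hρ x hx).trans (by linarith))
      (Eventually.of_forall fun n x hx => mollify_support n hρ x hx) ?_
    intro ε hε
    obtain ⟨δ, hδ, hu⟩ := Metric.uniformContinuous_iff.1
      (hc.uniformContinuous_of_continuous hcont) ε hε
    filter_upwards [(tendsto_mollifier_rOut d).eventually (gt_mem_nhds hδ)] with n hn x
    refine ContDiffBump.dist_normed_convolution_le hcont.aestronglyMeasurable fun y hy => ?_
    exact (hu ((Metric.mem_ball.1 hy).trans hn)).le

theorem ae_tendsto_mollify {v : E d → F} (hv : LocallyIntegrable v volume) :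
    ∀ᵐ x, Tendsto (fun n => mollify n v x) atTop (𝓝 (v x)) := by
  -- The value 2 is the exact ratio of the outer to the inner radius of `mollifier`.
  refine ContDiffBump.ae_convolution_tendsto_right_of_locallyIntegrable (K := 2)
    (tendsto_mollifier_rOut d) (Eventually.of_forall fun n => ?_) hv
  change 1 / ((n : ℝ) + 1) ≤ 2 * (1 / (2 * ((n : ℝ) + 1)))
  apply le_of_eq
  field_simp

end Mollifier

/-! ### Mollified weak gradients and integration by parts for two Sobolev functions. -/

section WeakGradient

variable {d : ℕ} {u v : E d → ℂ} {g h : E d → EuclideanSpace ℂ (Fin d)}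

theorem mollify_coord (n : ℕ) {w : E d → EuclideanSpace ℂ (Fin d)}
    (hw : LocallyIntegrable w volume) (x : E d) (i : Fin d) :
    mollify n w x i = ∫ t, (mollifier d n).normed volume t • w (x - t) i := by
  have := ((EuclideanSpace.proj i : EuclideanSpace ℂ (Fin d) →L[ℂ] ℂ).restrictScalars
    ℝ).integral_comp_comm (integrable_mollify n hw x)
  rw [mollify_apply]
  exact this.symm

/-- Mollification commutes with the weak gradient. -/
theorem HasWeakGradient.fderiv_mollify (hu : HasWeakGradient u g) (n : ℕ) (x : E d) (i : Fin d) :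
    fderiv ℝ (mollify n u) x (EuclideanSpace.single i 1) = mollify n g x i := by
  have hρ := contDiff_normed (d := d) n
  have hc := hasCompactSupport_normed (d := d) n
  have h1 := (hc.hasFDerivAt_convolution_left (ContinuousLinearMap.lsmul ℝ ℝ (E := ℂ))
    (hρ.of_le (by simp)) hu.1 x).fderiv
  have hex := (hc.fderiv ℝ).convolutionExists_left
    ((ContinuousLinearMap.lsmul ℝ ℝ (E := ℂ)).precompL (E d))
    (hρ.continuous_fderiv (by simp)) hu.1 x
  have h2 : fderiv ℝ (mollify n u) x (EuclideanSpace.single i 1)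
      = ∫ t, fderiv ℝ ((mollifier d n).normed volume) t (EuclideanSpace.single i 1)
        • u (x - t) := by
    change fderiv ℝ (convolution _ _ _ _) x _ = _
    rw [h1, convolution_def, ContinuousLinearMap.integral_apply hex]
    rfl
  -- The reflected kernel is an admissible test function. The sign from the reflection cancels the
  -- sign in the weak gradient identity.
  set φ : E d → ℝ := fun y => (mollifier d n).normed volume (x - y) with hφ
  have hφs : ContDiff ℝ ∞ φ := hρ.comp (contDiff_const.sub contDiff_id)
  have hφc : HasCompactSupport φ := hc.comp_homeomorph (Homeomorph.subLeft x)
  have hφd : ∀ y, fderiv ℝ φ y (EuclideanSpace.single i 1)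
      = - fderiv ℝ ((mollifier d n).normed volume) (x - y) (EuclideanSpace.single i 1) := by
    intro y
    have k1 := (hρ.differentiable (by simp) (x - y)).hasFDerivAt.comp y
      ((hasFDerivAt_id y).const_sub x)
    have k2 : fderiv ℝ φ y = _ := k1.fderiv
    rw [k2]
    simp
  have key := hu.3 φ hφs hφc i
  have e1 := integral_sub_left_eq_self (fun t => fderiv ℝ ((mollifier d n).normed volume) t
    (EuclideanSpace.single i 1) • u (x - t)) volume x
  have e2 := integral_sub_left_eq_self (fun t => (mollifier d n).normed volume t • g (x - t) i)
    volume x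
  simp only [sub_sub_cancel] at e1 e2
  rw [h2, mollify_coord n hu.2, ← e1, ← e2]
  simp only [hφd, neg_smul, integral_neg, neg_inj] at key
  exact key

/-- The derivative in direction `y` is the pairing of `y` with `mollify n g x`, so Cauchy-Schwarz
applies. This connects Sobolev inequalities, which involve `fderiv`, with the weak gradient. -/
theorem norm_fderiv_mollify_le (hu : HasWeakGradient u g) (n : ℕ) (x : E d) :
    ‖fderiv ℝ (mollify n u) x‖ ≤ ‖mollify n g x‖ := by
  refine ContinuousLinearMap.opNorm_le_bound _ (norm_nonneg _) fun y => ?_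
  have hy : fderiv ℝ (mollify n u) x y = pairing y (mollify n g x) := by
    generalize hL : fderiv ℝ (mollify n u) x = L
    conv_lhs => rw [← (EuclideanSpace.basisFun (Fin d) ℝ).sum_repr y]
    simp only [map_sum, map_smul, pairing]
    refine Finset.sum_congr rfl fun i _ => ?_
    rw [← hu.fderiv_mollify n x i, hL]
    simp
  rw [hy, mul_comm]
  have := enorm_pairing_le y (mollify n g x)
  rw [← ofReal_norm, ← ofReal_norm, ← ofReal_norm, ← ENNReal.ofReal_mul (norm_nonneg _)] at this
  exact (ENNReal.ofReal_le_ofReal_iff (by positivity)).1 this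

/-- Weak gradients are defined by real test functions. A complex `ζ` is split into real and
imaginary parts, and the identities are conjugated because the inner product is conjugate-linear in
its first argument. -/
theorem integral_inner_fderiv_test (hu : HasWeakGradient u g) {ζ : E d → ℂ} (hζ : ContDiff ℝ ∞ ζ)
    (hc : HasCompactSupport ζ) (i : Fin d) :
    ∫ x, inner ℂ (u x) (fderiv ℝ ζ x (EuclideanSpace.single i 1))
      = - ∫ x, inner ℂ (g x i) (ζ x) := by
  have hre : ContDiff ℝ ∞ fun x => (ζ x).re := Complex.reCLM.contDiff.comp hζ
  have him : ContDiff ℝ ∞ fun x => (ζ x).im := Complex.imCLM.contDiff.comp hζ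
  have cre : HasCompactSupport fun x => (ζ x).re := hc.comp_left (g := Complex.re) rfl
  have cim : HasCompactSupport fun x => (ζ x).im := hc.comp_left (g := Complex.im) rfl
  have dζ : ∀ x, HasFDerivAt ζ (fderiv ℝ ζ x) x := fun x =>
    (hζ.differentiable (by simp) x).hasFDerivAt
  have dre : ∀ x, fderiv ℝ (fun x => (ζ x).re) x (EuclideanSpace.single i 1)
      = (fderiv ℝ ζ x (EuclideanSpace.single i 1)).re := fun x => by
    have := (Complex.reCLM.hasFDerivAt.comp x (dζ x)).fderiv
    have h : fderiv ℝ (fun x => (ζ x).re) x = Complex.reCLM.comp (fderiv ℝ ζ x) := this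
    rw [h]
    rfl
  have dim : ∀ x, fderiv ℝ (fun x => (ζ x).im) x (EuclideanSpace.single i 1)
      = (fderiv ℝ ζ x (EuclideanSpace.single i 1)).im := fun x => by
    have := (Complex.imCLM.hasFDerivAt.comp x (dζ x)).fderiv
    have h : fderiv ℝ (fun x => (ζ x).im) x = Complex.imCLM.comp (fderiv ℝ ζ x) := this
    rw [h]
    rfl
  have k1 := congrArg conj (hu.3 _ hre cre i)
  have k2 := congrArg conj (hu.3 _ him cim i)
  have hg := locallyIntegrable_coord hu.2 i
  have conjI : ∀ {f : E d → ℂ}, Integrable f volume → Integrable (fun x => conj (f x)) volume :=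
    fun hf => (Complex.conjCLE : ℂ →L[ℝ] ℂ).integrable_comp hf
  have i1 := conjI (hu.1.integrable_smul_left_of_hasCompactSupport
    (continuous_partial hre (EuclideanSpace.single i 1)) (hasCompactSupport_partial cre _))
  have i2 := conjI (hu.1.integrable_smul_left_of_hasCompactSupport
    (continuous_partial him (EuclideanSpace.single i 1)) (hasCompactSupport_partial cim _))
  have i3 := conjI (hg.integrable_smul_left_of_hasCompactSupport hre.continuous cre)
  have i4 := conjI (hg.integrable_smul_left_of_hasCompactSupport him.continuous cim)
  have e1 : ∀ a z : ℂ, inner ℂ a z = conj (z.re • a) + Complex.I * conj (z.im • a) := by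
    intro a z
    simp only [RCLike.inner_apply, Complex.real_smul, map_mul, Complex.conj_ofReal]
    linear_combination (-(conj a)) * Complex.re_add_im z
  simp only [e1]
  simp only [dre, dim] at k1 k2 i1 i2
  rw [integral_add i1 (i2.const_mul _), integral_add i3 (i4.const_mul _), integral_const_mul,
    integral_const_mul, integral_conj, integral_conj, integral_conj, integral_conj, k1, k2]
  simp
  ring

/-- Integration by parts for two Sobolev functions, one of them compactly supported. -/
theorem IsH1.integral_inner_grad (hu : IsH1 u g) (hv : IsH1 v h) {ρ : ℝ}
    (hs : ∀ x, v x ≠ 0 → ‖x‖ ≤ ρ) (i : Fin d) :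
    ∫ x, inner ℂ (u x) (h x i) = - ∫ x, inner ℂ (g x i) (v x) := by
  have hproj : ∀ {w : E d → EuclideanSpace ℂ (Fin d)}, MemLp w 2 volume →
      MemLp (fun x => w x i) 2 volume := fun hw =>
    (EuclideanSpace.proj i : EuclideanSpace ℂ (Fin d) →L[ℂ] ℂ).comp_memLp' hw
  have hmem : ∀ {F : Type} [NormedAddCommGroup F] [NormedSpace ℝ F] {w : E d → F} (n : ℕ),
      StronglyMeasurable w → MemLp w 2 volume → MemLp (mollify n w) 2 volume :=
    fun n hm hw => ⟨(contDiff_mollify n (hw.locallyIntegrable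
      (by norm_num))).continuous.aestronglyMeasurable, (eLpNorm_mollify_le n hm).trans_lt hw.2⟩
  -- Only `v` is mollified: its bounded support makes the mollifications test functions, and `L²`
  -- convergence on both sides passes to the limit.
  have t1 : Tendsto (fun n => ∫ x, inner ℂ (u x) (mollify n h x i)) atTop
      (𝓝 (∫ x, inner ℂ (u x) (h x i))) := by
    refine tendsto_integral_inner hu.memLp (hproj hv.memLp_grad)
      (Eventually.of_forall fun n => hproj (hmem n hv.meas_grad hv.memLp_grad)) ?_
    refine tendsto_of_tendsto_of_tendsto_of_le_of_le tendsto_const_nhds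
      (tendsto_eLpNorm_mollify_sub hv.meas_grad hv.memLp_grad) (fun _ => zero_le) fun n => ?_
    refine eLpNorm_mono fun x => ?_
    exact PiLp.norm_apply_le (mollify n h x - h x) i
  have t2 : Tendsto (fun n => ∫ x, inner ℂ (g x i) (mollify n v x)) atTop
      (𝓝 (∫ x, inner ℂ (g x i) (v x))) :=
    tendsto_integral_inner (hproj hu.memLp_grad) hv.memLp
      (Eventually.of_forall fun n => hmem n hv.meas hv.memLp)
      (tendsto_eLpNorm_mollify_sub hv.meas hv.memLp)
  refine tendsto_nhds_unique t1 (t2.neg.congr fun n => ?_)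
  rw [← integral_inner_fderiv_test hu.weak (contDiff_mollify n hv.weak.1)
    (hasCompactSupport_mollify n hs) i]
  simp only [hv.weak.fderiv_mollify]

end WeakGradient

/-! ### Sobolev inequalities and local form bounds. -/

section LocalFormBound

variable {d : ℕ}

theorem support_fderiv_subset_closedBall {v : E d → ℂ} {ρ : ℝ} (hs : ∀ x, v x ≠ 0 → ‖x‖ ≤ ρ) :
    Function.support (fderiv ℝ v) ⊆ Metric.closedBall 0 ρ :=
  (support_fderiv_subset ℝ).trans (closure_minimal
    (fun x hx => mem_closedBall_zero_iff.2 (hs x hx)) Metric.isClosed_closedBall)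

/-- In dimension two the Sobolev inequality needs a gradient exponent `P < 2`. Hölder's inequality
on the bounded support brings back the `L²` norm of the gradient. -/
theorem eLpNorm_le_eLpNorm_two_of_support {F : Type*} [NormedAddCommGroup F] {f : E d → F}
    (hf : AEStronglyMeasurable f volume) {s : Set (E d)} (hs : Function.support f ⊆ s)
    {P : ℝ≥0∞} (hP : P ≤ 2) :
    eLpNorm f P volume ≤ eLpNorm f 2 volume *
      volume s ^ (1 / P.toReal - 1 / (2 : ℝ≥0∞).toReal) := by
  have := eLpNorm_le_eLpNorm_mul_rpow_measure_univ (μ := volume.restrict s) hP hf.restrict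
  rwa [Measure.restrict_apply_univ, eLpNorm_restrict_eq_of_support_subset hs,
    eLpNorm_restrict_eq_of_support_subset hs] at this

theorem eLpNorm_fderiv_le {v : E d → ℂ} (hv : ContDiff ℝ 1 v) {ρ : ℝ}
    (hs : ∀ x, v x ≠ 0 → ‖x‖ ≤ ρ) {P : ℝ≥0∞} (hP : P ≤ 2) :
    eLpNorm (fderiv ℝ v) P volume ≤ eLpNorm (fderiv ℝ v) 2 volume *
      volume (Metric.closedBall (0 : E d) ρ) ^ (1 / P.toReal - 1 / (2 : ℝ≥0∞).toReal) :=
  eLpNorm_le_eLpNorm_two_of_support (hv.continuous_fderiv one_ne_zero).aestronglyMeasurable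
    (support_fderiv_subset_closedBall hs) hP

/-- A Sobolev inequality in dimension at least two, with the `L²` norm of the gradient. -/
theorem exists_sobolev_const {P q : ℝ≥0} (h1 : 1 ≤ P) (h2 : P ≤ 2) (hPd : P < d)
    (hq : (P : ℝ)⁻¹ - (d : ℝ)⁻¹ ≤ (q : ℝ)⁻¹) (ρ : ℝ) :
    ∃ C : ℝ≥0∞, C ≠ ⊤ ∧ ∀ v : E d → ℂ, ContDiff ℝ 1 v → (∀ x, v x ≠ 0 → ‖x‖ ≤ ρ) →
      eLpNorm v q volume ≤ C * eLpNorm (fderiv ℝ v) 2 volume := by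
  have hfin : volume (Metric.closedBall (0 : E d) ρ) ^
      (1 / (P : ℝ≥0∞).toReal - 1 / (2 : ℝ≥0∞).toReal) ≠ ⊤ := by
    refine ENNReal.rpow_ne_top_of_nonneg ?_ (measure_closedBall_lt_top (x := (0 : E d))).ne
    have h1' : (0 : ℝ) < P := by exact_mod_cast one_pos.trans_le h1
    have h2' : (P : ℝ) ≤ 2 := by exact_mod_cast h2
    simp only [ENNReal.coe_toReal, ENNReal.toReal_ofNat, sub_nonneg]
    gcongr
  refine ⟨eLpNormLESNormFDerivOfLeConst ℂ (volume : Measure (E d)) (Metric.closedBall 0 ρ) P q *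
    volume (Metric.closedBall (0 : E d) ρ) ^ (1 / (P : ℝ≥0∞).toReal - 1 / (2 : ℝ≥0∞).toReal),
    ENNReal.mul_ne_top (by simp) hfin, fun v hv hs => ?_⟩
  calc eLpNorm v q volume ≤ _ * eLpNorm (fderiv ℝ v) P volume :=
        eLpNorm_le_eLpNorm_fderiv_of_le volume hv
          (fun x hx => mem_closedBall_zero_iff.2 (hs x hx)) h1
          (by rwa [finrank_euclideanSpace_fin]) (by rwa [finrank_euclideanSpace_fin])
          Metric.isBounded_closedBall
    _ ≤ _ := by
        rw [mul_assoc, mul_comm (volume _ ^ _)]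
        gcongr
        exact eLpNorm_fderiv_le hv hs (by exact_mod_cast h2)

/-- The one-dimensional Sobolev inequality. -/
theorem exists_sobolev_const_one (ρ : ℝ) :
    ∃ C : ℝ≥0∞, C ≠ ⊤ ∧ ∀ v : E 1 → ℂ, ContDiff ℝ 1 v → (∀ x, v x ≠ 0 → ‖x‖ ≤ ρ) →
      eLpNorm v ⊤ volume ≤ C * eLpNorm (fderiv ℝ v) 2 volume := by
  refine ⟨volume (Metric.closedBall (0 : E 1) ρ) ^
    (1 / (1 : ℝ≥0∞).toReal - 1 / (2 : ℝ≥0∞).toReal), ENNReal.rpow_ne_top_of_nonneg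
    (by norm_num) (measure_closedBall_lt_top (x := (0 : E 1))).ne, fun v hv hs => ?_⟩
  have he : MeasurePreserving (fun t : ℝ => (WithLp.toLp 2 fun _ => t : E 1)) volume volume :=
    (PiLp.volume_preserving_toLp (Fin 1)).comp ((volume_preserving_funUnique (Fin 1) ℝ).symm _)
  have hL : ∀ t : ℝ, (WithLp.toLp 2 fun _ => t : E 1) = t • EuclideanSpace.single 0 1 := by
    intro t
    ext i
    fin_cases i
    simp
  have hline : ContDiff ℝ 1 fun t : ℝ => v (t • EuclideanSpace.single 0 1) :=
    hv.comp (contDiff_id.smul contDiff_const)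
  have hlc : HasCompactSupport fun t : ℝ => v (t • EuclideanSpace.single 0 1) := by
    refine HasCompactSupport.of_support_subset_isCompact (isCompact_closedBall 0 ρ) fun t ht => ?_
    have := hs _ ht
    rw [mem_closedBall_zero_iff]
    simpa [norm_smul] using this
  have hder : ∀ t : ℝ, ‖deriv (fun t : ℝ => v (t • EuclideanSpace.single 0 1)) t‖ₑ
      ≤ ‖fderiv ℝ v (t • EuclideanSpace.single 0 1)‖ₑ := by
    intro t
    have h1 : HasDerivAt (fun t : ℝ => t • (EuclideanSpace.single 0 1 : E 1))
        ((1 : ℝ) • EuclideanSpace.single 0 1) t := (hasDerivAt_id t).smul_const _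
    have h2 := ((hv.differentiable one_ne_zero _).hasFDerivAt.comp_hasDerivAt t h1).deriv
    have h3 : deriv (fun t : ℝ => v (t • EuclideanSpace.single 0 1)) t = _ := h2
    rw [h3, ← ofReal_norm, ← ofReal_norm]
    refine ENNReal.ofReal_le_ofReal ((ContinuousLinearMap.le_opNorm _ _).trans ?_)
    simp
  -- A compactly supported function on the line is the integral of its derivative from the left.
  have hsup : ∀ x : E 1, ‖v x‖ₑ ≤ eLpNorm (fderiv ℝ v) 1 volume := by
    intro x
    have hx : x = x 0 • EuclideanSpace.single 0 1 := by
      ext i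
      fin_cases i
      simp
    calc ‖v x‖ₑ = ‖v (x 0 • EuclideanSpace.single 0 1)‖ₑ := by rw [← hx]
      _ ≤ ∫⁻ t in Set.Iic (x 0), ‖deriv (fun t : ℝ => v (t • EuclideanSpace.single 0 1)) t‖ₑ :=
          HasCompactSupport.enorm_le_lintegral_Ici_deriv hline hlc (x 0)
      _ ≤ ∫⁻ t, ‖deriv (fun t : ℝ => v (t • EuclideanSpace.single 0 1)) t‖ₑ :=
          setLIntegral_le_lintegral _ _
      _ ≤ ∫⁻ t : ℝ, ‖fderiv ℝ v (WithLp.toLp 2 fun _ => t : E 1)‖ₑ :=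
          lintegral_mono fun t => by rw [hL]; exact hder t
      _ = ∫⁻ y, ‖fderiv ℝ v y‖ₑ :=
          he.lintegral_comp (f := fun y => ‖fderiv ℝ v y‖ₑ)
            (hv.continuous_fderiv one_ne_zero).measurable.enorm
      _ = _ := eLpNorm_one_eq_lintegral_enorm.symm
  rw [mul_comm]
  refine le_trans ?_ (eLpNorm_fderiv_le hv hs (P := 1) (by norm_num))
  rw [eLpNorm_exponent_top]
  exact eLpNormEssSup_le_of_ae_enorm_bound (Eventually.of_forall hsup)

/-- The Sobolev exponents dual to the local integrability exponents of the potential. -/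
theorem exists_sobolev_exponents (hd : 1 ≤ d) {p : ℝ≥0∞} (h1 : d = 1 → p = 1)
    (h2 : d = 2 → 1 < p) (h3 : 3 ≤ d → p = (d : ℝ≥0∞) / 2) (ρ : ℝ) :
    ∃ p₀ p' q : ℝ≥0∞, p₀ ≤ p ∧ ENNReal.HolderTriple p₀ p' 1 ∧ ENNReal.HolderTriple q q p' ∧
      ∃ C : ℝ≥0∞, C ≠ ⊤ ∧ ∀ v : E d → ℂ, ContDiff ℝ 1 v → (∀ x, v x ≠ 0 → ‖x‖ ≤ ρ) →
        eLpNorm v q volume ≤ C * eLpNorm (fderiv ℝ v) 2 volume := by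
  rcases hd.lt_or_eq with hd2 | hd1
  -- With `p'` dual to `p₀` and `q = 2p'`, one has `1/q = 1/2 - 1/(2p₀)`, so the last condition is
  -- the Sobolev relation between `P` and `q`. For `d ≥ 3` it is an equality at `P = 2`, `p₀ = d/2`.
  · have hex : ∃ p₀ : ℝ≥0, (p₀ : ℝ≥0∞) ≤ p ∧ 1 < p₀ ∧ ∃ P : ℝ≥0, 1 ≤ P ∧ P ≤ 2 ∧ P < d ∧
        (P : ℝ)⁻¹ - (d : ℝ)⁻¹ ≤ 1 / 2 - 1 / (2 * p₀) := by
      rcases (show d = 2 ∨ 3 ≤ d by omega) with hd' | hd'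
      · obtain ⟨p₀, hp1, hp2⟩ := ENNReal.lt_iff_exists_nnreal_btwn.1 (h2 hd')
        have hp1' : 1 < p₀ := by exact_mod_cast hp1
        have hp1r : (1 : ℝ) < p₀ := by exact_mod_cast hp1'
        have h0 : (0 : ℝ) < 2 * p₀ - 1 := by linarith
        -- This `P` solves `1/P - 1/2 = 1/2 - 1/(2p₀)`, and `P < 2` exactly because `p₀ > 1`. A
        -- finite `p₀` below `p` is taken since `p` may be infinite.
        obtain ⟨P, hP⟩ : ∃ P : ℝ≥0, (P : ℝ) = 2 * p₀ / (2 * p₀ - 1) :=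
          ⟨Real.toNNReal _, Real.coe_toNNReal _ (by positivity)⟩
        refine ⟨p₀, hp2.le, hp1', P, ?_, ?_, ?_, ?_⟩
        · rw [← NNReal.coe_le_coe, hP, NNReal.coe_one, le_div_iff₀ h0]
          linarith
        · rw [← NNReal.coe_le_coe, hP, div_le_iff₀ h0]
          push_cast
          linarith
        · rw [← NNReal.coe_lt_coe, hP, hd', div_lt_iff₀ h0]
          push_cast
          linarith
        · rw [hP, hd']
          apply le_of_eq
          push_cast
          field_simp
          ring
      · have hdr : (3 : ℝ) ≤ d := by exact_mod_cast hd'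
        refine ⟨(d : ℝ≥0) / 2, ?_, ?_, 2, by norm_num, le_rfl, by exact_mod_cast hd', ?_⟩
        · rw [h3 hd', ENNReal.coe_div (by norm_num)]
          simp
        · rw [← NNReal.coe_lt_coe]
          push_cast
          linarith
        · push_cast
          apply le_of_eq
          field_simp
    obtain ⟨p₀, hp, hp1, P, hP1, hP2, hPd, hPq⟩ := hex
    have hp1r : (1 : ℝ) < p₀ := by exact_mod_cast hp1
    have h0 : (0 : ℝ) < p₀ - 1 := by linarith
    obtain ⟨p', hp'r⟩ : ∃ p' : ℝ≥0, (p' : ℝ) = p₀ / (p₀ - 1) :=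
      ⟨Real.toNNReal _, Real.coe_toNNReal _ (by positivity)⟩
    have hp'0 : 0 < p' := by
      rw [← NNReal.coe_pos, hp'r]
      positivity
    refine ⟨p₀, p', (2 * p' : ℝ≥0), hp, ⟨?_⟩, ⟨?_⟩, ?_⟩
    · have hne : p₀ ≠ 0 := (one_pos.trans hp1).ne'
      rw [← ENNReal.coe_inv hne, ← ENNReal.coe_inv hp'0.ne', inv_one, ← ENNReal.coe_add,
        ENNReal.coe_eq_one, ← NNReal.coe_inj]
      push_cast
      rw [hp'r]
      field_simp
      ring
    · rw [← ENNReal.coe_inv (by positivity), ← ENNReal.coe_inv hp'0.ne', ← ENNReal.coe_add,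
        ENNReal.coe_inj, ← NNReal.coe_inj]
      push_cast
      field_simp
      ring
    · refine exists_sobolev_const hP1 hP2 hPd (hPq.trans (le_of_eq ?_)) ρ
      push_cast
      rw [hp'r]
      field_simp
  · subst hd1
    refine ⟨1, ⊤, ⊤, (h1 rfl).ge, ⟨by simp⟩, ⟨by simp⟩, exists_sobolev_const_one ρ⟩

/-- Locally integrable weights of the critical Sobolev integrability are locally form-bounded. -/
theorem exists_local_form_bound (hd : 1 ≤ d) {p : ℝ≥0∞} (h1 : d = 1 → p = 1)
    (h2 : d = 2 → 1 < p) (h3 : 3 ≤ d → p = (d : ℝ≥0∞) / 2) {W : E d → ℝ}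
    (hWm : StronglyMeasurable W) (hW : LocMemLp W p) (ρ : ℝ) :
    ∃ C : ℝ≥0∞, C ≠ ⊤ ∧ ∀ u g, IsH1 u g → (∀ x, u x ≠ 0 → ‖x‖ ≤ ρ) →
      ∫⁻ x, ‖W x‖ₑ * ‖u x‖ₑ ^ 2 ≤ C * eLpNorm g 2 volume ^ 2 := by
  -- The radius `ρ + 1` leaves room for mollification, which enlarges supports by at most one.
  obtain ⟨p₀, p', q, hp₀, ht1, ht2, C, hC, hsob⟩ := exists_sobolev_exponents hd h1 h2 h3 (ρ + 1)
  set B : Set (E d) := Metric.closedBall 0 (ρ + 1) with hB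
  have hWB : MemLp W p₀ (volume.restrict B) :=
    haveI : IsFiniteMeasure (volume.restrict B) :=
      ⟨by rw [Measure.restrict_apply_univ]; exact measure_closedBall_lt_top⟩
    (hW B (isCompact_closedBall _ _)).mono_exponent hp₀
  refine ⟨eLpNorm W p₀ (volume.restrict B) * C ^ 2,
    ENNReal.mul_ne_top hWB.2.ne (ENNReal.pow_ne_top hC), fun u g hu hs => ?_⟩
  have hsmooth : ∀ v : E d → ℂ, ContDiff ℝ 1 v → (∀ x, v x ≠ 0 → ‖x‖ ≤ ρ + 1) →
      ∫⁻ x, ‖W x‖ₑ * ‖v x‖ₑ ^ 2 ≤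
        eLpNorm W p₀ (volume.restrict B) * C ^ 2 * eLpNorm (fderiv ℝ v) 2 volume ^ 2 := by
    intro v hv hvs
    have hsup : Function.support v ⊆ B := fun x hx => mem_closedBall_zero_iff.2 (hvs x hx)
    have e1 : ∫⁻ x, ‖W x‖ₑ * ‖v x‖ₑ ^ 2 = eLpNorm (W • (v • v)) 1 (volume.restrict B) := by
      rw [eLpNorm_one_eq_lintegral_enorm, ← lintegral_indicator
        Metric.isClosed_closedBall.measurableSet]
      refine lintegral_congr fun x => ?_
      by_cases hx : x ∈ B
      · rw [Set.indicator_of_mem hx]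
        simp only [Pi.smul_apply', enorm_smul]
        ring
      · rw [Set.indicator_of_notMem hx]
        have : v x = 0 := by
          by_contra h
          exact hx (hsup h)
        simp [this]
    have hvm := hv.continuous.aestronglyMeasurable (μ := volume.restrict B)
    rw [e1]
    calc _ ≤ eLpNorm W p₀ (volume.restrict B) * eLpNorm (v • v) p' (volume.restrict B) :=
          eLpNorm_smul_le_mul_eLpNorm (hvm.smul hvm) hWB.1
      _ ≤ eLpNorm W p₀ (volume.restrict B) *
          (eLpNorm v q (volume.restrict B) * eLpNorm v q (volume.restrict B)) := by
          gcongr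
          exact eLpNorm_smul_le_mul_eLpNorm hvm hvm
      _ ≤ eLpNorm W p₀ (volume.restrict B) *
          ((C * eLpNorm (fderiv ℝ v) 2 volume) * (C * eLpNorm (fderiv ℝ v) 2 volume)) := by
          have := (eLpNorm_restrict_le v q volume B).trans (hsob v hv hvs)
          gcongr
      _ = _ := by ring
  have hconv : ∀ᵐ x, Tendsto (fun n => ‖W x‖ₑ * ‖mollify n u x‖ₑ ^ 2) atTop
      (𝓝 (‖W x‖ₑ * ‖u x‖ₑ ^ 2)) := by
    filter_upwards [ae_tendsto_mollify hu.weak.1] with x hx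
    exact ENNReal.Tendsto.const_mul (ENNReal.Tendsto.pow hx.enorm) (Or.inr (by simp))
  -- Fatou's lemma transfers the smooth bound to `u`, since mollification does not increase the `L²`
  -- norm of the gradient.
  calc ∫⁻ x, ‖W x‖ₑ * ‖u x‖ₑ ^ 2
      = ∫⁻ x, liminf (fun n => ‖W x‖ₑ * ‖mollify n u x‖ₑ ^ 2) atTop :=
        lintegral_congr_ae (hconv.mono fun x hx => hx.liminf_eq.symm)
    _ ≤ liminf (fun n => ∫⁻ x, ‖W x‖ₑ * ‖mollify n u x‖ₑ ^ 2) atTop :=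
        lintegral_liminf_le fun n => hWm.enorm.mul
          ((contDiff_mollify n hu.weak.1).continuous.measurable.enorm.pow_const 2)
    _ ≤ _ := by
        refine liminf_le_of_frequently_le' (Frequently.of_forall fun n => ?_)
        refine (hsmooth _ ((contDiff_mollify n hu.weak.1).of_le (by simp))
          (mollify_support n hs)).trans ?_
        gcongr
        calc _ ≤ eLpNorm (mollify n g) 2 volume :=
              eLpNorm_mono fun x => norm_fderiv_mollify_le hu.weak n x
          _ ≤ _ := eLpNorm_mollify_le n hu.meas_grad

end LocalFormBound

/-! ### The dilation virial identity and the case of small potentials. -/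

section Virial

variable {d : ℕ} {u f : E d → ℂ} {g : E d → EuclideanSpace ℂ (Fin d)} {V : E d → ℝ}

/-- `-Δu + V u = μ u + f` weakly, where `g = ∇u`. -/
def IsWeakSolution (V : E d → ℝ) (μ : ℝ) (u : E d → ℂ) (g : E d → EuclideanSpace ℂ (Fin d))
    (f : E d → ℂ) : Prop :=
  ∀ φ γ, IsH1 φ γ → (∫ x, inner ℂ (γ x) (g x)) + (∫ x, (V x : ℂ) * (conj (φ x) * u x))
    = μ * (∫ x, inner ℂ (φ x) (u x)) + ∫ x, inner ℂ (φ x) (f x)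

theorem IsAdmissible.integrable_of_isH1 (hV : IsAdmissible V) {φ ψ : E d → ℂ}
    {γ h : E d → EuclideanSpace ℂ (Fin d)} (hφ : IsH1 φ γ) (hψ : IsH1 ψ h) :
    Integrable (fun x => (V x : ℂ) * (conj (φ x) * ψ x)) volume := by
  obtain ⟨a, ha, -⟩ := hφ.exists_W12
  obtain ⟨b, hb, -⟩ := hψ.exists_W12
  refine (hV.integrable a b).congr ?_
  filter_upwards [ha, hb] with x h1 h2
  rw [h1, h2]

/-- The dilation form of the virial identity. -/
theorem IsWeakSolution.virial {μ : ℝ} (hs : IsWeakSolution V μ u g f) (hu : IsH1 u g) {r : ℝ}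
    (hr : 0 < r) :
    (r - r⁻¹) * (∫ x, inner ℂ (g x) (g (r • x))).re
      = (r ^ d)⁻¹ * (∫ x, (V x : ℂ) * (conj (u (r⁻¹ • x)) * u x)).re
        - (∫ x, (V x : ℂ) * (conj (u (r • x)) * u x)).re
        + (∫ x, inner ℂ (u (r • x)) (f x)).re
        - (r ^ d)⁻¹ * (∫ x, inner ℂ (u (r⁻¹ • x)) (f x)).re := by
  have hri : 0 < r⁻¹ := inv_pos.2 hr
  -- Multiplied by `r⁻ᵈ`, the second identity has the same `μ` term as the first up to complex
  -- conjugation. Taking real parts and subtracting removes it, because `μ` is real.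
  have t1 := hs _ _ (hu.comp_smul hr)
  have t2 := hs _ _ (hu.comp_smul hri)
  simp only [inner_smul_left, Complex.conj_ofReal, integral_const_mul] at t1 t2
  have c1 := integral_comp_smul (fun x => inner ℂ (g (r⁻¹ • x)) (g x)) hr
  have c2 := integral_comp_smul (fun x => inner ℂ (u (r⁻¹ • x)) (u x)) hr
  simp only [inv_smul_smul₀ hr.ne'] at c1 c2
  have s1 : (∫ x, inner ℂ (g (r • x)) (g x)).re = (∫ x, inner ℂ (g x) (g (r • x))).re := by
    have : ∫ x, inner ℂ (g (r • x)) (g x) = conj (∫ x, inner ℂ (g x) (g (r • x))) := by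
      rw [← integral_conj]
      exact integral_congr_ae (Eventually.of_forall fun x => (inner_conj_symm _ _).symm)
    rw [this, Complex.conj_re]
  have s2 : (∫ x, inner ℂ (u (r • x)) (u x)).re = (∫ x, inner ℂ (u x) (u (r • x))).re := by
    have : ∫ x, inner ℂ (u (r • x)) (u x) = conj (∫ x, inner ℂ (u x) (u (r • x))) := by
      rw [← integral_conj]
      exact integral_congr_ae (Eventually.of_forall fun x => (inner_conj_symm _ _).symm)
    rw [this, Complex.conj_re]
  have r1 := congrArg Complex.re t1
  have r2 := congrArg Complex.re t2
  have r3 := congrArg Complex.re c1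
  have r4 := congrArg Complex.re c2
  simp only [Complex.add_re, Complex.re_ofReal_mul, Complex.smul_re, smul_eq_mul] at r1 r2 r3 r4
  rw [s1, s2] at r1
  rw [r3] at r1 ⊢
  rw [r4] at r1
  have key := congrArg (fun t => (r ^ d)⁻¹ * t) r2
  linear_combination r1 - key

theorem abs_re_integral_inner_le {F : Type*} [NormedAddCommGroup F] [InnerProductSpace ℂ F]
    {a b : E d → F} {M : ℝ≥0∞} (hM : M ≠ ⊤) (h : ∫⁻ x, ‖a x‖ₑ * ‖b x‖ₑ ≤ M) :
    |(∫ x, inner ℂ (a x) (b x)).re| ≤ M.toReal := by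
  refine (Complex.abs_re_le_norm _).trans ?_
  rw [← toReal_enorm]
  refine ENNReal.toReal_mono hM (le_trans (enorm_integral_le_lintegral_enorm _) (le_trans ?_ h))
  refine lintegral_mono fun x => ?_
  rw [← ofReal_norm, ← ofReal_norm, ← ofReal_norm, ← ENNReal.ofReal_mul (norm_nonneg _)]
  exact ENNReal.ofReal_le_ofReal (norm_inner_le_norm _ _)

theorem lintegral_dilation_sub_le_of_aestronglyMeasurable (hu : IsH1 u g) {h : E d → ℂ}
    (hh : AEStronglyMeasurable h volume) {r : ℝ} (hr : 1 ≤ r) :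
    ∫⁻ x, ‖u (r • x) - u x‖ₑ * ‖h x‖ₑ ≤ ENNReal.ofReal (r - 1) *
      (eLpNorm g 2 volume * eLpNorm (fun x => ‖x‖ • h x) 2 volume) := by
  have e1 : ∫⁻ x, ‖u (r • x) - u x‖ₑ * ‖h x‖ₑ = ∫⁻ x, ‖u (r • x) - u x‖ₑ * ‖hh.mk h x‖ₑ :=
    lintegral_congr_ae (hh.ae_eq_mk.mono fun x hx => by simp only; rw [← hx])
  have e2 : eLpNorm (fun x => ‖x‖ • h x) 2 volume = eLpNorm (fun x => ‖x‖ • hh.mk h x) 2 volume :=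
    eLpNorm_congr_ae (hh.ae_eq_mk.mono fun x hx => by simp only; rw [← hx])
  rw [e1, e2]
  exact hu.weak.lintegral_dilation_sub_le hu.meas hu.meas_grad hh.stronglyMeasurable_mk hr

/-- Bernoulli's inequality for `r⁻¹`, followed by `1 - r⁻¹ ≤ r - 1`. It bounds the Jacobian defect
and is the origin of the summand `d` in `d + 2`. -/
theorem one_sub_inv_pow_le {r : ℝ} (hr : 1 ≤ r) (d : ℕ) : 1 - (r ^ d)⁻¹ ≤ d * (r - 1) := by
  have hr0 : 0 < r := by linarith
  have h1 := one_add_mul_le_pow (a := r⁻¹ - 1) (by linarith [inv_pos.2 hr0]) d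
  have h2 : 1 - r⁻¹ ≤ r - 1 := by
    have : 2 ≤ r + r⁻¹ := by
      rw [← sub_nonneg]
      have : r + r⁻¹ - 2 = (r - 1) ^ 2 / r := by
        field_simp
        ring
      rw [this]
      positivity
    linarith
  have h3 : (d : ℝ) * (1 - r⁻¹) ≤ d * (r - 1) := by gcongr
  rw [add_sub_cancel, inv_pow] at h1
  linarith

/-- The symmetric dilation difference of `u`, tested against `h`. -/
theorem abs_dilation_difference_le (hu : IsH1 u g) {h : E d → ℂ}
    (hh : AEStronglyMeasurable h volume)
    (hint : ∀ φ γ, IsH1 φ γ → Integrable (fun x => inner ℂ (φ x) (h x)) volume)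
    (hx : eLpNorm (fun x => ‖x‖ • h x) 2 volume ≠ ⊤) {r : ℝ} (hr : 1 ≤ r) :
    |(∫ x, inner ℂ (u (r • x)) (h x)).re - (r ^ d)⁻¹ * (∫ x, inner ℂ (u (r⁻¹ • x)) (h x)).re| ≤
      (r - 1) * (2 * ((eLpNorm g 2 volume).toReal * (eLpNorm (fun x => ‖x‖ • h x) 2 volume).toReal)
        + d * |(∫ x, inner ℂ (u x) (h x)).re|) := by
  have hr0 : 0 < r := by linarith
  have hri : 0 < r⁻¹ := inv_pos.2 hr0
  have hr1 : 0 ≤ r - 1 := by linarith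
  set N := eLpNorm (fun x => ‖x‖ • h x) 2 volume with hN
  have i0 := hint _ _ hu
  have i1 := hint _ _ (hu.comp_smul hr0)
  have hw := hu.comp_smul hri
  have i2 := hint _ _ hw
  have b1 : |(∫ x, inner ℂ (u (r • x)) (h x)).re - (∫ x, inner ℂ (u x) (h x)).re| ≤
      (r - 1) * ((eLpNorm g 2 volume).toReal * N.toReal) := by
    rw [← Complex.sub_re, ← integral_sub i1 i0]
    simp only [← inner_sub_left]
    refine (abs_re_integral_inner_le ?_
      (lintegral_dilation_sub_le_of_aestronglyMeasurable hu hh hr)).trans (le_of_eq ?_)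
    · exact ENNReal.mul_ne_top (by simp) (ENNReal.mul_ne_top hu.memLp_grad.2.ne hx)
    · rw [ENNReal.toReal_mul, ENNReal.toReal_mul, ENNReal.toReal_ofReal hr1]
  have b2 : (r ^ d)⁻¹ * |(∫ x, inner ℂ (u x) (h x)).re - (∫ x, inner ℂ (u (r⁻¹ • x)) (h x)).re| ≤
      (r - 1) * ((eLpNorm g 2 volume).toReal * N.toReal) := by
    -- The dilation bound requires a factor at least one, so it is applied to `w = u(r⁻¹·)`, for
    -- which `w(r·) = u`. The growth of `‖∇w‖`, at most `r ^ (d/2)`, is absorbed by the prefactor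
    -- `r⁻ᵈ`.
    have hwb := lintegral_dilation_sub_le_of_aestronglyMeasurable hw hh hr
    simp only [inv_smul_smul₀ hr0.ne'] at hwb
    rw [← Complex.sub_re, ← integral_sub i0 i2]
    simp only [← inner_sub_left]
    have hb := abs_re_integral_inner_le (ENNReal.mul_ne_top (by simp)
      (ENNReal.mul_ne_top hw.memLp_grad.2.ne hx)) hwb
    rw [ENNReal.toReal_mul, ENNReal.toReal_mul, ENNReal.toReal_ofReal hr1] at hb
    set G := (eLpNorm g 2 volume).toReal with hG
    set G' := (eLpNorm (fun x => ((r⁻¹ : ℝ) : ℂ) • g (r⁻¹ • x)) 2 volume).toReal with hG'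
    have hsq : ((r ^ d)⁻¹ * G') ^ 2 ≤ G ^ 2 := by
      have e1 : eLpNorm (fun x => ((r⁻¹ : ℝ) : ℂ) • g (r⁻¹ • x)) 2 volume
          ≤ eLpNorm (fun x => g (r⁻¹ • x)) 2 volume := by
        refine eLpNorm_mono fun x => ?_
        rw [norm_smul, Complex.norm_real, Real.norm_of_nonneg hri.le]
        exact mul_le_of_le_one_left (norm_nonneg _) (inv_le_one_of_one_le₀ hr)
      have e2 := congrArg ENNReal.toReal (eLpNorm_comp_smul_sq g hri)
      rw [ENNReal.toReal_mul, ENNReal.toReal_pow, ENNReal.toReal_pow,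
        ENNReal.toReal_ofReal (by positivity), inv_pow, inv_inv] at e2
      have e3 : G' ≤ (eLpNorm (fun x => g (r⁻¹ • x)) 2 volume).toReal :=
        ENNReal.toReal_mono (memLp_comp_smul hu.meas_grad hu.memLp_grad hri).2.ne e1
      have e4 : (1 : ℝ) ≤ r ^ d := one_le_pow₀ hr
      calc ((r ^ d)⁻¹ * G') ^ 2
          ≤ ((r ^ d)⁻¹ * (eLpNorm (fun x => g (r⁻¹ • x)) 2 volume).toReal) ^ 2 := by
            gcongr
        _ = (r ^ d)⁻¹ * G ^ 2 := by
            rw [mul_pow, e2, ← hG]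
            field_simp
        _ ≤ 1 * G ^ 2 := by
            gcongr
            exact inv_le_one_of_one_le₀ e4
        _ = G ^ 2 := one_mul _
    have hGG : (r ^ d)⁻¹ * G' ≤ G := le_of_sq_le_sq hsq ENNReal.toReal_nonneg
    calc _ ≤ (r ^ d)⁻¹ * ((r - 1) * (G' * N.toReal)) := by gcongr
      _ = (r - 1) * (((r ^ d)⁻¹ * G') * N.toReal) := by ring
      _ ≤ _ := by gcongr
  have b3 := one_sub_inv_pow_le hr d
  have b4 : 0 ≤ 1 - (r ^ d)⁻¹ := by
    have := inv_le_one_of_one_le₀ (one_le_pow₀ (n := d) hr)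
    linarith
  have hrd : 0 ≤ (r ^ d)⁻¹ := by positivity
  set A := (∫ x, inner ℂ (u (r • x)) (h x)).re
  set B := (∫ x, inner ℂ (u x) (h x)).re
  set D := (∫ x, inner ℂ (u (r⁻¹ • x)) (h x)).re
  have hsplit : A - (r ^ d)⁻¹ * D = (A - B) + (r ^ d)⁻¹ * (B - D) + (1 - (r ^ d)⁻¹) * B := by ring
  rw [hsplit]
  calc _ ≤ |A - B| + |(r ^ d)⁻¹ * (B - D)| + |(1 - (r ^ d)⁻¹) * B| := abs_add_three _ _ _
    _ = |A - B| + (r ^ d)⁻¹ * |B - D| + (1 - (r ^ d)⁻¹) * |B| := by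
        rw [abs_mul, abs_mul, abs_of_nonneg hrd, abs_of_nonneg b4]
    _ ≤ (r - 1) * ((eLpNorm g 2 volume).toReal * N.toReal)
        + (r - 1) * ((eLpNorm g 2 volume).toReal * N.toReal) + (d * (r - 1)) * |B| := by
        gcongr
    _ = _ := by ring

/-- The limit `r → 1` in the virial identity. -/
theorem two_mul_sq_le_of_virial (hu : IsH1 u g) {M : ℝ}
    (hM : ∀ᶠ r in 𝓝[>] (1 : ℝ),
      (r - r⁻¹) * (∫ x, inner ℂ (g x) (g (r • x))).re ≤ (r - 1) * M) :
    2 * (eLpNorm g 2 volume).toReal ^ 2 ≤ M := by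
  have t1 : Tendsto (fun r : ℝ => ∫ x, inner ℂ (g x) (g (r • x))) (𝓝[>] 1)
      (𝓝 (∫ x, inner ℂ (g x) (g x))) := by
    refine tendsto_integral_inner hu.memLp_grad hu.memLp_grad ?_
      ((tendsto_eLpNorm_comp_smul_sub hu.memLp_grad).mono_left nhdsWithin_le_nhds)
    filter_upwards [self_mem_nhdsWithin] with r hr
    exact memLp_comp_smul hu.meas_grad hu.memLp_grad (one_pos.trans hr)
  have e1 : (∫ x, inner ℂ (g x) (g x)).re = (eLpNorm g 2 volume).toReal ^ 2 := by
    have h1 : ∀ x, inner ℂ (g x) (g x) = ((‖g x‖ ^ 2 : ℝ) : ℂ) := fun x => by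
      rw [inner_self_eq_norm_sq_to_K]
      simp
    have hm : AEStronglyMeasurable (fun x => ‖g x‖ ^ 2) volume :=
      (hu.meas_grad.norm.pow 2).aestronglyMeasurable
    simp only [h1]
    rw [integral_complex_ofReal, Complex.ofReal_re, ← ENNReal.toReal_pow, eLpNorm_two_sq,
      integral_eq_lintegral_of_nonneg_ae (Eventually.of_forall fun x => sq_nonneg ‖g x‖) hm]
    congr 1
    refine lintegral_congr fun x => ?_
    rw [ENNReal.ofReal_pow (norm_nonneg _), ofReal_norm]
  -- The factorization `r - r⁻¹ = (r - 1)(1 + r⁻¹)` makes the constant `2` appear as the limit of `1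
  -- + r⁻¹`.
  have t2 : Tendsto (fun r : ℝ => (1 + r⁻¹) * (∫ x, inner ℂ (g x) (g (r • x))).re) (𝓝[>] 1)
      (𝓝 ((1 + 1⁻¹) * (eLpNorm g 2 volume).toReal ^ 2)) := by
    rw [← e1]
    refine Tendsto.mul ?_ ((Complex.continuous_re.tendsto _).comp t1)
    exact ((tendsto_inv₀ one_ne_zero).const_add 1).mono_left nhdsWithin_le_nhds
  have t3 := le_of_tendsto t2 (b := M) (by
    filter_upwards [hM, self_mem_nhdsWithin] with r h1 hr
    have hr1 : 0 < r - 1 := sub_pos.2 hr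
    have hr0 : 0 < r := one_pos.trans hr
    have h2 : r - r⁻¹ = (r - 1) * (1 + r⁻¹) := by
      field_simp
      ring
    rw [h2, mul_assoc] at h1
    exact le_of_mul_le_mul_left h1 hr1)
  norm_num at t3
  exact t3

/-- An eigenfunction vanishes if `V` is small in the sense of the two form bounds. -/
theorem eq_zero_of_small (hd : 1 ≤ d) (hV : IsAdmissible V) (hsm : Small V) {μ : ℝ}
    (hu : IsH1 u g) (hs : IsWeakSolution V μ u g 0) : u =ᵐ[volume] 0 := by
  obtain ⟨b, hb, hsm⟩ := hsm
  have w1 := hu.weightedMass_le (fun ψ => (hsm ψ).1)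
  have w2 := hu.weightedMass_le (fun ψ => (hsm ψ).2)
  -- With `Vu` regarded as a source, the potential terms become minus the symmetric dilation
  -- difference of `u` against `h`.
  set h : E d → ℂ := fun x => (V x : ℂ) * u x with hh
  have hVm : AEStronglyMeasurable (fun x => (V x : ℂ)) volume :=
    Complex.continuous_ofReal.comp_aestronglyMeasurable hV.locallyIntegrable.aestronglyMeasurable
  have hhm : AEStronglyMeasurable h volume := hVm.mul hu.memLp.1
  have hin : ∀ φ : E d → ℂ, (fun x => inner ℂ (φ x) (h x))
      = fun x => (V x : ℂ) * (conj (φ x) * u x) := by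
    intro φ
    ext x
    simp only [hh, RCLike.inner_apply]
    ring
  have hVe : ∀ x, ‖(V x : ℂ)‖ₑ = ‖V x‖ₑ := fun x => by
    rw [← ofReal_norm, ← ofReal_norm, Complex.norm_real]
  set n := (eLpNorm g 2 volume).toReal with hn
  have hn0 : 0 ≤ n := ENNReal.toReal_nonneg
  have hxle : eLpNorm (fun x => ‖x‖ • h x) 2 volume ≤ b * eLpNorm g 2 volume := by
    refine (ENNReal.pow_le_pow_left_iff (n := 2) (by norm_num)).1 ?_
    rw [eLpNorm_two_sq, mul_pow]
    refine le_trans (le_of_eq (lintegral_congr fun x => ?_)) w2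
    rw [hh, enorm_smul, enorm_mul, enorm_norm, hVe]
    ring
  have hxt : (b : ℝ≥0∞) * eLpNorm g 2 volume ≠ ⊤ :=
    ENNReal.mul_ne_top (by simp) hu.memLp_grad.2.ne
  have hX : (eLpNorm (fun x => ‖x‖ • h x) 2 volume).toReal ≤ b * n := by
    refine (ENNReal.toReal_mono hxt hxle).trans (le_of_eq ?_)
    rw [ENNReal.toReal_mul, ENNReal.coe_toReal]
  have hY : |(∫ x, inner ℂ (u x) (h x)).re| ≤ b * n ^ 2 := by
    refine (abs_re_integral_inner_le (M := b * eLpNorm g 2 volume ^ 2)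
      (ENNReal.mul_ne_top (by simp) (ENNReal.pow_ne_top hu.memLp_grad.2.ne)) ?_).trans
      (le_of_eq ?_)
    · refine le_trans (le_of_eq (lintegral_congr fun x => ?_)) w1
      rw [hh, enorm_mul, hVe]
      ring
    · rw [ENNReal.toReal_mul, ENNReal.toReal_pow, ENNReal.coe_toReal]
  -- The weighted bound gives the part `2b` and the unweighted one the part `d b`. Together they are
  -- less than `2` exactly when `b < 2 / (d + 2)`.
  have hfin : 2 * n ^ 2 ≤ 2 * (n * (b * n)) + d * (b * n ^ 2) := by
    refine two_mul_sq_le_of_virial hu ?_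
    filter_upwards [self_mem_nhdsWithin] with r hr
    have hr1 : 1 ≤ r := le_of_lt hr
    have hr10 : 0 ≤ r - 1 := sub_nonneg.2 hr1
    rw [hs.virial hu (by linarith)]
    have hb1 := abs_dilation_difference_le hu hhm (fun φ γ hφ => by
      rw [hin]
      exact hV.integrable_of_isH1 hφ hu) (ne_top_of_le_ne_top hxt hxle) hr1
    simp only [Pi.zero_apply, inner_zero_right, integral_zero, Complex.zero_re, mul_zero]
    rw [hin, hin] at hb1
    have hb2 := neg_le_of_abs_le hb1
    have hb3 : (r - 1) * (2 * (n * (eLpNorm (fun x => ‖x‖ • h x) 2 volume).toReal)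
        + d * |(∫ x, inner ℂ (u x) (h x)).re|)
        ≤ (r - 1) * (2 * (n * (b * n)) + d * (b * n ^ 2)) := by gcongr
    linarith
  have hbd : (b : ℝ) * (d + 2) < 2 := by
    have h1 : (b : ℝ) < 2 / (d + 2) := by exact_mod_cast hb
    rwa [lt_div_iff₀ (by positivity)] at h1
  have hn2 : n ^ 2 = 0 := by
    by_contra hne
    have hpos : 0 < n ^ 2 := lt_of_le_of_ne (by positivity) (Ne.symm hne)
    nlinarith
  have hg : eLpNorm g 2 volume = 0 := by
    rcases (ENNReal.toReal_eq_zero_iff _).1 (pow_eq_zero_iff (two_ne_zero) |>.1 hn2) with h | h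
    · exact h
    · exact absurd h hu.memLp_grad.2.ne
  exact hu.weak.eq_zero_of_grad_eq_zero hd hu.meas hu.memLp
    ((eLpNorm_eq_zero_iff hu.memLp_grad.1 (by norm_num)).1 hg)

end Virial

/-! ### Continuity of dilations in a locally form-bounded weight. -/

section PotentialTerm

variable {d : ℕ} {u : E d → ℂ} {g : E d → EuclideanSpace ℂ (Fin d)}

/-- `W` is form-bounded with constant `C` on Sobolev functions supported in the ball of
radius `ρ`. -/
def IsLocallyFormBounded (W : E d → ℝ) (ρ : ℝ) (C : ℝ≥0∞) : Prop :=
  ∀ v h, IsH1 v h → (∀ x, v x ≠ 0 → ‖x‖ ≤ ρ) →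
    ∫⁻ x, ‖W x‖ₑ * ‖v x‖ₑ ^ 2 ≤ C * eLpNorm h 2 volume ^ 2

theorem support_comp_smul {ρ : ℝ} (hs : ∀ x, u x ≠ 0 → ‖x‖ ≤ ρ) {σ : ℝ} (hσ : 1 / 2 < σ) (x : E d)
    (hx : u (σ • x) ≠ 0) : ‖x‖ ≤ 2 * ρ := by
  have := hs _ hx
  rw [norm_smul, Real.norm_of_nonneg (by linarith)] at this
  nlinarith [norm_nonneg x]

theorem eventually_half_lt : ∀ᶠ σ : ℝ in 𝓝 1, 1 / 2 < σ := lt_mem_nhds (by norm_num)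

/-- Dilations are continuous for the gradient norm, hence by a form bound for weighted norms too.
The difference is split as `σ (g(σ·) - g) + (σ - 1) g`. -/
theorem IsH1.tendsto_grad_comp_smul_sub (hu : IsH1 u g) :
    Tendsto (fun σ : ℝ => eLpNorm (fun x => (σ : ℂ) • g (σ • x) - g x) 2 volume) (𝓝 1) (𝓝 0) := by
  have h1 := tendsto_eLpNorm_comp_smul_sub hu.memLp_grad
  have h2 : Tendsto (fun σ : ℝ => ‖σ‖ₑ * eLpNorm (fun x => g (σ • x) - g x) 2 volume
      + ‖σ - 1‖ₑ * eLpNorm g 2 volume) (𝓝 1) (𝓝 0) := by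
    have e1 : Tendsto (fun σ : ℝ => ‖σ‖ₑ) (𝓝 1) (𝓝 ‖(1 : ℝ)‖ₑ) := continuous_enorm.tendsto 1
    have e2 : Tendsto (fun σ : ℝ => ‖σ - 1‖ₑ) (𝓝 1) (𝓝 0) := by
      have : Continuous fun σ : ℝ => ‖σ - 1‖ₑ := continuous_enorm.comp (by fun_prop)
      simpa using this.tendsto 1
    have e3 := ENNReal.Tendsto.mul e1 (Or.inr (by simp)) h1 (Or.inr (by simp))
    have e4 := ENNReal.Tendsto.mul_const (b := eLpNorm g 2 volume) e2 (Or.inr hu.memLp_grad.2.ne)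
    simpa using e3.add e4
  refine tendsto_of_tendsto_of_tendsto_of_le_of_le' tendsto_const_nhds h2
    (Eventually.of_forall fun _ => zero_le) ?_
  filter_upwards [eventually_half_lt] with σ hσ
  have hσ0 : 0 < σ := by linarith
  have m := memLp_comp_smul hu.meas_grad hu.memLp_grad hσ0
  have e : (fun x => (σ : ℂ) • g (σ • x) - g x)
      = (σ • fun x => g (σ • x) - g x) + ((σ - 1) • g) := by
    ext x i
    simp
    ring
  rw [e]
  refine (eLpNorm_add_le ((m.sub hu.memLp_grad).1.const_smul σ)
    (hu.memLp_grad.1.const_smul (σ - 1)) (by norm_num)).trans (le_of_eq ?_)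
  rw [eLpNorm_const_smul, eLpNorm_const_smul]
  rfl

theorem enorm_sqrt_abs_sq (a : ℝ) : ‖Real.sqrt |a|‖ₑ ^ 2 = ‖a‖ₑ := by
  rw [← enorm_pow, Real.sq_sqrt (abs_nonneg a), Real.enorm_abs]

/-- Writing `|W|` as the square of `√|W|` turns a form bound into an `L²` bound, so the triangle and
Cauchy-Schwarz inequalities become available. -/
theorem eLpNorm_sqrt_smul_sq (W : E d → ℝ) (v : E d → ℂ) :
    eLpNorm (fun x => Real.sqrt |W x| • v x) 2 volume ^ 2 = ∫⁻ x, ‖W x‖ₑ * ‖v x‖ₑ ^ 2 := by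
  rw [eLpNorm_two_sq]
  refine lintegral_congr fun x => ?_
  rw [enorm_smul, mul_pow, enorm_sqrt_abs_sq]

/-- The size of the constant is immaterial; `C ≤ (C + 1)²` avoids a square root of `C`. -/
theorem IsLocallyFormBounded.eLpNorm_le {W : E d → ℝ} {ρ : ℝ} {C : ℝ≥0∞}
    (hW : IsLocallyFormBounded W ρ C) (hu : IsH1 u g) (hs : ∀ x, u x ≠ 0 → ‖x‖ ≤ ρ) :
    eLpNorm (fun x => Real.sqrt |W x| • u x) 2 volume ≤ (C + 1) * eLpNorm g 2 volume := by
  refine (ENNReal.pow_le_pow_left_iff (n := 2) (by norm_num)).1 ?_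
  rw [eLpNorm_sqrt_smul_sq, mul_pow]
  refine (hW u g hu hs).trans ?_
  gcongr
  calc C ≤ (C + 1) * 1 := by simp
    _ ≤ (C + 1) * (C + 1) := by gcongr; exact le_add_self
    _ = (C + 1) ^ 2 := (sq _).symm

theorem lintegral_weight_mul_le {W : E d → ℝ} (hWm : StronglyMeasurable W) {a b : E d → ℂ}
    (ha : AEStronglyMeasurable a volume) (hb : AEStronglyMeasurable b volume) :
    ∫⁻ x, ‖W x‖ₑ * (‖a x‖ₑ * ‖b x‖ₑ) ≤ eLpNorm (fun x => Real.sqrt |W x| • a x) 2 volume *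
      eLpNorm (fun x => Real.sqrt |W x| • b x) 2 volume := by
  have hw : AEStronglyMeasurable (fun x => Real.sqrt |W x|) volume :=
    (Real.continuous_sqrt.comp continuous_abs).comp_aestronglyMeasurable hWm.aestronglyMeasurable
  refine le_trans (le_of_eq (lintegral_congr fun x => ?_))
    (lintegral_enorm_mul_le (hw.smul ha) (hw.smul hb))
  rw [enorm_smul, enorm_smul, ← enorm_sqrt_abs_sq (W x)]
  ring

theorem enorm_weight_mul (w : ℝ) (a b : ℂ) :
    ‖(w : ℂ) * (conj a * b)‖ₑ = ‖w‖ₑ * (‖a‖ₑ * ‖b‖ₑ) := by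
  rw [enorm_mul, enorm_mul, RCLike.enorm_conj, ← ofReal_norm (w : ℂ), Complex.norm_real, ofReal_norm]

theorem IsLocallyFormBounded.integrable {W : E d → ℝ} (hWm : StronglyMeasurable W) {ρ : ℝ}
    {C : ℝ≥0∞} (hC : C ≠ ⊤) (hW : IsLocallyFormBounded W ρ C) {v : E d → ℂ}
    {h : E d → EuclideanSpace ℂ (Fin d)} (hu : IsH1 u g) (hus : ∀ x, u x ≠ 0 → ‖x‖ ≤ ρ)
    (hv : IsH1 v h) (hvs : ∀ x, v x ≠ 0 → ‖x‖ ≤ ρ) :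
    Integrable (fun x => (W x : ℂ) * (conj (u x) * v x)) volume := by
  have hC1 : C + 1 ≠ ⊤ := by simpa using hC
  refine ⟨((Complex.continuous_ofReal.comp_stronglyMeasurable hWm).mul
    ((Complex.continuous_conj.comp_stronglyMeasurable hu.meas).mul hv.meas)).aestronglyMeasurable,
    ?_⟩
  unfold HasFiniteIntegral
  simp only [enorm_weight_mul]
  calc _ ≤ _ := lintegral_weight_mul_le hWm hu.memLp.1 hv.memLp.1
    _ ≤ ((C + 1) * eLpNorm g 2 volume) * ((C + 1) * eLpNorm h 2 volume) := by
        gcongr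
        · exact hW.eLpNorm_le hu hus
        · exact hW.eLpNorm_le hv hvs
    _ < ⊤ := ENNReal.mul_lt_top (ENNReal.mul_lt_top hC1.lt_top hu.memLp_grad.2)
        (ENNReal.mul_lt_top hC1.lt_top hv.memLp_grad.2)

/-- Continuity of the weighted correlation of dilations. -/
theorem tendsto_weighted_correlation {W : E d → ℝ} (hWm : StronglyMeasurable W) {ρ : ℝ}
    (hρ : 0 ≤ ρ) {C : ℝ≥0∞} (hC : C ≠ ⊤) (hW : IsLocallyFormBounded W (2 * ρ) C) (hu : IsH1 u g)
    (hs : ∀ x, u x ≠ 0 → ‖x‖ ≤ ρ) :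
    Tendsto (fun p : ℝ × ℝ => ∫ x, (W x : ℂ) * (conj (u (p.1 • x)) * u (p.2 • x))) (𝓝 (1, 1))
      (𝓝 (∫ x, (W x : ℂ) * (conj (u x) * u x))) := by
  have hC1 : C + 1 ≠ ⊤ := by simpa using hC
  have hs2 : ∀ x, u x ≠ 0 → ‖x‖ ≤ 2 * ρ := fun x hx => (hs x hx).trans (by linarith)
  set n : ℝ → ℝ≥0∞ :=
    fun σ => eLpNorm (fun x => Real.sqrt |W x| • (u (σ • x) - u x)) 2 volume with hn
  set c := eLpNorm (fun x => Real.sqrt |W x| • u x) 2 volume with hc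
  have hct : c ≠ ⊤ := ne_top_of_le_ne_top (ENNReal.mul_ne_top hC1 hu.memLp_grad.2.ne)
    (hW.eLpNorm_le hu hs2)
  -- The form bound is applied to `u(σ·) - u`, which for `σ > 1/2` is supported in the ball of
  -- radius `2ρ`. This is why the bound is assumed on the doubled ball.
  have hnt : Tendsto n (𝓝 1) (𝓝 0) := by
    have h1 : Tendsto (fun σ : ℝ => (C + 1) *
        eLpNorm (fun x => (σ : ℂ) • g (σ • x) - g x) 2 volume) (𝓝 1) (𝓝 0) := by
      simpa using ENNReal.Tendsto.const_mul hu.tendsto_grad_comp_smul_sub (Or.inr hC1)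
    refine tendsto_of_tendsto_of_tendsto_of_le_of_le' tendsto_const_nhds h1
      (Eventually.of_forall fun _ => zero_le) ?_
    filter_upwards [eventually_half_lt] with σ hσ
    refine hW.eLpNorm_le ((hu.comp_smul (by linarith)).sub hu) fun x hx => ?_
    by_contra hne
    refine hx ?_
    have h2 : u x = 0 := by
      by_contra h
      exact hne (hs2 x h)
    have h3 : u (σ • x) = 0 := by
      by_contra h
      exact hne (support_comp_smul hs hσ x h)
    rw [h2, h3, sub_zero]
  have t1 : Tendsto (fun p : ℝ × ℝ => n p.1) (𝓝 (1, 1)) (𝓝 0) :=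
    hnt.comp (continuous_fst.tendsto (1, 1))
  have t2 : Tendsto (fun p : ℝ × ℝ => n p.2) (𝓝 (1, 1)) (𝓝 0) :=
    hnt.comp (continuous_snd.tendsto (1, 1))
  have ev : ∀ᶠ p : ℝ × ℝ in 𝓝 (1, 1), 1 / 2 < p.1 ∧ 1 / 2 < p.2 :=
    ((continuous_fst.tendsto (1, 1)).eventually eventually_half_lt).and
      ((continuous_snd.tendsto (1, 1)).eventually eventually_half_lt)
  refine tendsto_integral_of_L1 _ (hW.integrable hWm hC hu hs2 hu hs2).1
    (ev.mono fun p hp => hW.integrable hWm hC (hu.comp_smul (by linarith [hp.1]))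
      (support_comp_smul hs hp.1) (hu.comp_smul (by linarith [hp.2]))
      (support_comp_smul hs hp.2)) ?_
  have t3 : Tendsto (fun p : ℝ × ℝ => n p.1 * n p.2 + (n p.1 * c + c * n p.2)) (𝓝 (1, 1))
      (𝓝 0) := by
    have a1 := ENNReal.Tendsto.mul t1 (Or.inr (by simp)) t2 (Or.inr (by simp))
    have a2 := ENNReal.Tendsto.mul_const t1 (Or.inr hct)
    have a3 := ENNReal.Tendsto.const_mul t2 (Or.inr hct)
    simpa using a1.add (a2.add a3)
  refine tendsto_of_tendsto_of_tendsto_of_le_of_le' tendsto_const_nhds t3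
    (Eventually.of_forall fun _ => zero_le) ?_
  filter_upwards [ev] with p hp
  have m1 : StronglyMeasurable fun x => u (p.1 • x) - u x :=
    (hu.meas.comp_measurable (measurable_smul_left p.1)).sub hu.meas
  have m2 : StronglyMeasurable fun x => u (p.2 • x) - u x :=
    (hu.meas.comp_measurable (measurable_smul_left p.2)).sub hu.meas
  calc _ ≤ ∫⁻ x, (‖W x‖ₑ * (‖u (p.1 • x) - u x‖ₑ * ‖u (p.2 • x) - u x‖ₑ)
        + (‖W x‖ₑ * (‖u (p.1 • x) - u x‖ₑ * ‖u x‖ₑ)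
          + ‖W x‖ₑ * (‖u x‖ₑ * ‖u (p.2 • x) - u x‖ₑ))) := by
        refine lintegral_mono fun x => ?_
        simp only [← enorm_weight_mul]
        -- The product is expanded around `u`, so that every term contains a difference which is
        -- small in the weighted norm.
        have e : (W x : ℂ) * (conj (u (p.1 • x)) * u (p.2 • x)) - (W x : ℂ) * (conj (u x) * u x)
            = (W x : ℂ) * (conj (u (p.1 • x) - u x) * (u (p.2 • x) - u x))
              + ((W x : ℂ) * (conj (u (p.1 • x) - u x) * u x)
                + (W x : ℂ) * (conj (u x) * (u (p.2 • x) - u x))) := by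
          rw [map_sub]
          ring
        rw [e]
        refine (enorm_add_le _ _).trans ?_
        gcongr
        exact enorm_add_le _ _
    _ = (∫⁻ x, ‖W x‖ₑ * (‖u (p.1 • x) - u x‖ₑ * ‖u (p.2 • x) - u x‖ₑ))
        + ((∫⁻ x, ‖W x‖ₑ * (‖u (p.1 • x) - u x‖ₑ * ‖u x‖ₑ))
          + ∫⁻ x, ‖W x‖ₑ * (‖u x‖ₑ * ‖u (p.2 • x) - u x‖ₑ)) := by
        have k1 : Measurable fun x =>
            ‖W x‖ₑ * (‖u (p.1 • x) - u x‖ₑ * ‖u (p.2 • x) - u x‖ₑ) :=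
          hWm.enorm.mul (m1.enorm.mul m2.enorm)
        have k2 : Measurable fun x => ‖W x‖ₑ * (‖u (p.1 • x) - u x‖ₑ * ‖u x‖ₑ) :=
          hWm.enorm.mul (m1.enorm.mul hu.meas.enorm)
        rw [lintegral_add_left k1, lintegral_add_left k2]
    _ ≤ _ := by
        gcongr
        · exact lintegral_weight_mul_le hWm m1.aestronglyMeasurable m2.aestronglyMeasurable
        · exact lintegral_weight_mul_le hWm m1.aestronglyMeasurable hu.memLp.1
        · exact lintegral_weight_mul_le hWm hu.memLp.1 m2.aestronglyMeasurable

end PotentialTerm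

/-! ### The potential term of the virial identity under the gradient hypothesis. -/

section PotentialVirial

variable {d : ℕ} {u : E d → ℂ} {g : E d → EuclideanSpace ℂ (Fin d)} {V : E d → ℝ}
  {G : E d → E d}

/-- A measurable representative of `V` has to agree with `V` at both `x` and `r x`; the second holds
almost everywhere because dilation preserves null sets. -/
theorem HasWeakGradient.ray_ae (hV : HasWeakGradient V G) (hGm : StronglyMeasurable G) {r : ℝ}
    (hr : 1 ≤ r) : ∀ᵐ x, V (r • x) - V x = ∫ s in Set.Ioc 1 r, pairing x (G (s • x)) := by
  have hm := hV.1.aestronglyMeasurable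
  have hq : Measure.QuasiMeasurePreserving (fun x : E d => r • x) volume volume :=
    ⟨measurable_smul_left r, by
      rw [Measure.map_addHaar_smul volume (by linarith)]
      exact Measure.smul_absolutelyContinuous⟩
  filter_upwards [(hV.congr hm.ae_eq_mk (EventuallyEq.refl _ G)).ray hm.stronglyMeasurable_mk hGm hr,
    hm.ae_eq_mk, hq.ae_eq_comp hm.ae_eq_mk] with x h1 h2 h3
  simp only [Function.comp_apply] at h3
  rw [h2, h3, h1]

/-- Supplies the bound, uniform in the dilation factor, that justifies Fubini in
`integrable_ray_mul`. -/
theorem IsH1.eventually_grad_comp_smul_le (hu : IsH1 u g) :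
    ∀ᶠ σ : ℝ in 𝓝 1, eLpNorm (fun x => (σ : ℂ) • g (σ • x)) 2 volume ≤ 1 + eLpNorm g 2 volume := by
  filter_upwards [ENNReal.tendsto_nhds_zero.1 hu.tendsto_grad_comp_smul_sub 1 one_pos,
    eventually_half_lt] with σ h1 hσ
  have hσ0 : 0 < σ := by linarith
  have e : (fun x => (σ : ℂ) • g (σ • x)) = (fun x => (σ : ℂ) • g (σ • x) - g x) + g := by
    ext x i
    simp
  rw [e]
  refine (eLpNorm_add_le ((hu.comp_smul hσ0).memLp_grad.sub hu.memLp_grad).1 hu.memLp_grad.1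
    (by norm_num)).trans ?_
  gcongr
  exact h1

/-- In the variable `y = s x` the weight is the fixed function `y · G(y)`, and the dilations, by
`s⁻¹` and `r s⁻¹`, act on `u` alone. No continuity of `G` along rays is then needed. -/
theorem pairing_eq_weight {s : ℝ} (hs : 0 < s) (r : ℝ) (x : E d) :
    ((pairing x (G (s • x)) : ℝ) : ℂ) * (conj (u x) * u (r • x))
      = ((s⁻¹ : ℝ) : ℂ) * (((inner ℝ (s • x) (G (s • x)) : ℝ) : ℂ) *
        (conj (u (s⁻¹ • s • x)) * u ((r * s⁻¹) • s • x))) := by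
  have h1 : pairing x (G (s • x)) = s⁻¹ * inner ℝ (s • x) (G (s • x)) := by
    rw [pairing_eq_inner, real_inner_smul_left, inv_mul_cancel_left₀ hs.ne']
  have h2 : (r * s⁻¹) • s • x = r • x := by
    rw [mul_smul, inv_smul_smul₀ hs.ne']
  rw [h1, h2, inv_smul_smul₀ hs.ne']
  push_cast
  ring

/-- Fubini for the potential term of the virial identity. -/
theorem integrable_ray_mul (hGm : StronglyMeasurable G) (hu : IsH1 u g) {C K : ℝ≥0∞} {ρ : ℝ}
    (hC : C ≠ ⊤) (hK : K ≠ ⊤)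
    (hW : IsLocallyFormBounded (fun x => inner ℝ x (G x)) (2 * ρ) C)
    (hs : ∀ x, u x ≠ 0 → ‖x‖ ≤ ρ) {r : ℝ}
    (hb : ∀ s ∈ Set.Ioc 1 r, 1 / 2 < s⁻¹ ∧ 1 / 2 < r * s⁻¹ ∧
      eLpNorm (fun x => ((s⁻¹ : ℝ) : ℂ) • g (s⁻¹ • x)) 2 volume ≤ K ∧
      eLpNorm (fun x => ((r * s⁻¹ : ℝ) : ℂ) • g ((r * s⁻¹) • x)) 2 volume ≤ K) :
    Integrable (fun p : ℝ × E d =>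
      ((pairing p.2 (G (p.1 • p.2)) : ℝ) : ℂ) * (conj (u p.2) * u (r • p.2)))
      ((volume.restrict (Set.Ioc 1 r)).prod volume) := by
  have hm : StronglyMeasurable fun p : ℝ × E d =>
      ((pairing p.2 (G (p.1 • p.2)) : ℝ) : ℂ) * (conj (u p.2) * u (r • p.2)) := by
    refine (Complex.continuous_ofReal.comp_stronglyMeasurable (stronglyMeasurable_ray hGm)).mul
      (StronglyMeasurable.mul ?_ ?_)
    · exact Complex.continuous_conj.comp_stronglyMeasurable (hu.meas.comp_measurable measurable_snd)
    · exact hu.meas.comp_measurable (measurable_snd.const_smul r)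
  have hWm : StronglyMeasurable fun x : E d => (inner ℝ x (G x) : ℝ) :=
    stronglyMeasurable_id.inner hGm
  have hC1 : C + 1 ≠ ⊤ := by simpa using hC
  refine ⟨hm.aestronglyMeasurable, ?_⟩
  unfold HasFiniteIntegral
  rw [lintegral_prod _ hm.enorm.aemeasurable]
  calc _ ≤ ∫⁻ _ in Set.Ioc 1 r, ((C + 1) * K) * ((C + 1) * K) := by
        refine setLIntegral_mono measurable_const fun s hsr => ?_
        obtain ⟨b1, b2, b3, b4⟩ := hb s hsr
        have hs0 : 0 < s := by linarith [hsr.1]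
        have q1 := hu.comp_smul (r := s⁻¹) (by linarith)
        have q2 := hu.comp_smul (r := r * s⁻¹) (by linarith)
        set F : E d → ℂ := fun y => ((inner ℝ y (G y) : ℝ) : ℂ) *
          (conj (u (s⁻¹ • y)) * u ((r * s⁻¹) • y)) with hF
        calc _ ≤ ∫⁻ x, ‖F (s • x)‖ₑ := by
              refine lintegral_mono fun x => ?_
              simp only
              rw [pairing_eq_weight hs0, enorm_mul]
              have hle : ‖((s⁻¹ : ℝ) : ℂ)‖ₑ ≤ 1 := by
                rw [← ofReal_norm, Complex.norm_real, Real.norm_of_nonneg (inv_nonneg.2 hs0.le)]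
                exact ENNReal.ofReal_le_one.2 (inv_le_one_of_one_le₀ hsr.1.le)
              exact mul_le_of_le_one_left zero_le hle
          _ = ENNReal.ofReal ((s ^ d)⁻¹) * ∫⁻ x, ‖F x‖ₑ :=
              lintegral_comp_smul (fun x => ‖F x‖ₑ) hs0
          _ ≤ 1 * ∫⁻ x, ‖F x‖ₑ := by
              gcongr
              rw [← ENNReal.ofReal_one]
              exact ENNReal.ofReal_le_ofReal
                (inv_le_one_of_one_le₀ (one_le_pow₀ hsr.1.le))
          _ = ∫⁻ x, ‖(inner ℝ x (G x) : ℝ)‖ₑ * (‖u (s⁻¹ • x)‖ₑ * ‖u ((r * s⁻¹) • x)‖ₑ) := by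
              rw [one_mul]
              exact lintegral_congr fun x => enorm_weight_mul _ _ _
          _ ≤ _ := lintegral_weight_mul_le hWm q1.memLp.1 q2.memLp.1
          _ ≤ _ := by
              gcongr
              · exact (hW.eLpNorm_le q1 (support_comp_smul hs b1)).trans (by gcongr)
              · exact (hW.eLpNorm_le q2 (support_comp_smul hs b2)).trans (by gcongr)
    _ < ⊤ := by
        rw [lintegral_const]
        have := ENNReal.mul_lt_top hC1.lt_top hK.lt_top
        exact ENNReal.mul_lt_top (ENNReal.mul_lt_top this this) (by simp)

/-- The potential term of the virial identity as an average over rays. -/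
theorem potential_term_eq (hV : IsAdmissible V) (hG : HasWeakGradient V G)
    (hGm : StronglyMeasurable G) (hu : IsH1 u g) {r : ℝ} (hr : 1 ≤ r)
    (hint : Integrable (fun p : ℝ × E d =>
      ((pairing p.2 (G (p.1 • p.2)) : ℝ) : ℂ) * (conj (u p.2) * u (r • p.2)))
      ((volume.restrict (Set.Ioc 1 r)).prod volume)) :
    (r ^ d)⁻¹ * (∫ x, (V x : ℂ) * (conj (u (r⁻¹ • x)) * u x)).re
        - (∫ x, (V x : ℂ) * (conj (u (r • x)) * u x)).re
      = ∫ s in Set.Ioc 1 r,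
          (∫ x, ((pairing x (G (s • x)) : ℝ) : ℂ) * (conj (u x) * u (r • x))).re := by
  have hr0 : 0 < r := by linarith
  have hri : 0 < r⁻¹ := inv_pos.2 hr0
  have i1 := (hV.integrable_of_isH1 (hu.comp_smul hri) hu).comp_smul hr0.ne'
  have i2 := hV.integrable_of_isH1 hu (hu.comp_smul hr0)
  -- Replacing `x` by `r x` here, and conjugating the second term, gives both integrals the same
  -- factor `conj (u x) * u (r x)`. The difference then carries `V(r x) - V(x)`.
  have c1 := integral_comp_smul (fun x => (V x : ℂ) * (conj (u (r⁻¹ • x)) * u x)) hr0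
  simp only [inv_smul_smul₀ hr0.ne'] at c1 i1
  have c2 : ∫ x, (V x : ℂ) * (conj (u (r • x)) * u x)
      = conj (∫ x, (V x : ℂ) * (conj (u x) * u (r • x))) := by
    rw [← integral_conj]
    refine integral_congr_ae (Eventually.of_forall fun x => ?_)
    simp only [map_mul, Complex.conj_ofReal, Complex.conj_conj]
    ring
  have c3 := congrArg Complex.re c1
  rw [Complex.smul_re, smul_eq_mul] at c3
  rw [← c3, c2, Complex.conj_re, ← Complex.sub_re, ← integral_sub i1 i2]
  have hri : ∫ s in Set.Ioc 1 r,
      (∫ x, ((pairing x (G (s • x)) : ℝ) : ℂ) * (conj (u x) * u (r • x))).re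
      = (∫ s in Set.Ioc 1 r,
        ∫ x, ((pairing x (G (s • x)) : ℝ) : ℂ) * (conj (u x) * u (r • x))).re :=
    integral_re hint.integral_prod_left
  rw [hri, integral_integral_swap hint]
  congr 1
  refine integral_congr_ae ((hG.ray_ae hGm hr).mono fun x hx => ?_)
  simp only
  rw [integral_mul_const, integral_complex_ofReal, ← hx]
  push_cast
  ring

/-- Asymptotic upper bound for the potential term of the virial identity. -/
theorem eventually_potential_term_le (hV : IsAdmissible V) (hG : HasWeakGradient V G)
    (hGm : StronglyMeasurable G) (hu : IsH1 u g) {C : ℝ≥0∞} {ρ : ℝ} (hρ : 0 ≤ ρ) (hC : C ≠ ⊤)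
    (hW : IsLocallyFormBounded (fun x => inner ℝ x (G x)) (2 * ρ) C)
    (hs : ∀ x, u x ≠ 0 → ‖x‖ ≤ ρ) {M : ℝ} (hM0 : 0 < M)
    (hM : (∫ x, ((inner ℝ x (G x) : ℝ) : ℂ) * (conj (u x) * u x)).re < M) :
    ∀ᶠ r in 𝓝[>] (1 : ℝ), (r ^ d)⁻¹ * (∫ x, (V x : ℂ) * (conj (u (r⁻¹ • x)) * u x)).re
        - (∫ x, (V x : ℂ) * (conj (u (r • x)) * u x)).re ≤ (r - 1) * M := by
  have hWm : StronglyMeasurable fun x : E d => (inner ℝ x (G x) : ℝ) :=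
    stronglyMeasurable_id.inner hGm
  have hσ := eventually_half_lt.and hu.eventually_grad_comp_smul_le
  have hcor := (Complex.continuous_re.tendsto _).comp
    (tendsto_weighted_correlation hWm hρ hC hW hu hs)
  have hev := (hcor.eventually (gt_mem_nhds hM)).and
    (((continuous_fst.tendsto ((1 : ℝ), (1 : ℝ))).eventually hσ).and
      ((continuous_snd.tendsto ((1 : ℝ), (1 : ℝ))).eventually hσ))
  obtain ⟨δ, hδ, hball⟩ := Metric.eventually_nhds_iff.1 hev
  filter_upwards [self_mem_nhdsWithin, nhdsWithin_le_nhds (gt_mem_nhds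
    (show (1 : ℝ) < 1 + δ by linarith))] with r hr hrδ
  have hr1 : 1 < r := hr
  -- For `s` in `(1, r]` both dilation factors are within `r - 1 < δ` of one.
  have hnear : ∀ s ∈ Set.Ioc 1 r, dist ((s⁻¹, r * s⁻¹) : ℝ × ℝ) (1, 1) < δ := by
    intro s hsr
    have hs0 : 0 < s := by linarith [hsr.1]
    have h1 : s⁻¹ ≤ 1 := inv_le_one_of_one_le₀ hsr.1.le
    have h2 : s * s⁻¹ = 1 := mul_inv_cancel₀ hs0.ne'
    have h3 : 0 < s⁻¹ := inv_pos.2 hs0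
    rw [Prod.dist_eq, max_lt_iff, Real.dist_eq, Real.dist_eq, abs_lt, abs_lt]
    refine ⟨⟨?_, ?_⟩, ?_, ?_⟩
    · nlinarith [hsr.1, hsr.2]
    · linarith
    · nlinarith [hsr.1, hsr.2]
    · nlinarith [hsr.1, hsr.2]
  have hint := integrable_ray_mul (r := r) hGm hu hC (K := 1 + eLpNorm g 2 volume)
    (by simpa using hu.memLp_grad.2.ne) hW hs fun s hsr => by
      obtain ⟨-, ⟨a1, a2⟩, a3, a4⟩ := hball (hnear s hsr)
      exact ⟨a1, a3, a2, a4⟩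
  rw [potential_term_eq hV hG hGm hu hr1.le hint]
  have hle : ∀ s ∈ Set.Ioc 1 r,
      (∫ x, ((pairing x (G (s • x)) : ℝ) : ℂ) * (conj (u x) * u (r • x))).re ≤ M := by
    intro s hsr
    have hs0 : 0 < s := by linarith [hsr.1]
    have h1 := (hball (hnear s hsr)).1
    simp only [Function.comp_apply] at h1
    have c := integral_comp_smul (fun y => ((inner ℝ y (G y) : ℝ) : ℂ) *
      (conj (u (s⁻¹ • y)) * u ((r * s⁻¹) • y))) hs0
    simp only [pairing_eq_weight hs0]
    rw [integral_const_mul, c, Complex.re_ofReal_mul, Complex.smul_re, smul_eq_mul, ← mul_assoc]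
    set t := (∫ y, ((inner ℝ y (G y) : ℝ) : ℂ) *
      (conj (u (s⁻¹ • y)) * u ((r * s⁻¹) • y))).re
    -- The prefactor can be dropped because `M` is positive; `t` itself may have either sign.
    have k1 : s⁻¹ * (s ^ d)⁻¹ ≤ 1 :=
      mul_le_one₀ (inv_le_one_of_one_le₀ hsr.1.le) (by positivity)
        (inv_le_one_of_one_le₀ (one_le_pow₀ hsr.1.le))
    have k2 : 0 ≤ s⁻¹ * (s ^ d)⁻¹ := by positivity
    calc s⁻¹ * (s ^ d)⁻¹ * t ≤ s⁻¹ * (s ^ d)⁻¹ * M := by gcongr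
      _ ≤ 1 * M := by gcongr
      _ = M := one_mul M
  calc _ ≤ ∫ _ in Set.Ioc 1 r, M := by
        refine setIntegral_mono_on ?_ (by simp) measurableSet_Ioc hle
        exact hint.integral_prod_left.re
    _ = (r - 1) * M := by
        rw [setIntegral_const, Real.volume_real_Ioc_of_le hr1.le, smul_eq_mul]

end PotentialVirial

/-! ### Cutoff of weak solutions. -/

section Cutoff

variable {d : ℕ} {u : E d → ℂ} {g : E d → EuclideanSpace ℂ (Fin d)} {V : E d → ℝ}

/-- The `i`-th partial derivative. -/
def partialDeriv (i : Fin d) (χ : E d → ℝ) (x : E d) : ℝ :=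
  fderiv ℝ χ x (EuclideanSpace.single i 1)

theorem contDiff_partialDeriv {χ : E d → ℝ} (hχ : ContDiff ℝ ∞ χ) (i : Fin d) :
    ContDiff ℝ ∞ (partialDeriv i χ) :=
  (hχ.fderiv_right (m := ∞) (by simp)).clm_apply contDiff_const

theorem hasCompactSupport_partialDeriv {χ : E d → ℝ} (hc : HasCompactSupport χ) (i : Fin d) :
    HasCompactSupport (partialDeriv i χ) :=
  hasCompactSupport_partial hc _

/-- The commutator term `-2 ∇χ · ∇u - (Δχ) u` produced by a cutoff. -/
def cutoffSource (χ : E d → ℝ) (u : E d → ℂ) (g : E d → EuclideanSpace ℂ (Fin d)) (x : E d) : ℂ :=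
  -∑ i, (partialDeriv i χ x • g x i
    + (partialDeriv i χ x • g x i + partialDeriv i (partialDeriv i χ) x • u x))

theorem memLp_coord {w : E d → EuclideanSpace ℂ (Fin d)} (hw : MemLp w 2 volume) (i : Fin d) :
    MemLp (fun x => w x i) 2 volume :=
  (EuclideanSpace.proj i : EuclideanSpace ℂ (Fin d) →L[ℂ] ℂ).comp_memLp' hw

theorem memLp_smul_of_hasCompactSupport {F : Type*} [NormedAddCommGroup F] [NormedSpace ℝ F]
    {χ : E d → ℝ} (hχ : Continuous χ) (hc : HasCompactSupport χ) {v : E d → F}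
    (hv : MemLp v 2 volume) : MemLp (fun x => χ x • v x) 2 volume :=
  hv.smul (r := 2) (hχ.memLp_of_hasCompactSupport (p := ⊤) hc)

theorem memLp_cutoffSource {χ : E d → ℝ} (hχ : ContDiff ℝ ∞ χ) (hc : HasCompactSupport χ)
    (hu : IsH1 u g) : MemLp (cutoffSource χ u g) 2 volume := by
  refine MemLp.neg (memLp_finsetSum _ fun i _ => ?_)
  have h1 := memLp_smul_of_hasCompactSupport (contDiff_partialDeriv hχ i).continuous
    (hasCompactSupport_partialDeriv hc i) (memLp_coord hu.memLp_grad i)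
  have h2 := memLp_smul_of_hasCompactSupport
    (contDiff_partialDeriv (contDiff_partialDeriv hχ i) i).continuous
    (hasCompactSupport_partialDeriv (hasCompactSupport_partialDeriv hc i) i) hu.memLp
  exact h1.add (h1.add h2)

/-- Localization of a weak solution. -/
theorem IsWeakSolution.cutoff {μ : ℝ} (hs : IsWeakSolution V μ u g 0) (hu : IsH1 u g)
    {χ : E d → ℝ} (hχ : ContDiff ℝ ∞ χ) (hc : HasCompactSupport χ) :
    IsWeakSolution V μ (fun x => χ x • u x) (fun x => χ x • g x + u x • complexGradient χ x)
      (cutoffSource χ u g) := by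
  intro φ γ hφ
  have hη := contDiff_partialDeriv hχ
  have hηc := hasCompactSupport_partialDeriv hc
  -- The equation for `u` is tested with `χφ`. The gradient terms of the two equations then share `∫
  -- ⟨χγ, g⟩`, and only terms with derivatives of `χ` remain to be compared.
  have t := hs _ _ (hφ.cutoff hχ hc)
  have mχγ := memLp_smul_of_hasCompactSupport hχ.continuous hc hφ.memLp_grad
  have mηu : ∀ i, MemLp (fun x => partialDeriv i χ x • u x) 2 volume := fun i =>
    memLp_smul_of_hasCompactSupport (hη i).continuous (hηc i) hu.memLp
  have mηg : ∀ i, MemLp (fun x => partialDeriv i χ x • g x i) 2 volume := fun i =>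
    memLp_smul_of_hasCompactSupport (hη i).continuous (hηc i) (memLp_coord hu.memLp_grad i)
  have mηηu : ∀ i, MemLp (fun x => partialDeriv i (partialDeriv i χ) x • u x) 2 volume := fun i =>
    memLp_smul_of_hasCompactSupport (contDiff_partialDeriv (hη i) i).continuous
      (hasCompactSupport_partialDeriv (hηc i) i) hu.memLp
  have iA := integrable_inner mχγ hu.memLp_grad
  have iB : ∀ i, Integrable (fun x => inner ℂ (γ x i) (partialDeriv i χ x • u x)) volume :=
    fun i => integrable_inner (memLp_coord hφ.memLp_grad i) (mηu i)
  have iD : ∀ i, Integrable (fun x => inner ℂ (φ x) (partialDeriv i χ x • g x i)) volume :=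
    fun i => integrable_inner hφ.memLp (mηg i)
  have iE : ∀ i, Integrable (fun x => inner ℂ (φ x) (partialDeriv i χ x • g x i
      + partialDeriv i (partialDeriv i χ) x • u x)) volume :=
    fun i => integrable_inner hφ.memLp ((mηg i).add (mηηu i))
  have iF : ∀ i, Integrable (fun x => inner ℂ (φ x) (partialDeriv i χ x • g x i
      + (partialDeriv i χ x • g x i + partialDeriv i (partialDeriv i χ) x • u x))) volume :=
    fun i => integrable_inner hφ.memLp ((mηg i).add ((mηg i).add (mηηu i)))
  have e1 : ∫ x, inner ℂ (γ x) (χ x • g x + u x • complexGradient χ x)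
      = (∫ x, inner ℂ (χ x • γ x) (g x))
        + ∑ i, ∫ x, inner ℂ (γ x i) (partialDeriv i χ x • u x) := by
    rw [← integral_finsetSum _ fun i _ => iB i, ← integral_add iA (integrable_finsetSum _
      fun i _ => iB i)]
    congr 1
    ext x
    rw [inner_add_right]
    congr 1
    · simp only [PiLp.inner_apply, PiLp.smul_apply, RCLike.inner_apply, Complex.real_smul, map_mul,
        Complex.conj_ofReal]
      exact Finset.sum_congr rfl fun i _ => by ring
    · simp only [PiLp.inner_apply, PiLp.smul_apply, complexGradient, partialDeriv,
        RCLike.inner_apply, smul_eq_mul, Complex.real_smul]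
      exact Finset.sum_congr rfl fun i _ => by ring
  have e2 : ∫ x, inner ℂ (χ x • γ x + φ x • complexGradient χ x) (g x)
      = (∫ x, inner ℂ (χ x • γ x) (g x))
        + ∑ i, ∫ x, inner ℂ (φ x) (partialDeriv i χ x • g x i) := by
    rw [← integral_finsetSum _ fun i _ => iD i, ← integral_add iA (integrable_finsetSum _
      fun i _ => iD i)]
    congr 1
    ext x
    rw [inner_add_left]
    congr 1
    simp only [PiLp.inner_apply, PiLp.smul_apply, complexGradient, partialDeriv,
      RCLike.inner_apply, smul_eq_mul, Complex.real_smul, map_mul, Complex.conj_ofReal]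
    exact Finset.sum_congr rfl fun i _ => by ring
  -- Integration by parts moves the derivative from `φ` to `∂ᵢχ u`, producing the Laplacian of `χ`
  -- and the second copy of `∇χ · ∇u`.
  have e3 : ∀ i, ∫ x, inner ℂ (γ x i) (partialDeriv i χ x • u x)
      = - ∫ x, inner ℂ (φ x) (partialDeriv i χ x • g x i
        + partialDeriv i (partialDeriv i χ) x • u x) := by
    intro i
    obtain ⟨ρ, -, hρ⟩ := exists_support_subset_closedBall (hηc i)
    have := hφ.integral_inner_grad (hu.cutoff (hη i) (hηc i)) (ρ := ρ) (fun x hx => hρ x fun h =>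
      hx (by rw [h, zero_smul])) i
    rw [← neg_eq_iff_eq_neg, ← this]
    congr 1
    ext x
    simp only [PiLp.add_apply, PiLp.smul_apply, complexGradient, partialDeriv, smul_eq_mul,
      Complex.real_smul, mul_comm (u x)]
  have e4 : ∫ x, inner ℂ (φ x) (cutoffSource χ u g x)
      = - ∑ i, ((∫ x, inner ℂ (φ x) (partialDeriv i χ x • g x i))
        + ∫ x, inner ℂ (φ x) (partialDeriv i χ x • g x i
          + partialDeriv i (partialDeriv i χ) x • u x)) := by
    simp only [cutoffSource, inner_neg_right, inner_sum, integral_neg]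
    rw [integral_finsetSum _ fun i _ => iF i]
    congr 1
    refine Finset.sum_congr rfl fun i _ => ?_
    rw [← integral_add (iD i) (iE i)]
    simp only [inner_add_right]
  have e5 : ∫ x, inner ℂ (χ x • φ x) (u x) = ∫ x, inner ℂ (φ x) (χ x • u x) := by
    congr 1
    ext x
    simp only [RCLike.inner_apply, Complex.real_smul, map_mul, Complex.conj_ofReal]
    ring
  have e6 : ∫ x, (V x : ℂ) * (conj (χ x • φ x) * u x)
      = ∫ x, (V x : ℂ) * (conj (φ x) * (χ x • u x)) := by
    congr 1
    ext x
    simp only [Complex.real_smul, map_mul, Complex.conj_ofReal]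
    ring
  rw [e2, e5, e6] at t
  rw [e1, e4]
  simp only [e3, Finset.sum_neg_distrib, Finset.sum_add_distrib]
  simp only [Pi.zero_apply, inner_zero_right, integral_zero, add_zero] at t
  linear_combination t

theorem partialDeriv_comp_smul {η : E d → ℝ} (hη : ContDiff ℝ ∞ η) (c a : ℝ) (i : Fin d) :
    partialDeriv i (fun x => a * η (c • x)) = fun x => (a * c) * partialDeriv i η (c • x) := by
  ext x
  have h1 : HasFDerivAt (fun x : E d => η (c • x))
      ((fderiv ℝ η (c • x)).comp (c • ContinuousLinearMap.id ℝ (E d))) x :=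
    (hη.differentiable (by simp) (c • x)).hasFDerivAt.comp x ((hasFDerivAt_id x).const_smul c)
  have h2 := (h1.const_mul a).fderiv
  rw [partialDeriv, h2]
  simp [partialDeriv]
  ring

theorem partialDeriv_eq_zero_of_eventuallyEq_const {η : E d → ℝ} {x : E d} {c : ℝ}
    (h : η =ᶠ[𝓝 x] fun _ => c) (i : Fin d) : partialDeriv i η =ᶠ[𝓝 x] fun _ => 0 := by
  filter_upwards [h.eventuallyEq_nhds] with y hy
  rw [partialDeriv, hy.fderiv_eq]
  simp

/-- Cutoff functions with uniformly controlled derivatives. -/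
theorem exists_cutoff (d : ℕ) : ∃ (K : ℝ) (χ : ℕ → E d → ℝ), 1 ≤ K ∧ ∀ n, ContDiff ℝ ∞ (χ n) ∧
    HasCompactSupport (χ n) ∧ (∀ x, |χ n x - 1| ≤ K) ∧
    (∀ x, ‖x‖ < n + 1 → χ n x = 1 ∧ ∀ i, partialDeriv i (χ n) x = 0 ∧
      partialDeriv i (partialDeriv i (χ n)) x = 0) ∧
    (∀ x i, (‖x‖ + 1) * |partialDeriv i (χ n) x| ≤ K ∧
      (‖x‖ + 1) * |partialDeriv i (partialDeriv i (χ n)) x| ≤ K) := by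
  let η : ContDiffBump (0 : E d) := ⟨1, 2, one_pos, one_lt_two⟩
  have hη : ContDiff ℝ ∞ η := η.contDiff
  have hηc : HasCompactSupport η := η.hasCompactSupport
  have h1 : ∀ i : Fin d, ∃ M, ∀ x, ‖partialDeriv i η x‖ ≤ M := fun i =>
    (contDiff_partialDeriv hη i).continuous.bounded_above_of_compact_support
      (hasCompactSupport_partialDeriv hηc i)
  have h2 : ∀ i : Fin d, ∃ M, ∀ x, ‖partialDeriv i (partialDeriv i η) x‖ ≤ M := fun i =>
    (contDiff_partialDeriv (contDiff_partialDeriv hη i) i).continuous.bounded_above_of_compact_support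
      (hasCompactSupport_partialDeriv (hasCompactSupport_partialDeriv hηc i) i)
  choose M1 hM1 using h1
  choose M2 hM2 using h2
  set M : ℝ := 1 + ∑ i, (|M1 i| + |M2 i|) with hM
  have hM0 : 1 ≤ M := by
    have : 0 ≤ ∑ i, (|M1 i| + |M2 i|) := Finset.sum_nonneg fun i _ => by positivity
    linarith
  have hMi : ∀ i, |M1 i| + |M2 i| ≤ M := fun i => by
    have := Finset.single_le_sum (f := fun i => |M1 i| + |M2 i|) (fun i _ => by positivity)
      (Finset.mem_univ i)
    linarith
  have b1 : ∀ i x, |partialDeriv i η x| ≤ M := fun i x =>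
    (hM1 i x).trans ((le_abs_self _).trans (by linarith [hMi i, abs_nonneg (M2 i)]))
  have b2 : ∀ i x, |partialDeriv i (partialDeriv i η) x| ≤ M := fun i x =>
    (hM2 i x).trans ((le_abs_self _).trans (by linarith [hMi i, abs_nonneg (M1 i)]))
  have hz1 : ∀ i x, 2 < ‖x‖ → partialDeriv i η x = 0 ∧
      partialDeriv i (partialDeriv i η) x = 0 := by
    intro i x hx
    have he : (η : E d → ℝ) =ᶠ[𝓝 x] fun _ => 0 := by
      filter_upwards [(isOpen_lt continuous_const continuous_norm).mem_nhds hx] with y hy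
      refine η.zero_of_le_dist ?_
      rw [dist_zero_right]
      exact le_of_lt hy
    have h3 := partialDeriv_eq_zero_of_eventuallyEq_const he i
    exact ⟨h3.eq_of_nhds, (partialDeriv_eq_zero_of_eventuallyEq_const h3 i).eq_of_nhds⟩
  have hz2 : ∀ i x, ‖x‖ < 1 → partialDeriv i η x = 0 ∧
      partialDeriv i (partialDeriv i η) x = 0 := by
    intro i x hx
    have he : (η : E d → ℝ) =ᶠ[𝓝 x] fun _ => 1 := by
      filter_upwards [(isOpen_lt continuous_norm continuous_const).mem_nhds hx] with y hy
      exact η.one_of_mem_closedBall (mem_closedBall_zero_iff.2 (le_of_lt hy))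
    have h3 := partialDeriv_eq_zero_of_eventuallyEq_const he i
    exact ⟨h3.eq_of_nhds, (partialDeriv_eq_zero_of_eventuallyEq_const h3 i).eq_of_nhds⟩
  -- Each derivative of `η(x/(n+1))` gains `1/(n+1)`. Where derivatives can be nonzero `|x| ≤
  -- 2(n+1)`, hence `(|x| + 1)/(n + 1) ≤ 3`.
  refine ⟨3 * M, fun n x => η (((n : ℝ) + 1)⁻¹ • x), by linarith, fun n => ?_⟩
  set c : ℝ := ((n : ℝ) + 1)⁻¹ with hc
  have hn0 : (0 : ℝ) < (n : ℝ) + 1 := by positivity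
  have hn1 : (1 : ℝ) ≤ (n : ℝ) + 1 := by linarith [(Nat.cast_nonneg n : (0 : ℝ) ≤ n)]
  have hc0 : 0 < c := inv_pos.2 hn0
  have hc1 : c ≤ 1 := inv_le_one_of_one_le₀ hn1
  have hcn : c * ((n : ℝ) + 1) = 1 := inv_mul_cancel₀ hn0.ne'
  have d1 : ∀ i, partialDeriv i (fun x => η (c • x)) = fun x => c * partialDeriv i η (c • x) := by
    intro i
    simpa using partialDeriv_comp_smul hη c 1 i
  have d2 : ∀ i, partialDeriv i (partialDeriv i (fun x => η (c • x)))
      = fun x => (c * c) * partialDeriv i (partialDeriv i η) (c • x) := by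
    intro i
    rw [d1 i]
    exact partialDeriv_comp_smul (contDiff_partialDeriv hη i) c c i
  have hnorm : ∀ x : E d, ‖c • x‖ = c * ‖x‖ := fun x => by
    rw [norm_smul, Real.norm_of_nonneg hc0.le]
  have hbd : ∀ x : E d, ‖c • x‖ ≤ 2 → (‖x‖ + 1) * c ≤ 3 := by
    intro x hx
    rw [hnorm] at hx
    linarith
  refine ⟨hη.comp (contDiff_const_smul c),
    hηc.comp_homeomorph (Homeomorph.smulOfNeZero c hc0.ne'), fun x => ?_, fun x hx => ?_,
    fun x i => ?_⟩
  · have l1 := η.nonneg (x := c • x)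
    have l2 := η.le_one (x := c • x)
    rw [abs_le]
    constructor <;> linarith
  · have hx1 : ‖c • x‖ < 1 := by
      rw [hnorm, ← hcn]
      gcongr
    refine ⟨η.one_of_mem_closedBall (mem_closedBall_zero_iff.2 hx1.le), fun i => ?_⟩
    rw [d2, d1]
    simp only [hz2 i _ hx1, mul_zero, and_self]
  · rw [d2, d1]
    by_cases hx : ‖c • x‖ ≤ 2
    · have h3 := hbd x hx
      have hp : 0 ≤ (‖x‖ + 1) * c := by positivity
      constructor
      · rw [abs_mul, abs_of_pos hc0, ← mul_assoc]
        exact mul_le_mul h3 (b1 i _) (abs_nonneg _) (by norm_num)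
      · rw [abs_mul, abs_of_pos (by positivity : 0 < c * c), ← mul_assoc, ← mul_assoc]
        refine mul_le_mul ?_ (b2 i _) (abs_nonneg _) (by norm_num)
        calc (‖x‖ + 1) * c * c ≤ (‖x‖ + 1) * c * 1 := by gcongr
          _ ≤ 3 := by linarith
    · push Not at hx
      simp only [hz1 i _ hx, mul_zero, abs_zero]
      constructor <;> linarith

end Cutoff

/-! ### Localization, the repulsive case, and weak solutions from eigenfunctions. -/

section Repulsive

variable {d : ℕ} {u : E d → ℂ} {g : E d → EuclideanSpace ℂ (Fin d)} {V : E d → ℝ} {G : E d → E d}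

theorem norm_complexGradient_le {χ : E d → ℝ} {x : E d} {K : ℝ}
    (h : ∀ i, |partialDeriv i χ x| ≤ K) : ‖complexGradient χ x‖ ≤ d * K := by
  have e : complexGradient χ x
      = ∑ i, EuclideanSpace.single i ((partialDeriv i χ x : ℝ) : ℂ) := by
    ext j
    simp [complexGradient, partialDeriv, Finset.sum_apply]
  rw [e]
  refine (norm_sum_le _ _).trans ((Finset.sum_le_card_nsmul _ _ K fun i _ => ?_).trans ?_)
  · simpa using h i
  · simp

/-- The weight `‖x‖ + 1` controls the source and its product with `|x|` at once; the decay of the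
derivatives of the cutoff pays for it. -/
theorem norm_cutoffSource_le {χ : E d → ℝ} {x : E d} {K : ℝ} (hK : 0 ≤ K)
    (h : ∀ i, (‖x‖ + 1) * |partialDeriv i χ x| ≤ K ∧
      (‖x‖ + 1) * |partialDeriv i (partialDeriv i χ) x| ≤ K) :
    (‖x‖ + 1) * ‖cutoffSource χ u g x‖ ≤ d * (2 * K * (‖g x‖ + ‖u x‖)) := by
  have hx : 0 ≤ ‖x‖ + 1 := by positivity
  rw [cutoffSource, norm_neg]
  refine (mul_le_mul_of_nonneg_left (norm_sum_le _ _) hx).trans ?_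
  rw [Finset.mul_sum]
  refine (Finset.sum_le_card_nsmul _ _ (2 * K * (‖g x‖ + ‖u x‖)) fun i _ => ?_).trans (by simp)
  have h1 := norm_add_le (partialDeriv i χ x • g x i)
    (partialDeriv i χ x • g x i + partialDeriv i (partialDeriv i χ) x • u x)
  have h2 := norm_add_le (partialDeriv i χ x • g x i) (partialDeriv i (partialDeriv i χ) x • u x)
  simp only [norm_smul, Real.norm_eq_abs] at h1 h2
  have hgi : ‖g x i‖ ≤ ‖g x‖ := PiLp.norm_apply_le _ i
  have h3 : (‖x‖ + 1) * (|partialDeriv i χ x| * ‖g x i‖) ≤ K * ‖g x‖ := by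
    rw [← mul_assoc]
    exact mul_le_mul (h i).1 hgi (norm_nonneg _) hK
  have h4 : (‖x‖ + 1) * (|partialDeriv i (partialDeriv i χ) x| * ‖u x‖) ≤ K * ‖u x‖ := by
    rw [← mul_assoc]
    exact mul_le_mul_of_nonneg_right (h i).2 (norm_nonneg _)
  have h5 := mul_le_mul_of_nonneg_left (h1.trans (add_le_add_right h2 _)) hx
  have h6 : 0 ≤ K * ‖u x‖ := by positivity
  linarith

/-- The tails of a square-integrable function tend to zero. -/
theorem tendsto_eLpNorm_tail {F : Type*} [NormedAddCommGroup F] {w : E d → F}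
    (hw : MemLp w 2 volume) :
    Tendsto (fun n : ℕ => eLpNorm ({x : E d | (n : ℝ) + 1 ≤ ‖x‖}.indicator w) 2 volume)
      atTop (𝓝 0) := by
  have hms : ∀ n : ℕ, MeasurableSet {x : E d | (n : ℝ) + 1 ≤ ‖x‖} := fun n =>
    measurableSet_le measurable_const measurable_norm
  have h2 : Tendsto (fun n : ℕ =>
      ∫⁻ x, ‖{x : E d | (n : ℝ) + 1 ≤ ‖x‖}.indicator w x‖ₑ ^ 2) atTop (𝓝 (∫⁻ _ : E d, 0)) := by
    refine tendsto_lintegral_of_dominated_convergence' (fun x => ‖w x‖ₑ ^ 2)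
      (fun n => ((hw.1.indicator (hms n)).enorm.pow_const 2)) (fun n => ?_) ?_ ?_
    · refine Eventually.of_forall fun x => ?_
      exact pow_le_pow_left₀ zero_le (enorm_indicator_le_enorm_self w x) 2
    · rw [← eLpNorm_two_sq]
      exact ENNReal.pow_ne_top hw.2.ne
    · refine Eventually.of_forall fun x => ?_
      refine tendsto_const_nhds.congr' ?_
      obtain ⟨N, hN⟩ := exists_nat_gt ‖x‖
      filter_upwards [eventually_ge_atTop N] with n hn
      have hnN : (N : ℝ) ≤ n := by exact_mod_cast hn
      rw [Set.indicator_of_notMem]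
      · simp
      · simp only [Set.mem_ofPred_eq, not_le]
        linarith
  simp only [← eLpNorm_two_sq, lintegral_zero] at h2
  have h3 := h2.ennrpow_const (1 / 2 : ℝ)
  rw [ENNReal.zero_rpow_of_pos (by norm_num)] at h3
  refine h3.congr fun n => ?_
  rw [← ENNReal.rpow_natCast, ← ENNReal.rpow_mul]
  norm_num

/-- A weak solution is approximated by compactly supported solutions of inhomogeneous equations
whose sources tend to zero, also with the weight `|x|`. -/
theorem IsWeakSolution.exists_localization {μ : ℝ} (hs : IsWeakSolution V μ u g 0)
    (hu : IsH1 u g) : ∃ (U : ℝ≥0∞) (ε : ℕ → ℝ≥0∞), U ≠ ⊤ ∧ (∀ n, ε n ≠ ⊤) ∧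
      Tendsto ε atTop (𝓝 0) ∧ ∀ n, ∃ (v : E d → ℂ) (h : E d → EuclideanSpace ℂ (Fin d))
        (f : E d → ℂ), IsH1 v h ∧ IsWeakSolution V μ v h f ∧ MemLp f 2 volume ∧
        (∃ ρ : ℝ, 0 ≤ ρ ∧ ∀ x, v x ≠ 0 → ‖x‖ ≤ ρ) ∧ eLpNorm v 2 volume ≤ U ∧
        eLpNorm f 2 volume ≤ ε n ∧ eLpNorm (fun x => ‖x‖ • f x) 2 volume ≤ ε n ∧
        eLpNorm (fun x => g x - h x) 2 volume ≤ ε n := by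
  obtain ⟨K, χ, hK1, hχ⟩ := exists_cutoff d
  have hK : 0 ≤ K := by linarith
  -- A single `L²` majorant for the weighted source and for the gradient error. Both vanish for `|x|
  -- < n + 1`, so the tail norms of `w` serve as `ε n`.
  set w : E d → ℝ := fun x => 2 * (d + 1) * K * (‖g x‖ + ‖u x‖) with hw
  have hwL : MemLp w 2 volume := (hu.memLp_grad.norm.add hu.memLp.norm).const_mul _
  have hw0 : ∀ x, 0 ≤ w x := fun x => by positivity
  refine ⟨ENNReal.ofReal (K + 1) * eLpNorm u 2 volume, _,
    ENNReal.mul_ne_top ENNReal.ofReal_ne_top hu.memLp.2.ne,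
    fun n => (hwL.indicator (measurableSet_le measurable_const measurable_norm)).2.ne,
    tendsto_eLpNorm_tail hwL, fun n => ?_⟩
  obtain ⟨hsm, hc, hb, hnear, hfar⟩ := hχ n
  have hf : ∀ x, (‖x‖ + 1) * ‖cutoffSource (χ n) u g x‖
      ≤ ‖{x : E d | (n : ℝ) + 1 ≤ ‖x‖}.indicator w x‖ := by
    intro x
    by_cases hx : (n : ℝ) + 1 ≤ ‖x‖
    · rw [Set.indicator_of_mem (by exact hx), Real.norm_of_nonneg (hw0 x)]
      refine (norm_cutoffSource_le hK (hfar x)).trans ?_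
      have : 0 ≤ K * (‖g x‖ + ‖u x‖) := by positivity
      simp only [hw]
      linarith
    · push Not at hx
      rw [Set.indicator_of_notMem (by simpa using hx), cutoffSource]
      simp [((hnear x hx).2 _).1, ((hnear x hx).2 _).2]
  have hg : ∀ x, ‖g x - (χ n x • g x + u x • complexGradient (χ n) x)‖
      ≤ ‖{x : E d | (n : ℝ) + 1 ≤ ‖x‖}.indicator w x‖ := by
    intro x
    by_cases hx : (n : ℝ) + 1 ≤ ‖x‖
    · rw [Set.indicator_of_mem (by exact hx), Real.norm_of_nonneg (hw0 x)]
      have e : g x - (χ n x • g x + u x • complexGradient (χ n) x)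
          = -((χ n x - 1) • g x) - u x • complexGradient (χ n) x := by
        rw [sub_smul, one_smul]
        abel
      have h1 : ∀ i, |partialDeriv i (χ n) x| ≤ K := fun i => by
        have := (hfar x i).1
        have h0 : 0 ≤ ‖x‖ * |partialDeriv i (χ n) x| := by positivity
        linarith
      rw [e]
      refine (norm_sub_le _ _).trans ?_
      rw [norm_neg, norm_smul, norm_smul, Real.norm_eq_abs]
      have h2 : |χ n x - 1| * ‖g x‖ ≤ K * ‖g x‖ := by gcongr; exact hb x
      have h3 : ‖u x‖ * ‖complexGradient (χ n) x‖ ≤ ‖u x‖ * (d * K) := by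
        gcongr
        exact norm_complexGradient_le h1
      have h4 : 0 ≤ K * ‖g x‖ := by positivity
      have h5 : 0 ≤ K * ‖u x‖ := by positivity
      have h6 : 0 ≤ d * (K * ‖g x‖) := by positivity
      have h7 : 0 ≤ d * (K * ‖u x‖) := by positivity
      simp only [hw]
      nlinarith
    · push Not at hx
      have h0 : complexGradient (χ n) x = 0 := by
        ext i
        have := ((hnear x hx).2 i).1
        rw [partialDeriv] at this
        simp [complexGradient, this]
      rw [(hnear x hx).1, h0]
      simp
  refine ⟨_, _, _, hu.cutoff hsm hc, hs.cutoff hu hsm hc, memLp_cutoffSource hsm hc hu, ?_, ?_,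
    eLpNorm_mono fun x => ?_, eLpNorm_mono fun x => ?_, eLpNorm_mono hg⟩
  · obtain ⟨ρ, h0, hρ⟩ := exists_support_subset_closedBall hc
    exact ⟨ρ, h0, fun x hx => hρ x fun h => hx (by rw [h, zero_smul])⟩
  · refine eLpNorm_le_mul_eLpNorm_of_ae_le_mul (Eventually.of_forall fun x => ?_) 2
    rw [norm_smul, Real.norm_eq_abs]
    gcongr
    have := hb x
    rw [abs_le] at this ⊢
    constructor <;> linarith
  · refine le_trans ?_ (hf x)
    have h0 : 0 ≤ ‖x‖ * ‖cutoffSource (χ n) u g x‖ := by positivity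
    linarith
  · refine le_trans ?_ (hf x)
    rw [norm_smul, norm_norm]
    linarith [norm_nonneg (cutoffSource (χ n) u g x)]

/-- The negative part of `W` only lowers the integral, so a form bound on the positive part is
enough. -/
theorem re_integral_weight_le {W : E d → ℝ} {b : ℝ≥0} (hWm : StronglyMeasurable W)
    (hb : ∫⁻ x, ENNReal.ofReal (max (W x) 0) * ‖u x‖ₑ ^ 2 ≤ b * eLpNorm g 2 volume ^ 2)
    (hu : IsH1 u g) :
    (∫ x, (W x : ℂ) * (conj (u x) * u x)).re ≤ b * (eLpNorm g 2 volume).toReal ^ 2 := by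
  have e1 : ∀ x, (W x : ℂ) * (conj (u x) * u x) = ((W x * ‖u x‖ ^ 2 : ℝ) : ℂ) := fun x => by
    rw [mul_comm (conj (u x)), Complex.mul_conj, Complex.normSq_eq_norm_sq]
    push_cast
    rfl
  simp only [e1]
  rw [integral_complex_ofReal, Complex.ofReal_re]
  have hm : Measurable fun x => max (W x) 0 * ‖u x‖ ^ 2 :=
    (hWm.measurable.max measurable_const).mul (hu.meas.measurable.norm.pow_const 2)
  have e2 : ∀ x, ENNReal.ofReal (max (W x) 0 * ‖u x‖ ^ 2)
      = ENNReal.ofReal (max (W x) 0) * ‖u x‖ₑ ^ 2 := fun x => by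
    rw [ENNReal.ofReal_mul (le_max_right _ _), ENNReal.ofReal_pow (norm_nonneg _), ofReal_norm]
  have htop : (b : ℝ≥0∞) * eLpNorm g 2 volume ^ 2 ≠ ⊤ :=
    ENNReal.mul_ne_top (by simp) (ENNReal.pow_ne_top hu.memLp_grad.2.ne)
  have hnn : ∀ x, 0 ≤ max (W x) 0 * ‖u x‖ ^ 2 := fun x => by positivity
  have hint : Integrable (fun x => max (W x) 0 * ‖u x‖ ^ 2) volume := by
    refine (lintegral_ofReal_ne_top_iff_integrable hm.aestronglyMeasurable
      (Eventually.of_forall hnn)).1 ?_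
    simp only [e2]
    exact ne_top_of_le_ne_top htop hb
  have h1 : ∫ x, W x * ‖u x‖ ^ 2 ≤ ∫ x, max (W x) 0 * ‖u x‖ ^ 2 := by
    by_cases hi : Integrable (fun x => W x * ‖u x‖ ^ 2) volume
    · refine integral_mono hi hint fun x => ?_
      gcongr
      exact le_max_left _ _
    -- If the signed integrand is not integrable its integral is zero by convention, and the bound
    -- is trivial.
    · rw [integral_undef hi]
      exact integral_nonneg hnn
  refine h1.trans ?_
  rw [integral_eq_lintegral_of_nonneg_ae (Eventually.of_forall hnn) hm.aestronglyMeasurable]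
  simp only [e2]
  refine (ENNReal.toReal_mono htop hb).trans (le_of_eq ?_)
  rw [ENNReal.toReal_mul, ENNReal.toReal_pow, ENNReal.coe_toReal]

/-- Virial inequality for compactly supported solutions of an inhomogeneous equation. -/
theorem IsWeakSolution.virial_le {f : E d → ℂ} {μ : ℝ} (hs : IsWeakSolution V μ u g f)
    (hV : IsAdmissible V) (hG : HasWeakGradient V G) (hGm : StronglyMeasurable G) (hu : IsH1 u g)
    {C : ℝ≥0∞} {ρ : ℝ} (hρ : 0 ≤ ρ) (hC : C ≠ ⊤)
    (hW : IsLocallyFormBounded (fun x => inner ℝ x (G x)) (2 * ρ) C)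
    (hsupp : ∀ x, u x ≠ 0 → ‖x‖ ≤ ρ) {b : ℝ≥0}
    (hb : ∫⁻ x, ENNReal.ofReal (max (inner ℝ x (G x)) 0) * ‖u x‖ₑ ^ 2
      ≤ b * eLpNorm g 2 volume ^ 2)
    (hf : MemLp f 2 volume) (hxf : eLpNorm (fun x => ‖x‖ • f x) 2 volume ≠ ⊤) :
    2 * (eLpNorm g 2 volume).toReal ^ 2 ≤ b * (eLpNorm g 2 volume).toReal ^ 2
      + (2 * ((eLpNorm g 2 volume).toReal * (eLpNorm (fun x => ‖x‖ • f x) 2 volume).toReal)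
        + d * ((eLpNorm u 2 volume).toReal * (eLpNorm f 2 volume).toReal)) := by
  have hWm : StronglyMeasurable fun x : E d => (inner ℝ x (G x) : ℝ) :=
    stronglyMeasurable_id.inner hGm
  have h1 := re_integral_weight_le hWm hb hu
  have h2 : |(∫ x, inner ℂ (u x) (f x)).re|
      ≤ (eLpNorm u 2 volume).toReal * (eLpNorm f 2 volume).toReal := by
    rw [← ENNReal.toReal_mul]
    exact abs_re_integral_inner_le (ENNReal.mul_ne_top hu.memLp.2.ne hf.2.ne)
      (lintegral_enorm_mul_le hu.memLp.1 hf.1)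
  -- The slack `ε` provides the positivity and the strict inequality that
  -- `eventually_potential_term_le` demands of `M`.
  refine le_of_forall_pos_le_add fun ε hε => ?_
  have h3 := eventually_potential_term_le hV hG hGm hu hρ hC hW hsupp
    (M := b * (eLpNorm g 2 volume).toReal ^ 2 + ε) (by positivity) (by linarith)
  refine (two_mul_sq_le_of_virial hu (M := (b * (eLpNorm g 2 volume).toReal ^ 2 + ε)
    + (2 * ((eLpNorm g 2 volume).toReal * (eLpNorm (fun x => ‖x‖ • f x) 2 volume).toReal)
        + d * ((eLpNorm u 2 volume).toReal * (eLpNorm f 2 volume).toReal))) ?_).trans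
    (le_of_eq (by ring))
  filter_upwards [self_mem_nhdsWithin, h3] with r hr h4
  have hr1 : 1 ≤ r := le_of_lt hr
  have hr10 : 0 ≤ r - 1 := sub_nonneg.2 hr1
  rw [hs.virial hu (by linarith)]
  have h5 := le_of_abs_le (abs_dilation_difference_le hu hf.1
    (fun φ γ hφ => integrable_inner hφ.memLp hf) hxf hr1)
  have h6 : (r - 1) * (2 * ((eLpNorm g 2 volume).toReal
      * (eLpNorm (fun x => ‖x‖ • f x) 2 volume).toReal) + d * |(∫ x, inner ℂ (u x) (f x)).re|)
      ≤ (r - 1) * (2 * ((eLpNorm g 2 volume).toReal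
        * (eLpNorm (fun x => ‖x‖ • f x) 2 volume).toReal)
        + d * ((eLpNorm u 2 volume).toReal * (eLpNorm f 2 volume).toReal)) := by gcongr
  rw [mul_add]
  linarith

theorem locMemLp_inner_id {p : ℝ≥0∞} (hGm : StronglyMeasurable G) (hG : LocMemLp G p) :
    LocMemLp (fun x : E d => (inner ℝ x (G x) : ℝ)) p := by
  intro K hK
  obtain ⟨R, hR⟩ := hK.isBounded.subset_closedBall 0
  refine MemLp.of_le_mul (c := R) (hG K hK)
    (stronglyMeasurable_id.inner hGm).aestronglyMeasurable ?_
  filter_upwards [ae_restrict_mem hK.measurableSet] with x hx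
  refine (norm_inner_le_norm _ _).trans ?_
  gcongr
  exact mem_closedBall_zero_iff.1 (hR hx)

/-- The virial inequality is applied to the localized solutions. Their sources tend to zero with the
weight `|x|`, and the limit reads `2 ‖∇u‖² ≤ b ‖∇u‖²` with `b < 2`. -/
theorem eq_zero_of_repulsive_of_stronglyMeasurable (hd : 1 ≤ d) (hV : IsAdmissible V)
    (hG : ExtraRegularity V G) (hGm : StronglyMeasurable G) (hrep : Repulsive G) {μ : ℝ}
    (hu : IsH1 u g) (hs : IsWeakSolution V μ u g 0) : u =ᵐ[volume] 0 := by
  obtain ⟨p, h1, h2, h3, hwG, -, hGp⟩ := hG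
  obtain ⟨b, hb2, hb⟩ := hrep
  obtain ⟨U, ε, hU, hε, hε0, H⟩ := hs.exists_localization hu
  choose v h f hv hvs hf hsupp hvU hfε hxf hgh using H
  have hWm : StronglyMeasurable fun x : E d => (inner ℝ x (G x) : ℝ) :=
    stronglyMeasurable_id.inner hGm
  set a : ℕ → ℝ := fun n => (eLpNorm (h n) 2 volume).toReal with ha
  set e : ℕ → ℝ := fun n => (ε n).toReal with he
  have he0 : Tendsto e atTop (𝓝 0) := by
    exact (ENNReal.tendsto_toReal ENNReal.zero_ne_top).comp hε0
  have key : ∀ n, 2 * a n ^ 2 ≤ b * a n ^ 2 + (2 * (a n * e n) + d * (U.toReal * e n)) := by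
    intro n
    obtain ⟨ρ, hρ, hsp⟩ := hsupp n
    -- The constant `C` may grow with `n`. It serves only to justify the limit `r ↓ 1` and does not
    -- appear in the resulting inequality.
    obtain ⟨C, hC, hWC⟩ := exists_local_form_bound hd h1 h2 h3 hWm
      (locMemLp_inner_id hGm hGp) (2 * ρ)
    refine ((hvs n).virial_le hV hwG hGm (hv n) hρ hC hWC hsp ((hv n).weightedMass_le hb)
      (hf n) (ne_top_of_le_ne_top (hε n) (hxf n))).trans ?_
    have t1 := ENNReal.toReal_mono (hε n) (hxf n)
    have t2 := ENNReal.toReal_mono (hε n) (hfε n)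
    have t3 := ENNReal.toReal_mono hU (hvU n)
    gcongr
  have hdist : ∀ n, |a n - (eLpNorm g 2 volume).toReal| ≤ e n := by
    intro n
    have m1 := hu.memLp_grad
    have m2 := (hv n).memLp_grad
    have s1 : eLpNorm g 2 volume ≤ ε n + eLpNorm (h n) 2 volume := by
      have := eLpNorm_add_le (m1.sub m2).1 m2.1 (p := 2) (by norm_num)
      rw [sub_add_cancel] at this
      exact this.trans (add_le_add_left (hgh n) _)
    have s2 : eLpNorm (h n) 2 volume ≤ ε n + eLpNorm g 2 volume := by
      have := eLpNorm_add_le (m2.sub m1).1 m1.1 (p := 2) (by norm_num)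
      rw [sub_add_cancel, eLpNorm_sub_comm] at this
      exact this.trans (add_le_add_left (hgh n) _)
    have r1 := ENNReal.toReal_mono (ENNReal.add_ne_top.2 ⟨hε n, m2.2.ne⟩) s1
    have r2 := ENNReal.toReal_mono (ENNReal.add_ne_top.2 ⟨hε n, m1.2.ne⟩) s2
    rw [ENNReal.toReal_add (hε n) m2.2.ne] at r1
    rw [ENNReal.toReal_add (hε n) m1.2.ne] at r2
    rw [abs_le]
    constructor <;> linarith
  have ha' : Tendsto a atTop (𝓝 (eLpNorm g 2 volume).toReal) := by
    rw [tendsto_iff_norm_sub_tendsto_zero]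
    exact squeeze_zero (fun _ => norm_nonneg _) hdist he0
  have hlim := le_of_tendsto_of_tendsto' ((ha'.pow 2).const_mul 2)
    (((ha'.pow 2).const_mul (b : ℝ)).add (((ha'.mul he0).const_mul 2).add
      ((he0.const_mul U.toReal).const_mul (d : ℝ)))) key
  simp only [mul_zero, add_zero] at hlim
  have hb2' : (b : ℝ) < 2 := by exact_mod_cast hb2
  have hn2 : (eLpNorm g 2 volume).toReal ^ 2 = 0 := by
    by_contra hne
    have hpos : 0 < (eLpNorm g 2 volume).toReal ^ 2 :=
      lt_of_le_of_ne (by positivity) (Ne.symm hne)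
    nlinarith
  have hg : eLpNorm g 2 volume = 0 := by
    rcases (ENNReal.toReal_eq_zero_iff _).1 (pow_eq_zero_iff (two_ne_zero) |>.1 hn2) with h | h
    · exact h
    · exact absurd h hu.memLp_grad.2.ne
  exact hu.weak.eq_zero_of_grad_eq_zero hd hu.meas hu.memLp
    ((eLpNorm_eq_zero_iff hu.memLp_grad.1 (by norm_num)).1 hg)

/-- All hypotheses on `G` are insensitive to null sets, so `G` may be replaced by a measurable
representative. -/
theorem eq_zero_of_repulsive (hd : 1 ≤ d) (hV : IsAdmissible V)
    (hG : ExtraRegularity V G) (hrep : Repulsive G) {μ : ℝ}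
    (hu : IsH1 u g) (hs : IsWeakSolution V μ u g 0) : u =ᵐ[volume] 0 := by
  obtain ⟨p, h1, h2, h3, hwG, hVp, hGp⟩ := hG
  obtain ⟨b, hb2, hb⟩ := hrep
  have hm := hwG.locallyIntegrable_grad.aestronglyMeasurable
  refine eq_zero_of_repulsive_of_stronglyMeasurable (G := hm.mk G) hd hV
    ⟨p, h1, h2, h3, hwG.congr (EventuallyEq.refl _ _) hm.ae_eq_mk, hVp, fun K hK =>
      (hGp K hK).ae_eq (ae_restrict_of_ae hm.ae_eq_mk)⟩
    hm.stronglyMeasurable_mk ⟨b, hb2, fun ψ => le_trans (le_of_eq ?_) (hb ψ)⟩ hu hs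
  exact lintegral_congr_ae (hm.ae_eq_mk.mono fun x hx => by simp only [hx])

/-- An eigenfunction is a weak solution with a real spectral parameter. -/
theorem exists_isWeakSolution_of_mem_pointSpectrum (hV : IsAdmissible V) {z : ℂ}
    (hz : z ∈ pointSpectrum (hamiltonian V hV)) :
    ∃ (μ : ℝ) (ψ : W12 d), (ψ : L2 d) ≠ 0 ∧ IsWeakSolution V μ (ψ : L2 d) (grad ψ) 0 := by
  obtain ⟨ψ₀, hne, hψ₀⟩ := hz
  have hmem : ((ψ₀ : L2 d), hamiltonian V hV ψ₀) ∈ hamiltonianGraph V hV := by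
    rw [← hamiltonian_graph hV]
    exact (hamiltonian V hV).mem_graph ψ₀
  obtain ⟨ψ, h1, h2⟩ := hmem
  simp only at h1 h2
  rw [hψ₀, ← h1] at h2
  rw [← h1] at hne
  -- Testing with `ψ` itself gives `h_V(ψ, ψ) = z ‖ψ‖²`, where the form value is real and `‖ψ‖² ≠
  -- 0`.
  have hreal : ((z.re : ℝ) : ℂ) = z := by
    have h3 := h2 ψ
    rw [inner_smul_right, energyForm, inner_self_eq_norm_sq_to_K, inner_self_eq_norm_sq_to_K] at h3
    have e1 : ∀ x, (V x : ℂ) * (conj ((ψ : L2 d) x) * (ψ : L2 d) x)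
        = ((V x * ‖(ψ : L2 d) x‖ ^ 2 : ℝ) : ℂ) := fun x => by
      rw [mul_comm (conj _), Complex.mul_conj, Complex.normSq_eq_norm_sq]
      push_cast
      rfl
    simp only [e1] at h3
    rw [integral_complex_ofReal] at h3
    have h4 : ‖(ψ : L2 d)‖ ^ 2 ≠ 0 := pow_ne_zero 2 (norm_ne_zero_iff.2 hne)
    have h5 := congrArg Complex.im h3
    have e2 : (((‖(ψ : L2 d)‖ : ℝ) : ℂ)) ^ 2 = ((‖(ψ : L2 d)‖ ^ 2 : ℝ) : ℂ) := by push_cast; rfl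
    have e3 : (((‖grad ψ‖ : ℝ) : ℂ)) ^ 2 = ((‖grad ψ‖ ^ 2 : ℝ) : ℂ) := by push_cast; rfl
    simp only [Complex.coe_algebraMap, e2, e3, Complex.add_im, Complex.ofReal_im, add_zero,
      Complex.im_mul_ofReal] at h5
    have h6 : z.im = 0 := by
      rcases mul_eq_zero.1 h5.symm with h | h
      · exact h
      · exact absurd h h4
    exact Complex.ext rfl h6.symm
  refine ⟨z.re, ψ, hne, fun φ γ hφ => ?_⟩
  obtain ⟨χ, hχ1, hχ2⟩ := hφ.exists_W12
  have h3 := h2 χ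
  rw [inner_smul_right, energyForm, L2.inner_def, L2.inner_def] at h3
  have c1 : ∫ x, inner ℂ (grad χ x) (grad ψ x) = ∫ x, inner ℂ (γ x) (grad ψ x) :=
    integral_congr_ae (hχ2.mono fun x hx => by simp only [hx])
  have c2 : ∫ x, (V x : ℂ) * (conj ((χ : L2 d) x) * (ψ : L2 d) x)
      = ∫ x, (V x : ℂ) * (conj (φ x) * (ψ : L2 d) x) :=
    integral_congr_ae (hχ1.mono fun x hx => by simp only [hx])
  have c3 : ∫ x, inner ℂ ((χ : L2 d) x) ((ψ : L2 d) x) = ∫ x, inner ℂ (φ x) ((ψ : L2 d) x) :=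
    integral_congr_ae (hχ1.mono fun x hx => by simp only [hx])
  rw [c1, c2, c3] at h3
  rw [h3, hreal]
  simp

end Repulsive

end Schrodinger

end

theorem mainTheorem4 (d : ℕ) (hd : 1 ≤ d) (V : Schrodinger.E d → ℝ)
    (hV : Schrodinger.IsAdmissible V)
    (h : (∃ G : Schrodinger.E d → Schrodinger.E d,
            Schrodinger.ExtraRegularity V G ∧ Schrodinger.Repulsive G) ∨
          Schrodinger.Small V) :
    Schrodinger.pointSpectrum (Schrodinger.hamiltonian V hV) = ∅ := by
  refine Set.eq_empty_iff_forall_notMem.2 fun z hz => ?_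
  obtain ⟨μ, ψ, hne, hs⟩ := Schrodinger.exists_isWeakSolution_of_mem_pointSpectrum hV hz
  refine hne ((MeasureTheory.Lp.eq_zero_iff_ae_eq_zero).2 ?_)
  rcases h with ⟨G, hG, hrep⟩ | hsm
  · exact Schrodinger.eq_zero_of_repulsive hd hV hG hrep (Schrodinger.IsH1.of_W12 ψ) hs
  · exact Schrodinger.eq_zero_of_small hd hV hsm (Schrodinger.IsH1.of_W12 ψ) hs
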